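/- Let $G$ be a countable infinite discrete group, $B$ a unital C*-algebra, $\mathbb K$ the compact operators on $\ell^2(\mathbb N)$, and $E$ a C*-algebra containing $B\otimes\mathbb K$ as an essential (closed, two-sided) ideal. Let $E\subset\mathbb B(H)$ be a faithful non-degenerate representation on a Hilbert space $H$ and $U\colon G\to U(\mathbb B(H))$ a unitary representation such that, for all $g\in G$, $U_gEU_g^*=E$, $U_g(B\otimes\mathbb K)U_g^*=B\otimes\mathbb K$ and $U_g(1_B\otimes e_0)=(1_B\otimes e_0)U_g=1_B\otimes e_0$, where $e_0\in\mathbb K$ is a minimal projection. Let $X=H\otimes\ell^2(G)\otimes E$ be the Hilbert $E$-$E$-bimodule with $\langle\zeta\otimes\delta_h\otimes x,\xi\otimes\delta_k\otimes y\rangle=\langle\zeta,\xi\rangle\,\delta_{h,k}\,x^*y$ (inner products are linear in the second variable) and $a(\zeta\otimes\delta_h\otimes x)b=a\zeta\otimes\delta_h\otimes xb$. Let $\mathcal F(X)=E\Omega\oplus\bigoplus_{k\ge1}X^{\otimes_E k}$ be its Fock module with vacuum $\Omega$, let $T_\zeta$ ($\zeta\in X$) be the creation operators, $T_\zeta(x\Omega)=\zeta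 x$ and $T_\zeta\eta=\zeta\otimes\eta$, and let $\mathcal T_X\subset\mathcal L_E(\mathcal F(X))$ be the Toeplitz–Pimsner algebra, i.e. the C*-algebra generated by all $T_\zeta$ and by $E$ acting on $\mathcal F(X)$ from the left. Then: 1. There is exactly one action $\Gamma$ of $G$ on $\mathcal T_X$ by $*$-automorphisms (the quasi-free action) with $\Gamma_g(T_{\zeta\otimes\delta_h\otimes x})=T_{U_g\zeta\otimes\delta_{gh}\otimes U_gxU_g^*}$ and $\Gamma_g(x)=U_gxU_g^*$ for $g,h\in G$, $\zeta\in H$, $x\in E$. It restricts to an action $\gamma^E$ on the corner $A_E:=(1_B\otimes e_0)\,\mathcal T_X\,(1_B\otimes e_0)$. 2. The fixed point algebra of $\gamma^E$ is $A_E^{\gamma^E}=\iota(B)$, where $\iota(b)=b\otimes e_0\in E\subset\mathcal T_X$. 3. The vacuum compression is a $G$-equivariant conditional expectation $\Phi\colon A_E\to A_E^{\gamma^E}$. Here $\Phi(T)=\langle\Omega,T\Omega\rangle$ is the element of $E$ determined by $\langle a\Omega,T(b\Omega)\rangle_{\mathcal F(X)}=a^*\,\Phi(T)\,b$ for all $a,b\in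 E$. In particular it takes values in $\iota(B)$, and it is a positive contractive linear projection onto $\iota(B)$ with $\Phi(dT)=d\Phi(T)$ and $\Phi(Td)=\Phi(T)d$ for $d\in\iota(B)$. -/

import Mathlib

open scoped TensorProduct InnerProductSpace

set_option linter.unusedSectionVars false

universe u v w

/-- A selfadjoint `a` has a "negative part" `n`, with `n a n = - n³ ≤ 0`; if it vanishes then
`a` is of the form `s⋆ s`. -/
lemma exists_negPart {R : Type*} [NonUnitalCStarAlgebra R] {a : R} (ha : IsSelfAdjoint a) :
    ∃ n d : R, star n = n ∧ n * a * n = -(star d * d) ∧ n * n * n = star d * d ∧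
      (n = 0 → ∃ s, a = star s * s) := by
  let := CStarAlgebra.spectralOrder R
  have := CStarAlgebra.spectralOrderedRing R
  have hN : 0 ≤ a⁻ := CFC.negPart_nonneg a
  have hNs : star a⁻ = a⁻ := (IsSelfAdjoint.of_nonneg hN).star_eq
  have h3 : 0 ≤ a⁻ * a⁻ * a⁻ := by
    have := star_left_conjugate_nonneg hN a⁻
    rwa [hNs] at this
  obtain ⟨d, hd⟩ := CStarAlgebra.nonneg_iff_eq_star_mul_self.1 h3
  refine ⟨a⁻, d, hNs, ?_, hd, fun h0 => ?_⟩
  · have h1 : a⁺ * a⁻ = 0 := CFC.posPart_mul_negPart a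
    rw [← hd]
    nth_rw 2 [← CFC.posPart_sub_negPart a ha]
    rw [mul_assoc, sub_mul, h1, zero_sub, mul_neg, mul_assoc]
  · refine CStarAlgebra.nonneg_iff_eq_star_mul_self.1 ?_
    rw [← CFC.posPart_sub_negPart a ha, h0, sub_zero]
    exact CFC.posPart_nonneg a

/-- A pre-Hilbert `A`-`A`-bimodule: the right action is `rmul v a = v a`, the left action is
`lmul a v = a v`, and the `A`-valued inner product `ip` is linear in the second variable. -/
structure PreCorr (A : Type u) (V : Type v) [NonUnitalCStarAlgebra A] [PartialOrder A]
    [AddCommGroup V] [Module ℂ V] where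
  ip : V → V →ₗ[ℂ] A
  rmul : V →ₗ[ℂ] A →ₗ[ℂ] V
  lmul : A →ₗ[ℂ] V →ₗ[ℂ] V
  star_ip : ∀ v w, star (ip v w) = ip w v
  ip_nonneg : ∀ v, 0 ≤ ip v v
  ip_rmul : ∀ v w a, ip v (rmul w a) = ip v w * a
  rmul_mul : ∀ v a b, rmul v (a * b) = rmul (rmul v a) b
  lmul_mul : ∀ a b v, lmul (a * b) v = lmul a (lmul b v)
  ip_lmul : ∀ a v w, ip (lmul a v) w = ip v (lmul (star a) w)
  lmul_rmul : ∀ a v b, lmul a (rmul v b) = rmul (lmul a v) b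

namespace PreCorr

section Basic

variable {A : Type u} {V : Type v} [NonUnitalCStarAlgebra A] [PartialOrder A]
    [AddCommGroup V] [Module ℂ V] (P : PreCorr A V)

lemma ip_add_left (v w z : V) : P.ip (v + w) z = P.ip v z + P.ip w z := by
  rw [← P.star_ip, map_add, star_add, P.star_ip, P.star_ip]

lemma ip_smul_left (c : ℂ) (v z : V) : P.ip (c • v) z = star c • P.ip v z := by
  rw [← P.star_ip, map_smul, star_smul, P.star_ip]

lemma ip_sub_left (v w z : V) : P.ip (v - w) z = P.ip v z - P.ip w z := by
  rw [← P.star_ip, map_sub, star_sub, P.star_ip, P.star_ip]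

lemma ip_rmul_left (v w : V) (a : A) : P.ip (P.rmul v a) w = star a * P.ip v w := by
  rw [← P.star_ip, P.ip_rmul, star_mul, P.star_ip]

lemma ip_sum_left {ι : Type*} (s : Finset ι) (f : ι → V) (z : V) :
    P.ip (∑ i ∈ s, f i) z = ∑ i ∈ s, P.ip (f i) z := by
  rw [← P.star_ip, map_sum, star_sum]
  exact Finset.sum_congr rfl fun i _ => P.star_ip z (f i)

variable [StarOrderedRing A]

lemma cauchy_schwarz (v w : V) : ‖P.ip v w‖ ^ 2 ≤ ‖P.ip v v‖ * ‖P.ip w w‖ := by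
  have key : ∀ m : ℝ, ‖P.ip v v‖ < m → ‖P.ip v w‖ ^ 2 ≤ m * ‖P.ip w w‖ := by
    intro m hm
    have hm0 : 0 < m := (norm_nonneg _).trans_lt hm
    set c := P.ip v w with hc
    have hcs : P.ip w v = star c := by rw [hc, P.star_ip]
    have h1 : P.ip (P.rmul v c - (m : ℂ) • w) (P.rmul v c - (m : ℂ) • w)
        = star c * P.ip v v * c - m • (star c * c) - m • (star c * c)
          + m • (m • P.ip w w) := by
      simp only [map_sub, map_smul, ip_sub_left, ip_smul_left, ip_rmul_left, P.ip_rmul,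
        ← hc, hcs, smul_sub, mul_assoc, RCLike.star_def, Complex.conj_ofReal, smul_mul_assoc, sub_mul]
      simp only [Complex.coe_smul]
      abel
    have h2 : star c * P.ip v v * c ≤ m • (star c * c) :=
      (CStarAlgebra.star_left_conjugate_le_norm_smul (P.star_ip v v)).trans
        (smul_le_smul_of_nonneg_right hm.le (star_mul_self_nonneg c))
    have h3 : m • (star c * c) ≤ m • (m • P.ip w w) := by
      have h0 := P.ip_nonneg (P.rmul v c - (m : ℂ) • w)
      rw [h1] at h0
      have := sub_le_sub_right h2 (m • (star c * c))
      rw [sub_self] at this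
      have h4 : 0 ≤ 0 - m • (star c * c) + m • (m • P.ip w w) := by
        refine h0.trans ?_
        gcongr
      rwa [zero_sub, le_neg_add_iff_add_le, add_zero] at h4
    rw [smul_le_smul_iff_of_pos_left hm0] at h3
    calc ‖c‖ ^ 2 = ‖star c * c‖ := by rw [CStarRing.norm_star_mul_self, pow_two]
      _ ≤ ‖m • P.ip w w‖ :=
        CStarAlgebra.norm_le_norm_of_nonneg_of_le (star_mul_self_nonneg c) h3
      _ = m * ‖P.ip w w‖ := by rw [norm_smul, Real.norm_of_nonneg hm0.le]
  refine ge_of_tendsto (x := nhdsWithin ‖P.ip v v‖ (Set.Ioi ‖P.ip v v‖))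
    (f := fun m : ℝ => m * ‖P.ip w w‖) ?_ ?_
  · exact ((continuous_id.mul continuous_const).tendsto _).mono_left nhdsWithin_le_nhds
  · filter_upwards [self_mem_nhdsWithin] with m hm using key m hm

/-- The action of the unitization on `V` induced by the left action. -/
noncomputable def uact (r : Unitization ℂ A) (v : V) : V := r.fst • v + P.lmul r.snd v

lemma norm_ip_lmul_le (a : A) (v : V) :
    ‖P.ip (P.lmul a v) (P.lmul a v)‖ ≤ ‖a‖ ^ 2 * ‖P.ip v v‖ := by
  let := CStarAlgebra.spectralOrder (Unitization ℂ A)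
  have := CStarAlgebra.spectralOrderedRing (Unitization ℂ A)
  have h1 : star (a : Unitization ℂ A) * (a : Unitization ℂ A) ≤
      algebraMap ℝ (Unitization ℂ A) (‖(a : Unitization ℂ A)‖ ^ 2) :=
    CStarAlgebra.star_mul_le_algebraMap_norm_sq
  rw [← sub_nonneg, CStarAlgebra.nonneg_iff_eq_star_mul_self] at h1
  obtain ⟨r, hr⟩ := h1
  rw [Unitization.norm_inr] at hr
  have h2 : P.ip (P.uact r v) (P.uact r v) = P.ip v (P.uact (star r * r) v) := by
    simp only [uact, map_add, map_smul, P.ip_add_left, P.ip_smul_left, P.ip_lmul,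
      Unitization.fst_mul, Unitization.snd_mul, Unitization.fst_star, Unitization.snd_star,
      LinearMap.add_apply, LinearMap.smul_apply, P.lmul_mul, smul_add, mul_smul]
    abel
  have h3 : P.ip v (P.uact (star r * r) v)
      = (‖a‖ ^ 2) • P.ip v v - P.ip (P.lmul a v) (P.lmul a v) := by
    rw [← hr]
    have : (algebraMap ℝ (Unitization ℂ A) (‖a‖ ^ 2)) =
      algebraMap ℂ (Unitization ℂ A) ((‖a‖ ^ 2 : ℝ) : ℂ) := by
      rw [IsScalarTower.algebraMap_apply ℝ ℂ (Unitization ℂ A)]; rfl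
    rw [this, Unitization.algebraMap_eq_inl]
    simp only [uact, sub_eq_add_neg, P.ip_lmul, ← P.lmul_mul]
    simp [Complex.coe_smul, -Complex.ofReal_pow]
  have h4 := P.ip_nonneg (P.uact r v)
  rw [h2, h3, sub_nonneg] at h4
  calc _ ≤ ‖(‖a‖ ^ 2) • P.ip v v‖ :=
        CStarAlgebra.norm_le_norm_of_nonneg_of_le (P.ip_nonneg _) h4
    _ = _ := by rw [norm_smul, Real.norm_of_nonneg (by positivity)]

/-- The seminorm `‖v‖ = ‖⟪v, v⟫‖^(1/2)`. -/
noncomputable def nrm (v : V) : ℝ := √‖P.ip v v‖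

lemma nrm_nonneg (v : V) : 0 ≤ P.nrm v := Real.sqrt_nonneg _

lemma nrm_sq (v : V) : P.nrm v ^ 2 = ‖P.ip v v‖ := Real.sq_sqrt (norm_nonneg _)

lemma norm_ip_le (v w : V) : ‖P.ip v w‖ ≤ P.nrm v * P.nrm w := by
  rw [nrm, nrm, ← Real.sqrt_mul (norm_nonneg _)]
  exact Real.le_sqrt_of_sq_le (P.cauchy_schwarz v w)

lemma nrm_add_le (v w : V) : P.nrm (v + w) ≤ P.nrm v + P.nrm w := by
  refine Real.sqrt_le_iff.2 ⟨add_nonneg (P.nrm_nonneg v) (P.nrm_nonneg w), ?_⟩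
  have h : P.ip (v + w) (v + w) = P.ip v v + P.ip v w + (P.ip w v + P.ip w w) := by
    rw [P.ip_add_left, map_add, map_add]
  rw [h]
  have h1 := P.norm_ip_le v w
  have h2 := P.norm_ip_le w v
  have h3 := P.nrm_sq v
  have h4 := P.nrm_sq w
  have h5 := norm_add_le (P.ip v v + P.ip v w) (P.ip w v + P.ip w w)
  have h6 := norm_add_le (P.ip v v) (P.ip v w)
  have h7 := norm_add_le (P.ip w v) (P.ip w w)
  nlinarith

lemma nrm_smul (c : ℂ) (v : V) : P.nrm (c • v) = ‖c‖ * P.nrm v := by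
  have h : P.ip (c • v) (c • v) = (star c * c) • P.ip v v := by
    rw [P.ip_smul_left, map_smul, smul_smul]
  rw [nrm, h, norm_smul, norm_mul, norm_star, Real.sqrt_mul (by positivity),
    Real.sqrt_mul_self (norm_nonneg c), nrm]

lemma nrm_le_of_ip {W : Type*} [AddCommGroup W] [Module ℂ W] (Q : PreCorr A W)
    {C : ℝ} (hC : 0 ≤ C) (v : V) (w : W)
    (h : ‖Q.ip w w‖ ≤ C ^ 2 * ‖P.ip v v‖) : Q.nrm w ≤ C * P.nrm v := by
  refine (pow_le_pow_iff_left₀ (Q.nrm_nonneg _)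
    (mul_nonneg hC (P.nrm_nonneg v)) two_ne_zero).1 ?_
  rwa [mul_pow, Q.nrm_sq, P.nrm_sq]

lemma nrm_lmul_le (a : A) (v : V) : P.nrm (P.lmul a v) ≤ ‖a‖ * P.nrm v :=
  nrm_le_of_ip P P (norm_nonneg a) v _ (P.norm_ip_lmul_le a v)

lemma nrm_rmul_le (a : A) (v : V) : P.nrm (P.rmul v a) ≤ ‖a‖ * P.nrm v := by
  refine nrm_le_of_ip P P (norm_nonneg a) v _ ?_
  rw [P.ip_rmul_left, P.ip_rmul]
  calc ‖star a * (P.ip v v * a)‖ ≤ ‖star a‖ * (‖P.ip v v‖ * ‖a‖) :=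
        (norm_mul_le _ _).trans (by gcongr; exact norm_mul_le _ _)
    _ = _ := by rw [norm_star]; ring

/-- A copy of `V`, normed by `nrm`. -/
def Pre (_P : PreCorr A V) : Type v := V

instance : AddCommGroup P.Pre := inferInstanceAs (AddCommGroup V)

instance : Module ℂ P.Pre := inferInstanceAs (Module ℂ V)

/-- The identity map to the normed copy. -/
def toPre : V ≃ₗ[ℂ] P.Pre := LinearEquiv.refl ℂ V

noncomputable instance : SeminormedAddCommGroup P.Pre :=
  AddGroupSeminorm.toSeminormedAddCommGroup
    { toFun := fun v => P.nrm (P.toPre.symm v)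
      map_zero' := by simp [nrm]
      add_le' := fun v w => by rw [map_add]; exact P.nrm_add_le _ _
      neg' := fun v => by rw [map_neg, ← neg_one_smul ℂ, P.nrm_smul]; simp }

lemma norm_toPre (v : V) : ‖P.toPre v‖ = P.nrm v := rfl

noncomputable instance : NormedSpace ℂ P.Pre where
  norm_smul_le c v := (P.nrm_smul c (P.toPre.symm v)).le

/-- The Hausdorff completion of `V` for the seminorm `‖⟪v, v⟫‖^(1/2)`. -/
abbrev Compl : Type v := UniformSpace.Completion P.Pre

/-- The canonical map of `V` to its completion. -/
noncomputable def toCompl : V →ₗ[ℂ] P.Compl :=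
  (UniformSpace.Completion.toComplL (𝕜 := ℂ) (E := P.Pre)).toLinearMap ∘ₗ P.toPre.toLinearMap

lemma denseRange_toCompl : DenseRange P.toCompl :=
  UniformSpace.Completion.denseRange_coe (α := P.Pre)

lemma norm_toCompl (v : V) : ‖P.toCompl v‖ = P.nrm v :=
  UniformSpace.Completion.norm_coe (E := P.Pre) (P.toPre v)

variable {P} in
lemma clm_ext {σ : ℂ →+* ℂ} {C : Type*} [NormedAddCommGroup C] [NormedSpace ℂ C]
    {f g : P.Compl →SL[σ] C} (h : ∀ v, f (P.toCompl v) = g (P.toCompl v)) : f = g :=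
  ContinuousLinearMap.ext fun x =>
    congrFun (P.denseRange_toCompl.equalizer f.continuous g.continuous (funext h)) x

/-- The functional `⟪v, ·⟫` on the completion. -/
noncomputable def ipAux (v : V) : P.Compl →L[ℂ] A := (P.ip v).extendOfNorm P.toCompl

lemma ipAux_toCompl (v w : V) : P.ipAux v (P.toCompl w) = P.ip v w :=
  LinearMap.extendOfNorm_eq P.denseRange_toCompl
    ⟨P.nrm v, fun w => by rw [norm_toCompl]; exact P.norm_ip_le v w⟩ w

lemma norm_ipAux_le (v : V) : ‖P.ipAux v‖ ≤ P.nrm v :=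
  ContinuousLinearMap.opNorm_le_bound _ (P.nrm_nonneg v) fun x =>
    LinearMap.norm_extendOfNorm_apply_le P.denseRange_toCompl _
      (fun w => by rw [norm_toCompl]; exact P.norm_ip_le v w) x

/-- The inner product on the completion. -/
noncomputable def ipC : P.Compl →L⋆[ℂ] P.Compl →L[ℂ] A :=
  LinearMap.extendOfNorm
    { toFun := P.ipAux
      map_add' := fun v w => clm_ext fun z => by
        simp [ipAux_toCompl, ip_add_left]
      map_smul' := fun c v => clm_ext fun z => by
        simp [ipAux_toCompl, ip_smul_left] } P.toCompl

lemma ipC_toCompl (v w : V) : P.ipC (P.toCompl v) (P.toCompl w) = P.ip v w := by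
  rw [← ipAux_toCompl]
  exact congrArg (fun f : P.Compl →L[ℂ] A => f (P.toCompl w))
    (LinearMap.extendOfNorm_eq P.denseRange_toCompl
    ⟨1, fun w => by rw [norm_toCompl, one_mul]; exact P.norm_ipAux_le w⟩ v)

/-- The right action on the completion. -/
noncomputable def rmulC : P.Compl →L[ℂ] A →L[ℂ] P.Compl :=
  LinearMap.extendOfNorm
    { toFun := fun v => LinearMap.mkContinuous (P.toCompl ∘ₗ P.rmul v) (P.nrm v) fun a => by
        rw [LinearMap.comp_apply, norm_toCompl, mul_comm]; exact P.nrm_rmul_le a v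
      map_add' := fun v w => by ext; simp
      map_smul' := fun c v => by ext; simp } P.toCompl

lemma rmulC_toCompl (v : V) (a : A) : P.rmulC (P.toCompl v) a = P.toCompl (P.rmul v a) :=
  congrArg (fun f : A →L[ℂ] P.Compl => f a)
    (LinearMap.extendOfNorm_eq P.denseRange_toCompl
    ⟨1, fun w => by
      rw [norm_toCompl, one_mul]
      refine LinearMap.mkContinuous_norm_le _ (P.nrm_nonneg w) fun a => ?_
      rw [LinearMap.comp_apply, norm_toCompl, mul_comm]; exact P.nrm_rmul_le a w⟩ v)

/-- The left action on the completion. -/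
noncomputable def lmulC (a : A) : P.Compl →L[ℂ] P.Compl :=
  (P.toCompl ∘ₗ P.lmul a).extendOfNorm P.toCompl

lemma lmulC_toCompl (a : A) (v : V) : P.lmulC a (P.toCompl v) = P.toCompl (P.lmul a v) :=
  LinearMap.extendOfNorm_eq P.denseRange_toCompl
    ⟨‖a‖, fun v => by
      rw [LinearMap.comp_apply, norm_toCompl, norm_toCompl]; exact P.nrm_lmul_le a v⟩ v

@[elab_as_elim]
lemma dense_induction {p : P.Compl → Prop} (x : P.Compl) (hc : IsClosed {x | p x})
    (h : ∀ v, p (P.toCompl v)) : p x := P.denseRange_toCompl.induction_on x hc h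

@[elab_as_elim]
lemma dense_induction₂ {p : P.Compl → P.Compl → Prop} (x y : P.Compl)
    (hc : IsClosed {z : P.Compl × P.Compl | p z.1 z.2})
    (h : ∀ v w, p (P.toCompl v) (P.toCompl w)) : p x y :=
  P.denseRange_toCompl.induction_on₂ hc h x y

/-- The completion carries the same structure as `V`. -/
noncomputable def compl : PreCorr A P.Compl where
  ip x := (P.ipC x).toLinearMap
  rmul := (ContinuousLinearMap.coeLM ℂ) ∘ₗ P.rmulC.toLinearMap
  lmul :=
    { toFun := fun a => (P.lmulC a).toLinearMap
      map_add' := fun a b => by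
        rw [← ContinuousLinearMap.toLinearMap_add]
        exact congrArg _ (clm_ext fun v => by simp [lmulC_toCompl])
      map_smul' := fun c a => by
        rw [← ContinuousLinearMap.toLinearMap_smul]
        exact congrArg _ (clm_ext fun v => by simp [lmulC_toCompl]) }
  star_ip x y := by
    change star (P.ipC x y) = P.ipC y x
    refine P.dense_induction₂ x y (isClosed_eq (by fun_prop) (by fun_prop)) fun v w => ?_
    rw [ipC_toCompl, ipC_toCompl, P.star_ip]
  ip_nonneg x := by
    change 0 ≤ P.ipC x x
    refine P.dense_induction x ?_ fun v => ?_
    · exact CStarAlgebra.isClosed_nonneg.preimage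
        (f := fun x => P.ipC x x) (by fun_prop)
    · rw [ipC_toCompl]; exact P.ip_nonneg v
  ip_rmul x y a := by
    change P.ipC x (P.rmulC y a) = P.ipC x y * a
    refine P.dense_induction₂ x y (isClosed_eq (by fun_prop) (by fun_prop)) fun v w => ?_
    rw [ipC_toCompl, rmulC_toCompl, ipC_toCompl, P.ip_rmul]
  rmul_mul x a b := by
    change P.rmulC x (a * b) = P.rmulC (P.rmulC x a) b
    refine P.dense_induction x (isClosed_eq (by fun_prop) (by fun_prop)) fun v => ?_
    simp only [rmulC_toCompl, P.rmul_mul]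
  lmul_mul a b x := by
    change P.lmulC (a * b) x = P.lmulC a (P.lmulC b x)
    refine P.dense_induction x (isClosed_eq (by fun_prop) (by fun_prop)) fun v => ?_
    simp only [lmulC_toCompl, P.lmul_mul]
  ip_lmul a x y := by
    change P.ipC (P.lmulC a x) y = P.ipC x (P.lmulC (star a) y)
    refine P.dense_induction₂ x y (isClosed_eq (by fun_prop) (by fun_prop)) fun v w => ?_
    simp only [ipC_toCompl, lmulC_toCompl, P.ip_lmul]
  lmul_rmul a x b := by
    change P.lmulC a (P.rmulC x b) = P.rmulC (P.lmulC a x) b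
    refine P.dense_induction x (isClosed_eq (by fun_prop) (by fun_prop)) fun v => ?_
    simp only [rmulC_toCompl, lmulC_toCompl, P.lmul_rmul]

lemma compl_norm_sq (x : P.Compl) : ‖x‖ ^ 2 = ‖P.compl.ip x x‖ := by
  change _ = ‖P.ipC x x‖
  refine P.dense_induction x (isClosed_eq (by fun_prop) (by fun_prop)) fun v => ?_
  rw [ipC_toCompl, norm_toCompl, nrm_sq]

/-- Gram matrices are of the form `s⋆ s`. -/
lemma exists_gram {n : ℕ} (x : Fin n → V) :
    ∃ s : Fin n → Fin n → A, ∀ i j, P.ip (x i) (x j) = ∑ k, star (s k i) * s k j := by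
  let M : CStarMatrix (Fin n) (Fin n) A := CStarMatrix.ofMatrix fun i j => P.ip (x i) (x j)
  have hMa : ∀ i j, M i j = P.ip (x i) (x j) := fun i j => rfl
  have hM : IsSelfAdjoint M := by
    ext i j
    rw [CStarMatrix.star_apply, hMa, hMa, P.star_ip]
  obtain ⟨N, D, hNs, hNMN, hD, hN0⟩ := exists_negPart hM
  have hD0 : D = 0 := by
    ext i k
    have e1 : (N * M * N) k k = P.ip (∑ i, P.rmul (x i) (N i k)) (∑ i, P.rmul (x i) (N i k)) := by
      have hNs' : ∀ i, N k i = star (N i k) := fun i => by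
        conv_lhs => rw [← hNs]
        rw [CStarMatrix.star_apply]
      simp only [CStarMatrix.mul_apply, hMa, map_sum, P.ip_rmul, hNs', Finset.sum_mul]
      refine Finset.sum_congr rfl fun j _ => ?_
      rw [← P.star_ip, map_sum, star_sum, Finset.sum_mul]
      refine Finset.sum_congr rfl fun i _ => ?_
      rw [P.ip_rmul, star_mul, P.star_ip]
    have e2 : (star D * D) k k = ∑ i, star (D i k) * D i k := by
      simp [CStarMatrix.mul_apply, CStarMatrix.star_apply]
    have e3 : ∑ i, star (D i k) * D i k ≤ 0 := by
      rw [← e2]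
      have := P.ip_nonneg (∑ i, P.rmul (x i) (N i k))
      rw [← e1, hNMN] at this
      simpa [CStarMatrix.neg_apply] using this
    have e4 : star (D i k) * D i k ≤ 0 :=
      (Finset.single_le_sum (f := fun i => star (D i k) * D i k)
        (fun i _ => star_mul_self_nonneg _) (Finset.mem_univ i)).trans e3
    have e5 := le_antisymm e4 (star_mul_self_nonneg _)
    simpa [CStarRing.star_mul_self_eq_zero_iff] using e5
  have hN3 : N * N * N = 0 := by rw [hD, hD0, mul_zero]
  have hN2 : N * N = 0 := by
    rw [← CStarRing.star_mul_self_eq_zero_iff, star_mul, hNs, ← mul_assoc, hN3, zero_mul]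
  obtain ⟨S, hS⟩ := hN0 (by rwa [← CStarRing.star_mul_self_eq_zero_iff, hNs])
  refine ⟨fun k i => S k i, fun i j => ?_⟩
  rw [← hMa, hS]
  simp [CStarMatrix.mul_apply, CStarMatrix.star_apply]

/-- An adjointable map `S` with `S⋆ S` acting as an element of `A` is bounded. -/
lemma nrm_map_le {W : Type*} [AddCommGroup W] [Module ℂ W] (Q : PreCorr A W)
    {S : V → W} {S' : W → V} (h : ∀ v w, Q.ip (S v) w = P.ip v (S' w)) (b : A)
    (hb : ∀ v, S' (S v) = P.lmul b v) (v : V) : Q.nrm (S v) ≤ √‖b‖ * P.nrm v := by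
  refine P.nrm_le_of_ip Q (Real.sqrt_nonneg _) v _ ?_
  rw [h, hb, Real.sq_sqrt (norm_nonneg b), ← P.nrm_sq]
  calc _ ≤ P.nrm v * P.nrm (P.lmul b v) := P.norm_ip_le _ _
    _ ≤ P.nrm v * (‖b‖ * P.nrm v) :=
      mul_le_mul_of_nonneg_left (P.nrm_lmul_le b v) (P.nrm_nonneg v)
    _ = _ := by ring

/-- The adjoint of a bounded map is bounded. -/
lemma nrm_adj_le {W : Type*} [AddCommGroup W] [Module ℂ W] (Q : PreCorr A W)
    {S : V → W} {S' : W → V} (h : ∀ v w, Q.ip (S v) w = P.ip v (S' w)) {C : ℝ} (hC : 0 ≤ C)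
    (hb : ∀ v, Q.nrm (S v) ≤ C * P.nrm v) (w : W) : P.nrm (S' w) ≤ C * Q.nrm w := by
  have h1 : P.nrm (S' w) ^ 2 ≤ C * P.nrm (S' w) * Q.nrm w := by
    rw [P.nrm_sq, ← h]
    exact (Q.norm_ip_le _ _).trans (mul_le_mul_of_nonneg_right (hb _) (Q.nrm_nonneg w))
  by_contra hlt
  rw [not_le] at hlt
  have h2 := mul_nonneg hC (Q.nrm_nonneg w)
  nlinarith

/-- The map of completions induced by a bounded linear map. -/
noncomputable def mapCompl {W : Type*} [AddCommGroup W] [Module ℂ W] (Q : PreCorr A W)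
    (S : V →ₗ[ℂ] W) : P.Compl →L[ℂ] Q.Compl := (Q.toCompl ∘ₗ S).extendOfNorm P.toCompl

lemma mapCompl_toCompl {W : Type*} [AddCommGroup W] [Module ℂ W] (Q : PreCorr A W)
    (S : V →ₗ[ℂ] W) {C : ℝ} (hb : ∀ v, Q.nrm (S v) ≤ C * P.nrm v) (v : V) :
    P.mapCompl Q S (P.toCompl v) = Q.toCompl (S v) :=
  LinearMap.extendOfNorm_eq P.denseRange_toCompl
    ⟨C, fun v => by rw [LinearMap.comp_apply, norm_toCompl, norm_toCompl]; exact hb v⟩ v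

end Basic

end PreCorr

namespace PreCorr

section Constructions

variable (A : Type u) [NonUnitalCStarAlgebra A] [PartialOrder A] [StarOrderedRing A]

/-- `A` over itself: `⟪a, b⟫ = a⋆ b`. -/
noncomputable def self : PreCorr A A where
  ip a := LinearMap.mulLeft ℂ (star a)
  rmul := LinearMap.mul ℂ A
  lmul := LinearMap.mul ℂ A
  star_ip v w := by simp
  ip_nonneg v := star_mul_self_nonneg v
  ip_rmul v w a := by simp [mul_assoc]
  rmul_mul v a b := by simp [mul_assoc]
  lmul_mul a b v := by simp [mul_assoc]
  ip_lmul a v w := by simp [mul_assoc]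
  lmul_rmul a v b := by simp [mul_assoc]

variable {A}

/-- Direct sum of two: `⟪(v, w), (v', w')⟫ = ⟪v, v'⟫ + ⟪w, w'⟫`. -/
noncomputable def prod {V W : Type*} [AddCommGroup V] [Module ℂ V] [AddCommGroup W] [Module ℂ W]
    (P : PreCorr A V) (Q : PreCorr A W) : PreCorr A (V × W) where
  ip v := (P.ip v.1).coprod (Q.ip v.2)
  rmul :=
    { toFun := fun v => (P.rmul v.1).prod (Q.rmul v.2)
      map_add' := fun v w => by ext <;> simp
      map_smul' := fun c v => by ext <;> simp }
  lmul :=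
    { toFun := fun a => (P.lmul a).prodMap (Q.lmul a)
      map_add' := fun v w => by ext <;> simp
      map_smul' := fun c v => by ext <;> simp }
  star_ip v w := by simp [P.star_ip, Q.star_ip]
  ip_nonneg v := add_nonneg (P.ip_nonneg _) (Q.ip_nonneg _)
  ip_rmul v w a := by simp [P.ip_rmul, Q.ip_rmul, add_mul]
  rmul_mul v a b := by simp [P.rmul_mul, Q.rmul_mul]
  lmul_mul a b v := by simp [P.lmul_mul, Q.lmul_mul]
  ip_lmul a v w := by simp [P.ip_lmul, Q.ip_lmul]
  lmul_rmul a v b := by simp [P.lmul_rmul, Q.lmul_rmul]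

/-- The inner product of the exterior tensor product `K ⊗ A`. -/
noncomputable def exteriorIp (A : Type u) [NonUnitalCStarAlgebra A] (K : Type*)
    [NormedAddCommGroup K] [InnerProductSpace ℂ K] : K ⊗[ℂ] A →ₗ⋆[ℂ] K ⊗[ℂ] A →ₗ[ℂ] A :=
  TensorProduct.lift <| LinearMap.mk₂'ₛₗ (starRingEnd ℂ) (starRingEnd ℂ)
    (fun k x => TensorProduct.lift <| LinearMap.mk₂ ℂ (fun l y => ⟪k, l⟫_ℂ • (star x * y))
      (fun _ _ _ => by rw [inner_add_right, add_smul])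
      (fun _ _ _ => by rw [inner_smul_right, mul_smul])
      (fun _ _ _ => by rw [mul_add, smul_add])
      (fun _ _ _ => by rw [mul_smul_comm, smul_comm]))
    (fun _ _ _ => by ext; simp [add_smul])
    (fun c k x => by
      ext l y
      simpa [mul_smul] using smul_comm (⟪k, l⟫_ℂ) ((starRingEnd ℂ) c) (star x * y))
    (fun _ _ _ => by ext; simp [add_mul])
    (fun c k x => by
      ext l y
      simpa [smul_mul_assoc] using smul_comm (⟪k, l⟫_ℂ) ((starRingEnd ℂ) c) (star x * y))

@[simp]
lemma exteriorIp_tmul {K : Type*} [NormedAddCommGroup K] [InnerProductSpace ℂ K]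
    (k l : K) (x y : A) : exteriorIp A K (k ⊗ₜ x) (l ⊗ₜ y) = ⟪k, l⟫_ℂ • (star x * y) := rfl

/-- The exterior tensor product `K ⊗ A` of a (pre-)Hilbert space `K`, on which `A` acts through
`ρ`, with `A`: `⟪k ⊗ x, l ⊗ y⟫ = ⟪k, l⟫ x⋆ y` and `a (k ⊗ x) b = ρ(a) k ⊗ x b`. -/
noncomputable def exterior {K : Type*} [NormedAddCommGroup K] [InnerProductSpace ℂ K]
    (ρ : A →ₗ[ℂ] K →ₗ[ℂ] K) (hmul : ∀ a b k, ρ (a * b) k = ρ a (ρ b k))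
    (hstar : ∀ a k l, ⟪ρ a k, l⟫_ℂ = ⟪k, ρ (star a) l⟫_ℂ) : PreCorr A (K ⊗[ℂ] A) where
  ip := exteriorIp A K
  rmul := (LinearMap.lTensorHom K ∘ₗ (LinearMap.mul ℂ A).flip).flip
  lmul := LinearMap.rTensorHom A ∘ₗ ρ
  star_ip v w := by
    induction v with
    | zero => simp
    | add v v' h h' => simp [h, h']
    | tmul k x =>
      induction w with
      | zero => simp
      | add w w' h h' => simp [h, h']
      | tmul l y => simp [star_smul]
  ip_nonneg v := by
    obtain ⟨n, k, x, rfl⟩ := TensorProduct.exists_sum_tmul_eq v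
    obtain ⟨S, hS⟩ : ∃ S : Matrix (Fin n) (Fin n) ℂ, Matrix.gram ℂ k = S.conjTranspose * S := by
      open scoped MatrixOrder in
      exact CStarAlgebra.nonneg_iff_eq_star_mul_self.1 (Matrix.posSemidef_gram ℂ k).nonneg
    have hS' : ∀ i j, ⟪k i, k j⟫_ℂ = ∑ l, star (S l i) * S l j := fun i j => by
      rw [← Matrix.gram_apply, hS]
      simp [Matrix.mul_apply]
    have : exteriorIp A K (∑ i, k i ⊗ₜ x i) (∑ i, k i ⊗ₜ x i)
        = ∑ l, star (∑ i, S l i • x i) * (∑ j, S l j • x j) := by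
      simp only [map_sum, LinearMap.sum_apply, exteriorIp_tmul, hS', star_sum, star_smul,
        Finset.sum_mul_sum, Finset.sum_smul, smul_mul_smul_comm]
      exact (Finset.sum_comm.trans (Finset.sum_congr rfl fun d _ => Finset.sum_comm)).trans
        Finset.sum_comm
    rw [this]
    exact Finset.sum_nonneg fun _ _ => star_mul_self_nonneg _
  ip_rmul v w a := by
    induction v with
    | zero => simp
    | add v v' h h' => simp at h h'; simp [h, h', add_mul]
    | tmul k x =>
      induction w with
      | zero => simp
      | add w w' h h' => simp at h h'; simp [h, h', add_mul]
      | tmul l y => simp [mul_assoc, smul_mul_assoc]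
  rmul_mul v a b := by
    induction v with
    | zero => simp
    | add v v' h h' => simp at h h'; simp [h, h']
    | tmul k x => simp [mul_assoc]
  lmul_mul a b v := by
    induction v with
    | zero => simp
    | add v v' h h' => simp at h h'; simp [h, h']
    | tmul k x => simp [hmul]
  ip_lmul a v w := by
    induction v with
    | zero => simp
    | add v v' h h' => simp at h h'; simp [h, h']
    | tmul k x =>
      induction w with
      | zero => simp
      | add w w' h h' => simp at h h'; simp [h, h']
      | tmul l y => simp [hstar]
  lmul_rmul a v b := by
    induction v with
    | zero => simp
    | add v v' h h' => simp at h h'; simp [h, h']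
    | tmul k x => simp

variable {V W : Type*} [AddCommGroup V] [Module ℂ V] [AddCommGroup W] [Module ℂ W]

/-- The annihilation map `v' ⊗ w' ↦ ⟪v, v'⟫ w'`. -/
noncomputable def ann (P : PreCorr A V) (Q : PreCorr A W) (v : V) : V ⊗[ℂ] W →ₗ[ℂ] W :=
  TensorProduct.lift (Q.lmul ∘ₗ P.ip v)

@[simp]
lemma ann_tmul (P : PreCorr A V) (Q : PreCorr A W) (v v' : V) (w' : W) :
    ann P Q v (v' ⊗ₜ w') = Q.lmul (P.ip v v') w' := rfl

/-- The inner product of the interior tensor product `V ⊗_A W`. -/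
noncomputable def tensorIp (P : PreCorr A V) (Q : PreCorr A W) :
    V ⊗[ℂ] W →ₗ⋆[ℂ] V ⊗[ℂ] W →ₗ[ℂ] A :=
  TensorProduct.lift <| LinearMap.mk₂'ₛₗ (starRingEnd ℂ) (starRingEnd ℂ)
    (fun v w => Q.ip w ∘ₗ ann P Q v)
    (fun _ _ _ => by ext; simp [ip_add_left])
    (fun _ _ _ => by ext; simp [ip_smul_left])
    (fun _ _ _ => by ext; simp [ip_add_left])
    (fun _ _ _ => by ext; simp [ip_smul_left])

@[simp]
lemma tensorIp_tmul (P : PreCorr A V) (Q : PreCorr A W) (v : V) (w : W) (z : V ⊗[ℂ] W) :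
    tensorIp P Q (v ⊗ₜ w) z = Q.ip w (ann P Q v z) := rfl

/-- The interior tensor product `V ⊗_A W`:
`⟪v ⊗ w, v' ⊗ w'⟫ = ⟪w, ⟪v, v'⟫ w'⟫` and `a (v ⊗ w) b = a v ⊗ w b`. -/
noncomputable def tensor (P : PreCorr A V) (Q : PreCorr A W) : PreCorr A (V ⊗[ℂ] W) where
  ip := tensorIp P Q
  rmul := (LinearMap.lTensorHom V ∘ₗ Q.rmul.flip).flip
  lmul := LinearMap.rTensorHom W ∘ₗ P.lmul
  star_ip v w := by
    induction v with
    | zero => simp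
    | add v v' h h' => simp [h, h']
    | tmul k x =>
      induction w with
      | zero => simp
      | add w w' h h' => simp at h h'; simp [h, h']
      | tmul l y => simp [Q.star_ip, Q.ip_lmul, P.star_ip]
  ip_nonneg v := by
    obtain ⟨n, k, x, rfl⟩ := TensorProduct.exists_sum_tmul_eq v
    obtain ⟨S, hS⟩ := P.exists_gram k
    have : tensorIp P Q (∑ i, k i ⊗ₜ x i) (∑ i, k i ⊗ₜ x i)
        = ∑ l, Q.ip (∑ i, Q.lmul (S l i) (x i)) (∑ j, Q.lmul (S l j) (x j)) := by
      simp only [map_sum, LinearMap.sum_apply, tensorIp_tmul, ann_tmul, hS, Q.lmul_mul,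
        Q.ip_sum_left, Q.ip_lmul]
      exact (Finset.sum_comm.trans (Finset.sum_congr rfl fun d _ => Finset.sum_comm)).trans
        Finset.sum_comm
    rw [this]
    exact Finset.sum_nonneg fun _ _ => Q.ip_nonneg _
  ip_rmul v w a := by
    induction v with
    | zero => simp
    | add v v' h h' => simp at h h'; simp [h, h', add_mul]
    | tmul k x =>
      induction w with
      | zero => simp
      | add w w' h h' => simp at h h'; simp [h, h', add_mul]
      | tmul l y => simp [Q.lmul_rmul, Q.ip_rmul]
  rmul_mul v a b := by
    induction v with
    | zero => simp
    | add v v' h h' => simp at h h'; simp [h, h']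
    | tmul k x => simp [Q.rmul_mul]
  lmul_mul a b v := by
    induction v with
    | zero => simp
    | add v v' h h' => simp at h h'; simp [h, h']
    | tmul k x => simp [P.lmul_mul]
  ip_lmul a v w := by
    induction v with
    | zero => simp
    | add v v' h h' => simp at h h'; simp [h, h']
    | tmul k x =>
      induction w with
      | zero => simp
      | add w w' h h' => simp at h h'; simp [h, h']
      | tmul l y => simp [P.ip_lmul]
  lmul_rmul a v b := by
    induction v with
    | zero => simp
    | add v v' h h' => simp at h h'; simp [h, h']
    | tmul k x => simp

end Constructions
end PreCorr

/-- A C⋆-correspondence (Hilbert `A`-`A`-bimodule): a complete right Hilbert `A`-module, with a left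
action of `A` by adjointable operators. -/
structure Corr (A : Type u) [NonUnitalCStarAlgebra A] [PartialOrder A] : Type (max u (v + 1)) where
  carrier : Type v
  [normedAddCommGroup : NormedAddCommGroup carrier]
  [normedSpace : NormedSpace ℂ carrier]
  [completeSpace : CompleteSpace carrier]
  str : PreCorr A carrier
  norm_sq : ∀ x, ‖x‖ ^ 2 = ‖str.ip x x‖

namespace Corr

attribute [instance] Corr.normedAddCommGroup Corr.normedSpace Corr.completeSpace

variable {A : Type u} [NonUnitalCStarAlgebra A] [PartialOrder A] [StarOrderedRing A]

/-- The completion of a pre-correspondence. -/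
noncomputable def ofPre {V : Type v} [AddCommGroup V] [Module ℂ V] (P : PreCorr A V) :
    Corr.{u, v} A where
  carrier := P.Compl
  str := P.compl
  norm_sq := P.compl_norm_sq

section Adjointable

variable (X : Corr.{u, v} A)

lemma nrm_eq (x : X.carrier) : X.str.nrm x = ‖x‖ := by
  rw [PreCorr.nrm, ← X.norm_sq, Real.sqrt_sq (norm_nonneg _)]

variable {X} in
lemma ext_ip {x y : X.carrier} (h : ∀ z, X.str.ip z x = X.str.ip z y) : x = y := by
  rw [← sub_eq_zero, ← norm_eq_zero, ← sq_eq_zero_iff, X.norm_sq, map_sub, h, sub_self, norm_zero]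

lemma norm_ip_le (x y : X.carrier) : ‖X.str.ip x y‖ ≤ ‖x‖ * ‖y‖ := by
  rw [← nrm_eq, ← nrm_eq]
  exact X.str.norm_ip_le x y

lemma continuous_ip (x : X.carrier) : Continuous (X.str.ip x) :=
  AddMonoidHomClass.continuous_of_bound (X.str.ip x) ‖x‖ (X.norm_ip_le x)

/-- The adjointable operators on `X`, i.e. those with an adjoint for the `A`-valued inner product
(such operators are automatically `A`-linear). -/
def adjointable : Subalgebra ℂ (X.carrier →L[ℂ] X.carrier) where
  carrier := {T | ∃ S : X.carrier →L[ℂ] X.carrier, ∀ x y, X.str.ip (T x) y = X.str.ip x (S y)}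
  mul_mem' := by
    rintro T T' ⟨S, hS⟩ ⟨S', hS'⟩
    exact ⟨S' * S, fun x y => by simp [hS, hS']⟩
  add_mem' := by
    rintro T T' ⟨S, hS⟩ ⟨S', hS'⟩
    exact ⟨S + S', fun x y => by simp [hS, hS', X.str.ip_add_left]⟩
  algebraMap_mem' c := ⟨algebraMap ℂ _ (star c), fun x y => by
    simp [Algebra.algebraMap_eq_smul_one, X.str.ip_smul_left]⟩

/-- The algebra `L_A(X)` of adjointable operators. -/
def Adj : Type v := X.adjointable

variable {X}

noncomputable instance : NormedRing X.Adj := inferInstanceAs (NormedRing X.adjointable)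

noncomputable instance : NormedAlgebra ℂ X.Adj :=
  inferInstanceAs (NormedAlgebra ℂ X.adjointable)

/-- The underlying bounded operator. -/
def Adj.op (T : X.Adj) : X.carrier →L[ℂ] X.carrier := T.val

lemma Adj.op_mul (S T : X.Adj) (x : X.carrier) : (S * T).op x = S.op (T.op x) := rfl

lemma Adj.op_add (S T : X.Adj) (x : X.carrier) : (S + T).op x = S.op x + T.op x := rfl

lemma Adj.op_smul (c : ℂ) (T : X.Adj) (x : X.carrier) : (c • T).op x = c • T.op x := rfl

lemma Adj.norm_def (T : X.Adj) : ‖T‖ = ‖T.op‖ := rfl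

lemma Adj.ext_ip {S T : X.Adj} (h : ∀ x y, X.str.ip x (S.op y) = X.str.ip x (T.op y)) : S = T :=
  Subtype.ext (ContinuousLinearMap.ext fun y => Corr.ext_ip fun x => h x y)

/-- The adjoint. -/
noncomputable instance : Star X.Adj where
  star T := ⟨T.2.choose, T.op, fun x y => by
    rw [← X.str.star_ip]
    exact (congrArg star (T.2.choose_spec y x)).symm.trans (X.str.star_ip _ _)⟩

lemma Adj.star_right (T : X.Adj) (x y : X.carrier) :
    X.str.ip x ((star T).op y) = X.str.ip (T.op x) y := (T.2.choose_spec x y).symm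

lemma Adj.star_left (T : X.Adj) (x y : X.carrier) :
    X.str.ip ((star T).op x) y = X.str.ip x (T.op y) := by
  rw [← X.str.star_ip, Adj.star_right, X.str.star_ip]

noncomputable instance : StarRing X.Adj where
  star_involutive T := Adj.ext_ip fun x y => by rw [Adj.star_right, Adj.star_left]
  star_mul S T := Adj.ext_ip fun x y => by
    rw [Adj.star_right, Adj.op_mul, Adj.op_mul, Adj.star_right, Adj.star_right]
  star_add S T := Adj.ext_ip fun x y => by
    rw [Adj.star_right, Adj.op_add, Adj.op_add, map_add, X.str.ip_add_left, Adj.star_right,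
      Adj.star_right]

instance : StarModule ℂ X.Adj where
  star_smul c T := Adj.ext_ip fun x y => by
    rw [Adj.star_right, Adj.op_smul, Adj.op_smul, map_smul, X.str.ip_smul_left, Adj.star_right]

instance : CStarRing X.Adj where
  norm_mul_self_le T := by
    have key : ∀ x : X.carrier, ‖T.op x‖ ≤ √‖star T * T‖ * ‖x‖ := fun x => by
      refine (pow_le_pow_iff_left₀ (norm_nonneg _) (by positivity) two_ne_zero).1 ?_
      rw [mul_pow, Real.sq_sqrt (norm_nonneg (star T * T)), X.norm_sq, ← Adj.star_right,
        ← Adj.op_mul]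
      calc _ ≤ ‖x‖ * ‖(star T * T).op x‖ := X.norm_ip_le _ _
        _ ≤ ‖x‖ * (‖star T * T‖ * ‖x‖) := by
          gcongr
          exact (star T * T).op.le_opNorm x
        _ = _ := by ring
    have h : ‖T‖ ≤ √‖star T * T‖ :=
      ContinuousLinearMap.opNorm_le_bound _ (Real.sqrt_nonneg _) key
    calc ‖T‖ * ‖T‖ ≤ √‖star T * T‖ * √‖star T * T‖ := by gcongr
      _ = _ := Real.mul_self_sqrt (norm_nonneg _)

/-- The adjointable operator on a completion given by a pair of formally adjoint maps `S`, `S'` on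
the dense subspace, if `S` is bounded. -/
noncomputable def Adj.ofPre {V : Type v} [AddCommGroup V] [Module ℂ V] (P : PreCorr A V)
    (S S' : V →ₗ[ℂ] V) (h : ∀ v w, P.ip (S v) w = P.ip v (S' w)) {C : ℝ} (hC : 0 ≤ C)
    (hb : ∀ v, P.nrm (S v) ≤ C * P.nrm v) : (Corr.ofPre P).Adj :=
  ⟨P.mapCompl P S, P.mapCompl P S', fun x y => by
    change P.ipC (P.mapCompl P S x) y = P.ipC x (P.mapCompl P S' y)
    refine P.dense_induction₂ x y (isClosed_eq (by fun_prop) (by fun_prop)) fun v w => ?_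
    rw [P.mapCompl_toCompl P S hb, P.mapCompl_toCompl P S' (P.nrm_adj_le P h hC hb),
      P.ipC_toCompl, P.ipC_toCompl, h]⟩

/-- The left action of `A`, as adjointable operators. -/
noncomputable def left (X : Corr.{u, v} A) (a : A) : X.Adj :=
  ⟨(X.str.lmul a).mkContinuous ‖a‖ fun x => by
      rw [← nrm_eq, ← nrm_eq]; exact X.str.nrm_lmul_le a x,
    (X.str.lmul (star a)).mkContinuous ‖star a‖ fun x => by
      rw [← nrm_eq, ← nrm_eq]; exact X.str.nrm_lmul_le _ x,
    fun x y => X.str.ip_lmul a x y⟩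

end Adjointable

section Fock

/-- The interior tensor product `X ⊗_A Y`. -/
noncomputable def tensor (X Y : Corr.{u, v} A) : Corr.{u, v} A := ofPre (X.str.tensor Y.str)

/-- The creation map `y ↦ x ⊗ y`. -/
noncomputable def create (X Y : Corr.{u, v} A) (x : X.carrier) :
    Y.carrier →ₗ[ℂ] (tensor X Y).carrier :=
  (X.str.tensor Y.str).toCompl ∘ₗ TensorProduct.mk ℂ X.carrier Y.carrier x

/-- The annihilation map `x' ⊗ y ↦ ⟪x, x'⟫ y`. -/
noncomputable def annihilate (X Y : Corr.{u, v} A) (x : X.carrier) :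
    (tensor X Y).carrier →L[ℂ] Y.carrier :=
  (X.str.ann Y.str x).extendOfNorm (X.str.tensor Y.str).toCompl

lemma annihilate_toCompl (X Y : Corr.{u, v} A) (x : X.carrier) (z : X.carrier ⊗[ℂ] Y.carrier) :
    annihilate X Y x ((X.str.tensor Y.str).toCompl z) = X.str.ann Y.str x z := by
  have h : ∀ y z, (X.str.tensor Y.str).ip (TensorProduct.mk ℂ X.carrier Y.carrier x y) z
      = Y.str.ip y (X.str.ann Y.str x z) := fun y z => rfl
  have hb := Y.str.nrm_map_le (X.str.tensor Y.str) h (X.str.ip x x) fun v => rfl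
  refine LinearMap.extendOfNorm_eq (X.str.tensor Y.str).denseRange_toCompl
    ⟨√‖X.str.ip x x‖, fun z => ?_⟩ z
  rw [PreCorr.norm_toCompl, ← nrm_eq]
  exact Y.str.nrm_adj_le _ h (Real.sqrt_nonneg _) hb z

lemma annihilate_create (X Y : Corr.{u, v} A) (x : X.carrier) (y : Y.carrier) :
    annihilate X Y x (create X Y x y) = Y.str.lmul (X.str.ip x x) y :=
  annihilate_toCompl X Y x _

lemma ip_create (X Y : Corr.{u, v} A) (x : X.carrier) (y : Y.carrier)
    (z : (tensor X Y).carrier) :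
    (tensor X Y).str.ip (create X Y x y) z = Y.str.ip y (annihilate X Y x z) := by
  refine (X.str.tensor Y.str).dense_induction z (isClosed_eq ((tensor X Y).continuous_ip _)
    ((Y.continuous_ip y).comp (annihilate X Y x).continuous)) fun v => ?_
  rw [annihilate_toCompl]
  exact (X.str.tensor Y.str).ipC_toCompl _ v

/-- The tensor powers: `pow X k` is the `(k + 1)`-fold interior tensor power of `X`. -/
noncomputable def pow (X : Corr.{u, v} A) : ℕ → Corr.{u, v} A
  | 0 => X
  | k + 1 => tensor X (pow X k)

/-- The algebraic direct sum of a sequence of correspondences. -/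
abbrev DSum (Y : ℕ → Corr.{u, v} A) : Type v := DirectSum ℕ fun k => (Y k).carrier

/-- The inclusion of the `k`-th summand. -/
noncomputable abbrev DSum.lof (Y : ℕ → Corr.{u, v} A) (k : ℕ) : (Y k).carrier →ₗ[ℂ] DSum Y :=
  DirectSum.lof ℂ ℕ (fun k => (Y k).carrier) k

variable (Y : ℕ → Corr.{u, v} A)

lemma DSum.induction {p : DSum Y → Prop} (v : DSum Y) (h0 : p 0)
    (h1 : ∀ k y, p (DSum.lof Y k y)) (h2 : ∀ v w, p v → p w → p (v + w)) : p v :=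
  DirectSum.induction_on v h0 h1 h2

/-- The inner product `⟪v, w⟫ = ∑ k, ⟪v k, w k⟫`. -/
noncomputable def dsumIp (v : DSum Y) : DSum Y →ₗ[ℂ] A :=
  DirectSum.toModule ℂ ℕ A fun k => (Y k).str.ip (v k)

lemma DSum.lof_same (k : ℕ) (y : (Y k).carrier) : DSum.lof Y k y k = y := by
  rw [DirectSum.lof_apply]

lemma DSum.lof_ne {j k : ℕ} (h : k ≠ j) (y : (Y j).carrier) : DSum.lof Y j y k = 0 :=
  DirectSum.of_eq_of_ne _ _ _ h

lemma dsumIp_lof (v : DSum Y) (k : ℕ) (y : (Y k).carrier) :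
    dsumIp Y v (DSum.lof Y k y) = (Y k).str.ip (v k) y := by
  rw [dsumIp, DirectSum.toModule_lof]

lemma dsumIp_star (v w : DSum Y) : star (dsumIp Y v w) = dsumIp Y w v := by
  have hz : ∀ v, dsumIp Y 0 v = 0 := fun v => by
    induction v using DSum.induction with
    | h0 => simp
    | h1 k y =>
      rw [dsumIp_lof]
      change (Y k).str.ip 0 y = 0
      rw [← (Y k).str.star_ip, map_zero, star_zero]
    | h2 v w hv hw => rw [map_add, hv, hw, add_zero]
  have ha : ∀ u v w, dsumIp Y (u + v) w = dsumIp Y u w + dsumIp Y v w := fun u v w => by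
    induction w using DSum.induction with
    | h0 => simp
    | h1 k y =>
      rw [dsumIp_lof, dsumIp_lof, dsumIp_lof, DirectSum.add_apply, (Y k).str.ip_add_left]
    | h2 w w' h h' => rw [map_add, map_add, map_add, h, h']; abel
  induction v using DSum.induction with
  | h0 => rw [hz, star_zero, map_zero]
  | h2 v v' h h' => rw [ha, star_add, h, h', map_add]
  | h1 j y =>
    induction w using DSum.induction with
    | h0 => rw [hz, map_zero, star_zero]
    | h2 w w' h h' => rw [ha, map_add, star_add, h, h']
    | h1 k z =>
      rw [dsumIp_lof, dsumIp_lof, (Y k).str.star_ip]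
      by_cases hjk : j = k
      · subst hjk
        rw [DirectSum.lof_apply, DirectSum.lof_apply]
      · rw [DirectSum.lof_eq_of, DirectSum.lof_eq_of, DirectSum.of_eq_of_ne _ _ _ (Ne.symm hjk),
          DirectSum.of_eq_of_ne _ _ _ hjk, map_zero, ← (Y j).str.star_ip, map_zero, star_zero]

lemma lof_dsumIp (k : ℕ) (y : (Y k).carrier) (v : DSum Y) :
    dsumIp Y (DSum.lof Y k y) v = (Y k).str.ip y (v k) := by
  rw [← dsumIp_star, dsumIp_lof, (Y k).str.star_ip]

/-- The componentwise right action. -/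
noncomputable def dsumRmul : DSum Y →ₗ[ℂ] A →ₗ[ℂ] DSum Y :=
  DirectSum.toModule ℂ ℕ (A →ₗ[ℂ] DSum Y) fun k => (Y k).str.rmul.compr₂ (DSum.lof Y k)

lemma dsumRmul_lof (k : ℕ) (y : (Y k).carrier) (a : A) :
    dsumRmul Y (DSum.lof Y k y) a = DSum.lof Y k ((Y k).str.rmul y a) := by
  rw [dsumRmul, DirectSum.toModule_lof, LinearMap.compr₂_apply]

/-- The componentwise left action. -/
noncomputable def dsumLmul : A →ₗ[ℂ] DSum Y →ₗ[ℂ] DSum Y :=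
  (DirectSum.toModule ℂ ℕ (A →ₗ[ℂ] DSum Y) fun k =>
    (Y k).str.lmul.flip.compr₂ (DSum.lof Y k)).flip

lemma dsumLmul_lof (k : ℕ) (y : (Y k).carrier) (a : A) :
    dsumLmul Y a (DSum.lof Y k y) = DSum.lof Y k ((Y k).str.lmul a y) := by
  rw [dsumLmul, LinearMap.flip_apply, DirectSum.toModule_lof, LinearMap.compr₂_apply,
    LinearMap.flip_apply]

lemma dsumLmul_apply (a : A) (v : DSum Y) (k : ℕ) :
    dsumLmul Y a v k = (Y k).str.lmul a (v k) := by
  induction v using DSum.induction with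
  | h0 => simp
  | h1 j y =>
    rw [dsumLmul_lof]
    by_cases hjk : j = k
    · subst hjk
      rw [DirectSum.lof_apply, DirectSum.lof_apply]
    · rw [DirectSum.lof_eq_of, DirectSum.lof_eq_of, DirectSum.of_eq_of_ne _ _ _ (Ne.symm hjk),
        DirectSum.of_eq_of_ne _ _ _ (Ne.symm hjk), map_zero]
  | h2 v w h h' => rw [map_add, DirectSum.add_apply, DirectSum.add_apply, h, h', map_add]

/-- The algebraic direct sum of a sequence of correspondences, with `⟪v, w⟫ = ∑ k, ⟪v k, w k⟫` and
the componentwise actions. -/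
noncomputable def dsum : PreCorr A (DSum Y) where
  ip := dsumIp Y
  rmul := dsumRmul Y
  lmul := dsumLmul Y
  star_ip := dsumIp_star Y
  ip_nonneg v := by
    classical
    have h : dsumIp Y v v = ∑ k ∈ DFinsupp.support v, (Y k).str.ip (v k) (v k) := by
      conv_lhs => rw [← DirectSum.sum_support_of v, map_sum]
      simp only [DirectSum.sum_support_of]
      exact Finset.sum_congr rfl fun k _ => dsumIp_lof Y v k (v k)
    rw [h]
    exact Finset.sum_nonneg fun k _ => (Y k).str.ip_nonneg _
  ip_rmul v w a := by
    induction w using DSum.induction with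
    | h0 => simp
    | h1 k y => rw [dsumRmul_lof, dsumIp_lof, dsumIp_lof, (Y k).str.ip_rmul]
    | h2 w w' h h' => simp [h, h', add_mul]
  rmul_mul v a b := by
    induction v using DSum.induction with
    | h0 => simp
    | h1 k y => simp only [dsumRmul_lof, (Y k).str.rmul_mul]
    | h2 w w' h h' => simp [h, h']
  lmul_mul a b v := by
    induction v using DSum.induction with
    | h0 => simp
    | h1 k y => simp only [dsumLmul_lof, (Y k).str.lmul_mul]
    | h2 w w' h h' => simp [h, h']
  ip_lmul a v w := by
    induction w using DSum.induction with
    | h0 => simp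
    | h1 k y =>
      rw [dsumLmul_lof, dsumIp_lof, dsumIp_lof, dsumLmul_apply, (Y k).str.ip_lmul]
    | h2 w w' h h' => simp [h, h']
  lmul_rmul a v b := by
    induction v using DSum.induction with
    | h0 => simp
    | h1 k y => simp only [dsumRmul_lof, dsumLmul_lof, (Y k).str.lmul_rmul]
    | h2 w w' h h' => simp [h, h']

/-- The algebraic Fock space `A Ω ⊕ X ⊕ (X ⊗_A X) ⊕ ⋯`. -/
noncomputable def preFock (X : Corr.{u, v} A) : PreCorr A (A × DSum X.pow) :=
  (PreCorr.self A).prod (dsum X.pow)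

/-- The Fock space `F(X) = A Ω ⊕ ⨁_{k ≥ 1} X^{⊗ k}`, a Hilbert `A`-`A`-bimodule. -/
noncomputable def fock (X : Corr.{u, v} A) : Corr.{u, max u v} A := ofPre X.preFock

/-- The map `a ↦ a Ω`. -/
noncomputable def vac (X : Corr.{u, v} A) : A →ₗ[ℂ] X.fock.carrier :=
  X.preFock.toCompl ∘ₗ LinearMap.inl ℂ A (DSum X.pow)

/-- `a ↦ x a`, into the summand of degree one. -/
noncomputable def up₀ (X : Corr.{u, v} A) (x : X.carrier) : A →ₗ[ℂ] (X.pow 0).carrier :=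
  X.str.rmul x

/-- `x' ↦ ⟪x, x'⟫`, on the summand of degree one. -/
noncomputable def down₀ (X : Corr.{u, v} A) (x : X.carrier) : (X.pow 0).carrier →ₗ[ℂ] A :=
  X.str.ip x

/-- `η ↦ x ⊗ η`, from degree `k + 1` to degree `k + 2`. -/
noncomputable def up (X : Corr.{u, v} A) (x : X.carrier) (k : ℕ) :
    (X.pow k).carrier →ₗ[ℂ] (X.pow (k + 1)).carrier := create X (X.pow k) x

/-- `x' ⊗ η ↦ ⟪x, x'⟫ η`, from degree `k + 2` to degree `k + 1`. -/
noncomputable def down (X : Corr.{u, v} A) (x : X.carrier) (k : ℕ) :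
    (X.pow (k + 1)).carrier →ₗ[ℂ] (X.pow k).carrier := (annihilate X (X.pow k) x).toLinearMap

lemma ip_up₀ (X : Corr.{u, v} A) (x : X.carrier) (a : A) (z : (X.pow 0).carrier) :
    (X.pow 0).str.ip (X.up₀ x a) z = star a * X.down₀ x z := X.str.ip_rmul_left x z a

lemma down₀_up₀ (X : Corr.{u, v} A) (x : X.carrier) (a : A) :
    X.down₀ x (X.up₀ x a) = X.str.ip x x * a := X.str.ip_rmul x x a

lemma ip_up (X : Corr.{u, v} A) (x : X.carrier) (k : ℕ) (y : (X.pow k).carrier)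
    (z : (X.pow (k + 1)).carrier) :
    (X.pow (k + 1)).str.ip (X.up x k y) z = (X.pow k).str.ip y (X.down x k z) :=
  ip_create X (X.pow k) x y z

lemma down_up (X : Corr.{u, v} A) (x : X.carrier) (k : ℕ) (y : (X.pow k).carrier) :
    X.down x k (X.up x k y) = (X.pow k).str.lmul (X.str.ip x x) y :=
  annihilate_create X (X.pow k) x y

/-- On the algebraic Fock space: `a Ω ↦ x a` and `η ↦ x ⊗ η`. -/
noncomputable def preCreate (X : Corr.{u, v} A) (x : X.carrier) :
    A × DSum X.pow →ₗ[ℂ] A × DSum X.pow :=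
  LinearMap.inr ℂ A (DSum X.pow) ∘ₗ
    (DSum.lof X.pow 0 ∘ₗ X.up₀ x).coprod
      (DirectSum.toModule ℂ ℕ (DSum X.pow) fun k => DSum.lof X.pow (k + 1) ∘ₗ X.up x k)

/-- The formal adjoint of `preCreate` on the component of degree `k + 1`. -/
noncomputable def preAnnAux (X : Corr.{u, v} A) (x : X.carrier) :
    (k : ℕ) → (X.pow k).carrier →ₗ[ℂ] A × DSum X.pow
  | 0 => LinearMap.inl ℂ A (DSum X.pow) ∘ₗ X.down₀ x
  | k + 1 => LinearMap.inr ℂ A (DSum X.pow) ∘ₗ DSum.lof X.pow k ∘ₗ X.down x k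

/-- The formal adjoint of `preCreate`: `a Ω ↦ 0`, `x' ↦ ⟪x, x'⟫ Ω`, `x' ⊗ η ↦ ⟪x, x'⟫ η`. -/
noncomputable def preAnn (X : Corr.{u, v} A) (x : X.carrier) :
    A × DSum X.pow →ₗ[ℂ] A × DSum X.pow :=
  DirectSum.toModule ℂ ℕ (A × DSum X.pow) (X.preAnnAux x) ∘ₗ LinearMap.snd ℂ A (DSum X.pow)

lemma preCreate_inl (X : Corr.{u, v} A) (x : X.carrier) (a : A) :
    X.preCreate x (a, 0) = (0, DSum.lof X.pow 0 (X.up₀ x a)) := by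
  simp [preCreate]

lemma preCreate_inr (X : Corr.{u, v} A) (x : X.carrier) (k : ℕ) (y : (X.pow k).carrier) :
    X.preCreate x (0, DSum.lof X.pow k y) = (0, DSum.lof X.pow (k + 1) (X.up x k y)) := by
  simp only [preCreate, LinearMap.comp_apply, LinearMap.coprod_apply, map_zero, zero_add]
  rw [DirectSum.toModule_lof]
  rfl

lemma preAnn_inl (X : Corr.{u, v} A) (x : X.carrier) (a : A) :
    X.preAnn x (a, 0) = 0 := by
  simp [preAnn]

lemma preAnn_inr (X : Corr.{u, v} A) (x : X.carrier) (k : ℕ) (y : (X.pow k).carrier) :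
    X.preAnn x (0, DSum.lof X.pow k y) = X.preAnnAux x k y := by
  simp only [preAnn, LinearMap.comp_apply, LinearMap.snd_apply]
  rw [DirectSum.toModule_lof]

lemma preAnnAux_zero (X : Corr.{u, v} A) (x : X.carrier) (y : (X.pow 0).carrier) :
    X.preAnnAux x 0 y = (X.down₀ x y, 0) := rfl

lemma preAnnAux_succ (X : Corr.{u, v} A) (x : X.carrier) (k : ℕ) (y : (X.pow (k + 1)).carrier) :
    X.preAnnAux x (k + 1) y = (0, DSum.lof X.pow k (X.down x k y)) := rfl

lemma preFock_induction (X : Corr.{u, v} A) {p : A × DSum X.pow → Prop} (v : A × DSum X.pow)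
    (h0 : ∀ a, p (a, 0)) (h1 : ∀ k y, p (0, DSum.lof X.pow k y))
    (h2 : ∀ v w, p v → p w → p (v + w)) : p v := by
  obtain ⟨a, v⟩ := v
  have h : p (0, v) := by
    induction v using DSum.induction with
    | h0 => exact h0 0
    | h1 k y => exact h1 k y
    | h2 v w hv hw => simpa using h2 _ _ hv hw
  simpa using h2 _ _ (h0 a) h

lemma preFock_ip (X : Corr.{u, v} A) (v w : A × DSum X.pow) :
    X.preFock.ip v w = star v.1 * w.1 + dsumIp X.pow v.2 w.2 := rfl

lemma preFock_ip_mk (X : Corr.{u, v} A) (a b : A) (v w : DSum X.pow) :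
    X.preFock.ip (a, v) (b, w) = star a * b + dsumIp X.pow v w := rfl

lemma preFock_lmul (X : Corr.{u, v} A) (a : A) (v : A × DSum X.pow) :
    X.preFock.lmul a v = (a * v.1, dsumLmul X.pow a v.2) := rfl

lemma preAnn_preCreate (X : Corr.{u, v} A) (x : X.carrier) (v : A × DSum X.pow) :
    X.preAnn x (X.preCreate x v) = X.preFock.lmul (X.str.ip x x) v := by
  induction v using X.preFock_induction with
  | h0 a =>
    rw [preCreate_inl, preAnn_inr, preAnnAux_zero, down₀_up₀, preFock_lmul, map_zero]
  | h1 k y =>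
    rw [preCreate_inr, preAnn_inr, preAnnAux_succ, down_up, preFock_lmul, dsumLmul_lof, mul_zero]
  | h2 v w hv hw => rw [map_add, map_add, hv, hw, map_add]

lemma preCreate_adj (X : Corr.{u, v} A) (x : X.carrier) (v w : A × DSum X.pow) :
    X.preFock.ip (X.preCreate x v) w = X.preFock.ip v (X.preAnn x w) := by
  have hA : ∀ a, dsumIp X.pow 0 a = 0 := fun a => by
    rw [← dsumIp_star, map_zero, star_zero]
  induction v using X.preFock_induction with
  | h2 v v' h h' => rw [map_add, X.preFock.ip_add_left, X.preFock.ip_add_left, h, h']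
  | h0 a =>
    rw [preCreate_inl]
    induction w using X.preFock_induction with
    | h2 w w' h h' => simp only [map_add, h, h']
    | h0 b => rw [preAnn_inl]; simp [preFock_ip_mk]
    | h1 k y =>
      rw [preAnn_inr]
      cases k with
      | zero =>
        rw [preAnnAux_zero, preFock_ip_mk, preFock_ip_mk, hA, lof_dsumIp, DSum.lof_same, ip_up₀]
        simp
      | succ k =>
        rw [preAnnAux_succ, preFock_ip_mk, preFock_ip_mk, hA, lof_dsumIp,
          DSum.lof_ne _ (by simp)]
        simp
  | h1 k y =>
    rw [preCreate_inr]
    induction w using X.preFock_induction with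
    | h2 w w' h h' => simp only [map_add, h, h']
    | h0 b => rw [preAnn_inl]; simp [preFock_ip_mk]
    | h1 j z =>
      rw [preAnn_inr]
      cases j with
      | zero =>
        rw [preAnnAux_zero, preFock_ip_mk, preFock_ip_mk, map_zero, lof_dsumIp,
          DSum.lof_ne _ (by simp)]
        simp
      | succ j =>
        rw [preAnnAux_succ, preFock_ip_mk, preFock_ip_mk, lof_dsumIp, lof_dsumIp]
        by_cases hjk : k = j
        · subst hjk
          rw [DSum.lof_same, DSum.lof_same, ip_up]
        · rw [DSum.lof_ne _ (by simpa), DSum.lof_ne _ hjk, map_zero, map_zero]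

/-- The creation operator `T_x` on the Fock space. -/
noncomputable def creation (X : Corr.{u, v} A) (x : X.carrier) : X.fock.Adj :=
  Adj.ofPre X.preFock (X.preCreate x) (X.preAnn x) (X.preCreate_adj x)
    (Real.sqrt_nonneg ‖X.str.ip x x‖)
    (X.preFock.nrm_map_le X.preFock (X.preCreate_adj x) (X.str.ip x x) (X.preAnn_preCreate x))

/-- The Toeplitz--Pimsner algebra `T_X`: the C⋆-algebra of adjointable operators on the Fock space
generated by the creation operators and the left action of `A`. -/
noncomputable def toeplitz (X : Corr.{u, v} A) : NonUnitalStarSubalgebra ℂ X.fock.Adj :=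
  (NonUnitalStarAlgebra.adjoin ℂ (Set.range X.creation ∪ Set.range X.fock.left)).topologicalClosure

end Fock

end Corr

namespace Corr

section Toeplitz

variable {A : Type u} [NonUnitalCStarAlgebra A] [PartialOrder A] [StarOrderedRing A]
  (X : Corr.{u, v} A)

lemma star_left (a : A) : star (X.left a) = X.left (star a) :=
  Adj.ext_ip fun x y => by
    rw [Adj.star_right]
    exact X.str.ip_lmul a x y

/-- The creation operator `T_x` as an element of `T_X`. -/
noncomputable def toeplitzT (x : X.carrier) : X.toeplitz :=
  ⟨X.creation x, subset_closure (NonUnitalStarAlgebra.subset_adjoin ℂ _ (.inl ⟨x, rfl⟩))⟩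

/-- The left action of `a ∈ A` as an element of `T_X`, i.e. the embedding `A → T_X`. -/
noncomputable def toeplitzOf (a : A) : X.toeplitz :=
  ⟨X.fock.left a, subset_closure (NonUnitalStarAlgebra.subset_adjoin ℂ _ (.inr ⟨a, rfl⟩))⟩

lemma isSelfAdjoint_toeplitzOf {a : A} (ha : IsSelfAdjoint a) :
    IsSelfAdjoint (X.toeplitzOf a) :=
  Subtype.ext ((X.fock.star_left a).trans (congrArg X.fock.left ha))

/-- `e` is the vacuum compression `⟪Ω, T Ω⟫ ∈ A` of `T`. As `Ω` itself need not belong to the Fock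
space when `A` is not unital, this means `⟪a Ω, T (b Ω)⟫ = a⋆ e b` for all `a`, `b`, which
determines `e`. -/
def IsVacuumCompression (T : X.toeplitz) (e : A) : Prop :=
  ∀ a b : A, X.fock.str.ip (X.vac a) ((T : X.fock.Adj).op (X.vac b)) = star a * e * b

end Toeplitz

end Corr

section CompactOperators

variable {L : Type*} [NormedAddCommGroup L] [InnerProductSpace ℂ L] [CompleteSpace L]

lemma IsCompactOperator.star {T : L →L[ℂ] L} (hT : IsCompactOperator T) :
    IsCompactOperator (star T : L →L[ℂ] L) := by
  have hS : IsCompactOperator (T * Star.star T : L →L[ℂ] L) := hT.comp_clm (Star.star T)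
  have htb : TotallyBounded ((T * Star.star T : L →L[ℂ] L) '' Metric.ball 0 1) :=
    (hS.isCompact_closure_image_ball 1).totallyBounded.subset subset_closure
  have key : ∀ z : L, ‖(Star.star T : L →L[ℂ] L) z‖ ^ 2
      ≤ ‖(T * Star.star T : L →L[ℂ] L) z‖ * ‖z‖ := fun z => by
    have h : ⟪(Star.star T : L →L[ℂ] L) z, (Star.star T : L →L[ℂ] L) z⟫_ℂ
        = ⟪(T * Star.star T : L →L[ℂ] L) z, z⟫_ℂ := by
      rw [ContinuousLinearMap.star_eq_adjoint, ContinuousLinearMap.adjoint_inner_right]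
      rfl
    have h0 := inner_self_eq_norm_sq_to_K (𝕜 := ℂ) ((Star.star T : L →L[ℂ] L) z)
    rw [h] at h0
    have h1 := congrArg norm h0
    rw [norm_pow, RCLike.norm_ofReal, abs_norm] at h1
    rw [← h1]
    exact norm_inner_le_norm _ _
  refine (isCompactOperator_iff_isCompact_closure_image_ball
    (Star.star T : L →L[ℂ] L).toLinearMap one_pos).2 ?_
  refine TotallyBounded.isCompact_of_isClosed ?_ isClosed_closure
  refine TotallyBounded.closure ?_
  rw [Metric.totallyBounded_iff]
  intro ε hε
  obtain ⟨t, htf, htc⟩ := Metric.totallyBounded_iff.1 htb (ε ^ 2 / 8) (by positivity)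
  classical
  have hch : ∀ c : L, ∃ z : L, (∃ z' ∈ Metric.ball (0 : L) 1, dist ((T * Star.star T) z') c < ε ^ 2 / 8) →
      z ∈ Metric.ball (0 : L) 1 ∧ dist ((T * Star.star T) z) c < ε ^ 2 / 8 := fun c => by
    by_cases h : ∃ z' ∈ Metric.ball (0 : L) 1, dist ((T * Star.star T) z') c < ε ^ 2 / 8
    · exact ⟨h.choose, fun _ => h.choose_spec⟩
    · exact ⟨0, fun h' => (h h').elim⟩
  choose s hs using hch
  refine ⟨(fun c => (Star.star T : L →L[ℂ] L) (s c)) '' t, htf.image _, ?_⟩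
  rintro _ ⟨z, hz, rfl⟩
  obtain ⟨c, hc, hzc⟩ := Set.mem_iUnion₂.1 (htc ⟨z, hz, rfl⟩)
  obtain ⟨h1, h2⟩ := hs c ⟨z, hz, hzc⟩
  refine Set.mem_iUnion₂.2 ⟨_, ⟨c, hc, rfl⟩, ?_⟩
  rw [mem_ball_zero_iff] at hz h1
  have h3 : ‖(T * Star.star T : L →L[ℂ] L) (z - s c)‖ < ε ^ 2 / 4 := by
    rw [map_sub, ← dist_eq_norm]
    calc _ ≤ dist ((T * Star.star T : L →L[ℂ] L) z) c
          + dist ((T * Star.star T : L →L[ℂ] L) (s c)) c := dist_triangle_right _ _ _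
      _ < ε ^ 2 / 8 + ε ^ 2 / 8 := add_lt_add hzc h2
      _ = ε ^ 2 / 4 := by ring
  have h4 : ‖z - s c‖ ≤ 2 := (norm_sub_le _ _).trans (by linarith)
  rw [Metric.mem_ball, dist_eq_norm]
  change ‖(Star.star T : L →L[ℂ] L) z - (Star.star T : L →L[ℂ] L) (s c)‖ < ε
  rw [← map_sub]
  refine lt_of_pow_lt_pow_left₀ 2 hε.le ((key _).trans_lt ?_)
  nlinarith [norm_nonneg ((T * Star.star T : L →L[ℂ] L) (z - s c)), norm_nonneg (z - s c)]

variable (L) in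
/-- The C⋆-algebra `K(L)` of compact operators on a Hilbert space. -/
def compactOps : NonUnitalStarSubalgebra ℂ (L →L[ℂ] L) where
  carrier := {T | IsCompactOperator T}
  mul_mem' {_ T} hS _ := hS.comp_clm T
  add_mem' hS hT := hS.add hT
  zero_mem' := isCompactOperator_zero
  smul_mem' c _ hT := hT.smul c
  star_mem' hT := hT.star

end CompactOperators

/-- The separable infinite-dimensional Hilbert space `ℓ²(S)`, for `S = ℕ`, or `ℓ²(G)`. -/
noncomputable abbrev ellTwo (S : Type*) : Type _ := lp (fun _ : S => ℂ) 2

/-- The algebra `K` of compact operators on the separable infinite-dimensional Hilbert space. -/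
noncomputable abbrev KK : Type := compactOps (ellTwo ℕ)

/-- A minimal projection: a nonzero projection `e` with `e M e = ℂ e`. -/
structure IsMinimalProjection {M : Type*} [NonUnitalRing M] [StarRing M] [Module ℂ M]
    (e : M) : Prop where
  isStarProjection : IsStarProjection e
  ne_zero : e ≠ 0
  minimal : ∀ a, ∃ c : ℂ, e * a * e = c • e

section Subalgebras

variable {M : Type*} [NonUnitalNormedRing M] [StarRing M] [Module ℂ M] [StarModule ℂ M]
  [IsScalarTower ℂ M M] [SMulCommClass ℂ M M]

/-- The corner `p M p`. -/
def corner (p : M) (hp : IsSelfAdjoint p) : NonUnitalStarSubalgebra ℂ M where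
  carrier := {a | ∃ b, a = p * b * p}
  mul_mem' := by
    rintro _ _ ⟨b, rfl⟩ ⟨c, rfl⟩
    exact ⟨b * p * p * c, by simp only [mul_assoc]⟩
  add_mem' := by
    rintro _ _ ⟨b, rfl⟩ ⟨c, rfl⟩
    exact ⟨b + c, by rw [mul_add, add_mul]⟩
  zero_mem' := ⟨0, by simp⟩
  smul_mem' := by
    rintro c _ ⟨b, rfl⟩
    exact ⟨c • b, by rw [mul_smul_comm, smul_mul_assoc]⟩
  star_mem' := by
    rintro _ ⟨b, rfl⟩
    exact ⟨star b, by simp only [star_mul, hp.star_eq, mul_assoc]⟩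

/-- The elements of the subalgebra `C` that are fixed by the action `Γ`. -/
def fixedPoints {G : Type*} [Group G] (Γ : G →* (M ≃⋆ₐ[ℂ] M)) (C : NonUnitalStarSubalgebra ℂ M) :
    NonUnitalStarSubalgebra ℂ M where
  carrier := {a | a ∈ C ∧ ∀ g, Γ g a = a}
  mul_mem' := fun ha hb => ⟨mul_mem ha.1 hb.1, fun g => by rw [map_mul, ha.2, hb.2]⟩
  add_mem' := fun ha hb => ⟨add_mem ha.1 hb.1, fun g => by rw [map_add, ha.2, hb.2]⟩
  zero_mem' := ⟨zero_mem C, fun g => map_zero _⟩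
  smul_mem' := fun c _ ha => ⟨SMulMemClass.smul_mem c ha.1, fun g => by rw [map_smul, ha.2]⟩
  star_mem' := fun ha => ⟨star_mem ha.1, fun g => by rw [map_star, ha.2]⟩

/-- `Φ` is a conditional expectation of `C` onto `D ⊆ C`: a positive contractive linear projection
onto `D` which is a `D`-bimodule map. -/
structure IsConditionalExpectation (C D : NonUnitalStarSubalgebra ℂ M) (Φ : C →ₗ[ℂ] M) : Prop where
  le : D ≤ C
  mem : ∀ a, Φ a ∈ D
  apply_eq : ∀ a : C, (a : M) ∈ D → Φ a = a
  map_mul_left : ∀ d a : C, (d : M) ∈ D → Φ (d * a) = d * Φ a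
  map_mul_right : ∀ a d : C, (d : M) ∈ D → Φ (a * d) = Φ a * d
  norm_le : ∀ a, ‖Φ a‖ ≤ ‖(a : M)‖
  nonneg : ∀ a : C, ∃ d ∈ D, Φ (star a * a) = star d * d

end Subalgebras

section Pimsner

variable {E : Type u} [NonUnitalCStarAlgebra E] [PartialOrder E] [StarOrderedRing E]
  {H : Type v} [NormedAddCommGroup H] [InnerProductSpace ℂ H] [CompleteSpace H]

/-- The action `a ↦ π(a) ⊗ 1` of `E` on the algebraic tensor product `H ⊗ ℓ²(G)`. -/
noncomputable def ampliation (G : Type w) (π : E →⋆ₙₐ[ℂ] (H →L[ℂ] H)) :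
    E →ₗ[ℂ] H ⊗[ℂ] ellTwo G →ₗ[ℂ] H ⊗[ℂ] ellTwo G :=
  LinearMap.rTensorHom (ellTwo G) ∘ₗ ContinuousLinearMap.coeLM ℂ ∘ₗ LinearMapClass.linearMap π

lemma ampliation_tmul (G : Type w) (π : E →⋆ₙₐ[ℂ] (H →L[ℂ] H)) (a : E) (ζ : H) (f : ellTwo G) :
    ampliation G π a (ζ ⊗ₜ f) = π a ζ ⊗ₜ f := rfl

lemma ampliation_mul (G : Type w) (π : E →⋆ₙₐ[ℂ] (H →L[ℂ] H)) (a b : E) (k : H ⊗[ℂ] ellTwo G) :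
    ampliation G π (a * b) k = ampliation G π a (ampliation G π b k) := by
  induction k with
  | zero => simp
  | add k k' h h' => rw [map_add, map_add, map_add, h, h']
  | tmul ζ f => simp [ampliation_tmul]

lemma ampliation_star (G : Type w) (π : E →⋆ₙₐ[ℂ] (H →L[ℂ] H)) (a : E)
    (k l : H ⊗[ℂ] ellTwo G) :
    ⟪ampliation G π a k, l⟫_ℂ = ⟪k, ampliation G π (star a) l⟫_ℂ := by
  induction k with
  | zero => simp
  | add k k' h h' => rw [map_add, inner_add_left, inner_add_left, h, h']
  | tmul ζ f =>
    induction l with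
    | zero => simp
    | add l l' h h' => rw [map_add, inner_add_right, inner_add_right, h, h']
    | tmul ξ f' =>
      rw [ampliation_tmul, ampliation_tmul, TensorProduct.inner_tmul, TensorProduct.inner_tmul,
        map_star, ContinuousLinearMap.star_eq_adjoint, ContinuousLinearMap.adjoint_inner_right]

/-- The Hilbert `E`-`E`-bimodule `X = H ⊗ ℓ²(G) ⊗ E` of a representation `π` of `E` on `H`, with
`⟪ζ ⊗ δ_h ⊗ x, ξ ⊗ δ_k ⊗ y⟫ = ⟪ζ, ξ⟫ ⟪δ_h, δ_k⟫ x⋆ y` and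
`a (ζ ⊗ δ_h ⊗ x) b = π(a) ζ ⊗ δ_h ⊗ x b`. -/
noncomputable def pimsnerModule (G : Type w) (π : E →⋆ₙₐ[ℂ] (H →L[ℂ] H)) :
    Corr.{u, max u v w} E :=
  Corr.ofPre (PreCorr.exterior (ampliation G π) (ampliation_mul G π) (ampliation_star G π))

/-- The vector `ζ ⊗ δ_h ⊗ x`. -/
noncomputable def pimsnerTmul {G : Type w} (π : E →⋆ₙₐ[ℂ] (H →L[ℂ] H)) (ζ : H) (h : G) (x : E) :
    (pimsnerModule G π).carrier :=
  open Classical in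
  (PreCorr.exterior (ampliation G π) (ampliation_mul G π) (ampliation_star G π)).toCompl
    ((ζ ⊗ₜ[ℂ] (lp.single 2 h (1 : ℂ) : ellTwo G)) ⊗ₜ[ℂ] x)

/-- `Γ` is the quasi-free action of `G` on `T_X` induced by the unitary representation `U`: for
`x, y ∈ E` such that `y = U_g x U_g⋆` it maps `T_{ζ ⊗ δ_h ⊗ x}` to `T_{U_g ζ ⊗ δ_{gh} ⊗ y}`, and it
maps `x ∈ E ⊆ T_X` to `y`. -/
structure IsQuasiFree {G : Type w} [Group G] (π : E →⋆ₙₐ[ℂ] (H →L[ℂ] H))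
    (U : G →* unitary (H →L[ℂ] H))
    (Γ : G →* ((pimsnerModule G π).toeplitz ≃⋆ₐ[ℂ] (pimsnerModule G π).toeplitz)) : Prop where
  map_creation : ∀ (g : G) (x y : E),
    π y = (U g : H →L[ℂ] H) * π x * star (U g : H →L[ℂ] H) → ∀ (ζ : H) (h : G),
    Γ g ((pimsnerModule G π).toeplitzT (pimsnerTmul π ζ h x)) =
      (pimsnerModule G π).toeplitzT (pimsnerTmul π ((U g : H →L[ℂ] H) ζ) (g * h) y)
  map_of : ∀ (g : G) (x y : E),
    π y = (U g : H →L[ℂ] H) * π x * star (U g : H →L[ℂ] H) →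
    Γ g ((pimsnerModule G π).toeplitzOf x) = (pimsnerModule G π).toeplitzOf y

/-- `π` is nondegenerate: the vectors `π(a) ζ` span a dense subspace of `H`. -/
def IsNondegenerate (π : E →⋆ₙₐ[ℂ] (H →L[ℂ] H)) : Prop :=
  Dense (Submodule.span ℂ {ζ : H | ∃ (a : E) (ξ : H), π a ξ = ζ} : Set H)

lemma isSelfAdjoint_map_one_tmul {B : Type*} [CStarAlgebra B] (j : B ⊗[ℂ] KK →⋆ₙₐ[ℂ] E) {e₀ : KK}
    (he₀ : IsMinimalProjection e₀) : IsSelfAdjoint (j (1 ⊗ₜ e₀)) := by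
  rw [IsSelfAdjoint, ← map_star, TensorProduct.star_tmul, star_one,
    he₀.isStarProjection.isSelfAdjoint.star_eq]

variable {B : Type*} [CStarAlgebra B]

/-- The corner `A_E = (1 ⊗ e₀) T_X (1 ⊗ e₀)`, where `j` is the inclusion of `B ⊗ K` into `E`. -/
noncomputable def pimsnerCorner (G : Type w) (π : E →⋆ₙₐ[ℂ] (H →L[ℂ] H))
    (j : B ⊗[ℂ] KK →⋆ₙₐ[ℂ] E) (e₀ : KK) (he₀ : IsMinimalProjection e₀) :
    NonUnitalStarSubalgebra ℂ (pimsnerModule G π).toeplitz :=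
  corner ((pimsnerModule G π).toeplitzOf (j (1 ⊗ₜ e₀)))
    ((pimsnerModule G π).isSelfAdjoint_toeplitzOf (isSelfAdjoint_map_one_tmul j he₀))

/-- The embedding `ι(b) = b ⊗ e₀` of `B` into `E ⊆ T_X`. -/
noncomputable def pimsnerIota (G : Type w) (π : E →⋆ₙₐ[ℂ] (H →L[ℂ] H))
    (j : B ⊗[ℂ] KK →⋆ₙₐ[ℂ] E) (e₀ : KK) (b : B) : (pimsnerModule G π).toeplitz :=
  (pimsnerModule G π).toeplitzOf (j (b ⊗ₜ e₀))

end Pimsner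

/-! Write `p = 1 ⊗ e₀` and `α_g = Ad U_g` on `E`. The map `W_g : ζ ⊗ δ_h ⊗ x ↦ U_g ζ ⊗ δ_{gh} ⊗
α_g(x)` of `X` is not `E`-linear, but it transforms inner products and the left action by `α_g`
(`PreCorr.Twist`). This suffices to take tensor powers and direct sums, so `W_g` has a second
quantization on the Fock module. Conjugation by it is an automorphism of the adjointable operators
with `T_x ↦ T_{W_g x}` and `a ↦ α_g(a)`, hence preserves the Toeplitz algebra (`quasiFree`).
Uniqueness holds because automorphisms are continuous and are prescribed on generators
(`toeplitz_equiv_ext`).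

The heart of the matter is the fixed point algebra, which is small because translation on `ℓ²(G)` is
mixing: `⟪λ_g f, f'⟫ → 0` as `g → ∞` in the infinite group `G`. It follows that `⟪W_g x, y⟫ → 0` in
norm for all `x`, `y` in `X`, and so the annihilation operators `T_{W_g x}⋆` tend strongly to zero
(`tendsto_star_creation`). By the relation `T_x⋆ T_y = ⟪x, y⟫` every polynomial `S` in the
generators is normally ordered: an element `a` of `E` plus terms beginning with a creation operator
or ending with an annihilation operator. The latter become weakly null when they are moved by `g →
∞` (`IsNormallyOrdered.exists_tendsto`).

Let `T = p T p` be fixed and `‖T - S‖ < ε`. Since `U_g p = p`, every `α_g` is trivial on `p E p`, so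
`T - p a p` is fixed too. It is the compression by `p` of `Γ_g(T - S) + Γ_g(S - a)`, where the first
term has norm less than `ε` and the second is weakly null; therefore `‖T - p a p‖ ≤ ε`
(`exists_norm_sub_left_le`). Compressing to the vacuum, which leaves `p a p` unchanged, shows that
`T` equals its own vacuum compression (`eq_left_of_fixed`). Finally `p E p` lies in the ideal, and
`e₀ K e₀ = ℂ e₀` gives `p E p = B ⊗ e₀` (`exists_corner_eq`).

On the corner the vacuum compression is `T ↦ ⟪p Ω, T (p Ω)⟫`, where `p Ω` replaces the possibly
missing vector `Ω`. Its values lie in `p E p`, which is exactly the fixed point algebra, and the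
properties of a conditional expectation are those of a vector state with values in `E`. -/

namespace Corr

/-! ### Completeness of the algebra of adjointable operators. -/

section CStar

variable {A : Type u} [NonUnitalCStarAlgebra A] [PartialOrder A] [StarOrderedRing A]
  {X : Corr.{u, v} A}

/-- The algebra of adjointable operators is complete: adjoints of a Cauchy sequence converge. -/
instance : CompleteSpace X.Adj := by
  refine Metric.complete_of_cauchySeq_tendsto fun f hf => ?_
  have h1 : CauchySeq fun n => (f n).op :=
    cauchySeq_of_le_tendsto_0 _ (fun n m N hn hm => (cauchySeq_iff_le_tendsto_0.1 hf).choose_spec.2.1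
      n m N hn hm) (cauchySeq_iff_le_tendsto_0.1 hf).choose_spec.2.2
  have hf' : CauchySeq fun n => star (f n) := hf.map star_isometry.uniformContinuous
  have h2 : CauchySeq fun n => (star (f n)).op :=
    cauchySeq_of_le_tendsto_0 _ (fun n m N hn hm =>
      (cauchySeq_iff_le_tendsto_0.1 hf').choose_spec.2.1
      n m N hn hm) (cauchySeq_iff_le_tendsto_0.1 hf').choose_spec.2.2
  obtain ⟨T, hT⟩ := cauchySeq_tendsto_of_complete h1
  obtain ⟨S, hS⟩ := cauchySeq_tendsto_of_complete h2
  have hadj : ∀ x y, X.str.ip (T x) y = X.str.ip x (S y) := fun x y => by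
    have hTx : Filter.Tendsto (fun n => (f n).op x) Filter.atTop (nhds (T x)) :=
      ((ContinuousLinearMap.apply ℂ _ x).continuous.tendsto T).comp hT
    have hSy : Filter.Tendsto (fun n => (star (f n)).op y) Filter.atTop (nhds (S y)) :=
      ((ContinuousLinearMap.apply ℂ _ y).continuous.tendsto S).comp hS
    have e1 := ((X.continuous_ip y).tendsto _).comp hTx
    have e2 := ((X.continuous_ip x).tendsto _).comp hSy
    rw [← X.str.star_ip]
    refine tendsto_nhds_unique (e1.star) (e2.congr fun n => ?_)
    simp only [Function.comp_apply, X.str.star_ip, Adj.star_right]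
  let T' : X.Adj := (⟨T, S, hadj⟩ : X.adjointable)
  have h3 := tendsto_iff_norm_sub_tendsto_zero.1 hT
  exact ⟨T', (tendsto_iff_norm_sub_tendsto_zero (b := T')).2 h3⟩

variable (X) in
/-- The C⋆-algebra structure on the adjointable operators. -/
noncomputable abbrev adjCStarAlgebra : NonUnitalCStarAlgebra X.Adj where

instance isClosed_toeplitz (X : Corr.{u, v} A) : IsClosed (X.toeplitz : Set X.fock.Adj) :=
  NonUnitalStarSubalgebra.isClosed_topologicalClosure _

end CStar

end Corr

/-! ### Twisted automorphisms of pre-correspondences. -/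

namespace PreCorr

section Twist

variable {A : Type u} [NonUnitalCStarAlgebra A] [PartialOrder A]
  {V : Type v} [AddCommGroup V] [Module ℂ V]

/-- A linear automorphism of a pre-correspondence that is twisted by the automorphism `α` of the
coefficient algebra. -/
structure Twist (P : PreCorr A V) (α : A ≃⋆ₐ[ℂ] A) where
  equiv : V ≃ₗ[ℂ] V
  ip_map : ∀ v w, P.ip (equiv v) (equiv w) = α (P.ip v w)
  lmul_map : ∀ a v, equiv (P.lmul a v) = P.lmul (α a) (equiv v)

namespace Twist

variable {P : PreCorr A V} {α : A ≃⋆ₐ[ℂ] A}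

/-- The inverse of a twisted automorphism. -/
def symm (W : P.Twist α) : P.Twist α.symm where
  equiv := W.equiv.symm
  ip_map v w := by
    refine α.injective ((W.ip_map _ _).symm.trans ?_)
    rw [W.equiv.apply_symm_apply, W.equiv.apply_symm_apply]
    exact (α.apply_symm_apply _).symm
  lmul_map a v := by
    apply W.equiv.injective
    rw [W.lmul_map]
    simp

variable [StarOrderedRing A]

/-- Injective ⋆-homomorphisms of C⋆-algebras are isometric, so the twist by `α` does not affect
norms. This is what lets twisted automorphisms pass to completions. -/
lemma nrm_map (W : P.Twist α) (v : V) : P.nrm (W.equiv v) = P.nrm v := by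
  rw [nrm, nrm, W.ip_map, NonUnitalStarAlgHom.norm_map α α.injective]

/-- The extension of a twisted automorphism to the completion. -/
noncomputable def complMap (W : P.Twist α) : P.Compl →L[ℂ] P.Compl :=
  P.mapCompl P W.equiv.toLinearMap

lemma complMap_toCompl (W : P.Twist α) (v : V) :
    W.complMap (P.toCompl v) = P.toCompl (W.equiv v) :=
  P.mapCompl_toCompl P _ (C := 1) (fun v => by rw [one_mul]; exact (W.nrm_map v).le) v

/-- The extension of a twisted automorphism to the completion. -/
noncomputable def compl (W : P.Twist α) : P.compl.Twist α where
  equiv := LinearEquiv.ofLinearMap W.complMap.toLinearMap W.symm.complMap.toLinearMap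
    (by
      rw [← ContinuousLinearMap.toLinearMap_comp]
      refine congrArg (ContinuousLinearMap.toLinearMap) (clm_ext (g := .id ℂ _) fun v => ?_)
      simp [complMap_toCompl, symm])
    (by
      rw [← ContinuousLinearMap.toLinearMap_comp]
      refine congrArg (ContinuousLinearMap.toLinearMap) (clm_ext (g := .id ℂ _) fun v => ?_)
      simp [complMap_toCompl, symm])
  ip_map x y := by
    change P.ipC (W.complMap x) (W.complMap y) = α (P.ipC x y)
    have hα : Continuous α := (NonUnitalStarAlgHom.isometry α α.injective).continuous
    refine P.dense_induction₂ x y (isClosed_eq (by fun_prop) (by fun_prop)) fun v w => ?_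
    rw [complMap_toCompl, complMap_toCompl, ipC_toCompl, ipC_toCompl, W.ip_map]
  lmul_map a x := by
    change W.complMap (P.lmulC a x) = P.lmulC (α a) (W.complMap x)
    refine P.dense_induction x (isClosed_eq (by fun_prop) (by fun_prop)) fun v => ?_
    simp only [lmulC_toCompl, complMap_toCompl, W.lmul_map]

lemma compl_toCompl (W : P.Twist α) (v : V) :
    W.compl.equiv (P.toCompl v) = P.toCompl (W.equiv v) := W.complMap_toCompl v

variable (A) in
/-- `α` as a twisted automorphism of `A` over itself. -/
noncomputable def self (α : A ≃⋆ₐ[ℂ] A) : (PreCorr.self A).Twist α where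
  equiv := { α with map_smul' := fun c a => map_smul α c a }
  ip_map v w := by
    change star (α v) * α w = α (star v * w)
    rw [map_mul, map_star]
  lmul_map a v := map_mul α a v

variable {V' : Type*} [AddCommGroup V'] [Module ℂ V'] {Q : PreCorr A V'}

/-- The direct sum of two twisted automorphisms. -/
noncomputable def prod (W : P.Twist α) (W' : Q.Twist α) : (P.prod Q).Twist α where
  equiv := W.equiv.prodCongr W'.equiv
  ip_map v w := by
    change P.ip _ _ + Q.ip _ _ = α (P.ip _ _ + Q.ip _ _)
    rw [map_add, ← W.ip_map, ← W'.ip_map]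
    rfl
  lmul_map a v := Prod.ext (W.lmul_map a v.1) (W'.lmul_map a v.2)

/-- The tensor product of two twisted automorphisms. -/
noncomputable def tensor (W : P.Twist α) (W' : Q.Twist α) : (P.tensor Q).Twist α where
  equiv := TensorProduct.congr W.equiv W'.equiv
  ip_map v w := by
    change tensorIp P Q _ _ = α (tensorIp P Q _ _)
    induction v with
    | zero => simp
    | add v v' h h' => simp [h, h']
    | tmul k x =>
      induction w with
      | zero => simp
      | add w w' h h' => simp only [map_add, h, h']
      | tmul l y => simp [W.ip_map, ← W'.lmul_map, W'.ip_map]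
  lmul_map a v := by
    change TensorProduct.congr W.equiv W'.equiv (LinearMap.rTensorHom V' (P.lmul a) v)
      = LinearMap.rTensorHom V' (P.lmul (α a)) (TensorProduct.congr W.equiv W'.equiv v)
    induction v with
    | zero => simp
    | add v v' h h' => simp only [map_add, h, h']
    | tmul k x => simp [W.lmul_map]

end Twist

end Twist

end PreCorr

/-! ### Second quantization and conjugation of operators. -/

namespace Corr

section Twist

variable {A : Type u} [NonUnitalCStarAlgebra A] [PartialOrder A] [StarOrderedRing A]
  {α : A ≃⋆ₐ[ℂ] A}

/-- The direct sum of a sequence of twisted automorphisms. -/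
noncomputable def dsumTwist (Y : ℕ → Corr.{u, v} A) (W : ∀ k, (Y k).str.Twist α) :
    (dsum Y).Twist α where
  equiv := DFinsupp.mapRange.linearEquiv fun k => (W k).equiv
  ip_map v w := by
    change dsumIp Y _ _ = α (dsumIp Y _ _)
    induction w using DSum.induction with
    | h0 => simp
    | h2 w w' h h' => simp only [map_add, h, h']
    | h1 k y =>
      have : (DFinsupp.mapRange.linearEquiv fun k => (W k).equiv) (DSum.lof Y k y)
        = DSum.lof Y k ((W k).equiv y) := DFinsupp.mapRange_single (hf := fun _ => map_zero _)
      rw [this, dsumIp_lof, dsumIp_lof, ← (W k).ip_map]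
      rfl
  lmul_map a v := by
    change _ = dsumLmul Y _ _
    refine DFinsupp.ext fun k => ?_
    have h1 := dsumLmul_apply Y a v k
    have h2 := dsumLmul_apply Y (α a) ((DFinsupp.mapRange.linearEquiv fun k => (W k).equiv) v) k
    refine Eq.trans ?_ h2.symm
    change (W k).equiv (dsumLmul Y a v k) = _
    rw [h1, (W k).lmul_map]
    rfl

lemma dsumTwist_lof (Y : ℕ → Corr.{u, v} A) (W : ∀ k, (Y k).str.Twist α) (k : ℕ)
    (y : (Y k).carrier) :
    (dsumTwist Y W).equiv (DSum.lof Y k y) = DSum.lof Y k ((W k).equiv y) :=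
  DFinsupp.mapRange_single (hf := fun _ => map_zero _)

variable {X : Corr.{u, v} A}

/-- Compatibility with the right action need not be part of `PreCorr.Twist`: in a genuine Hilbert
module the inner product separates points and determines it. -/
lemma twist_rmul (W : X.str.Twist α) (x : X.carrier) (a : A) :
    W.equiv (X.str.rmul x a) = X.str.rmul (W.equiv x) (α a) :=
  ext_ip fun z => by
    obtain ⟨z, rfl⟩ := W.equiv.surjective z
    rw [W.ip_map, X.str.ip_rmul, X.str.ip_rmul, W.ip_map, map_mul]

lemma norm_twist (W : X.str.Twist α) (x : X.carrier) : ‖W.equiv x‖ = ‖x‖ := by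
  rw [← nrm_eq, ← nrm_eq, W.nrm_map]

/-- A twisted automorphism as an isometry. -/
noncomputable def twistIsometry (W : X.str.Twist α) : X.carrier ≃ₗᵢ[ℂ] X.carrier :=
  ⟨W.equiv, norm_twist W⟩

/-- The tensor powers of a twisted automorphism. -/
noncomputable def powTwist (W : X.str.Twist α) : ∀ k, (X.pow k).str.Twist α
  | 0 => W
  | _ + 1 => (W.tensor (powTwist W _)).compl

lemma powTwist_up (W : X.str.Twist α) (x : X.carrier) (k : ℕ) (y : (X.pow k).carrier) :
    (powTwist W (k + 1)).equiv (X.up x k y)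
      = X.up (W.equiv x) k ((powTwist W k).equiv y) :=
  (W.tensor (powTwist W k)).compl_toCompl (x ⊗ₜ y)

/-- The second quantization of a twisted automorphism on the algebraic Fock space. -/
noncomputable def preFockTwist (W : X.str.Twist α) : X.preFock.Twist α :=
  (PreCorr.Twist.self A α).prod (dsumTwist X.pow (powTwist W))

lemma preFockTwist_inl (W : X.str.Twist α) (a : A) :
    (preFockTwist W).equiv (a, 0) = (α a, 0) :=
  Prod.ext (by rfl) (map_zero (dsumTwist X.pow (powTwist W)).equiv)

lemma preFockTwist_inr (W : X.str.Twist α) (k : ℕ) (y : (X.pow k).carrier) :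
    (preFockTwist W).equiv (0, DSum.lof X.pow k y)
      = (0, DSum.lof X.pow k ((powTwist W k).equiv y)) :=
  Prod.ext (by exact map_zero α) (dsumTwist_lof X.pow (powTwist W) k y)

/-- This covariance is what makes conjugation carry `T_x` to `T_{W x}`. Degree zero rests on
`twist_rmul`, the higher degrees on the definition of the tensor powers of `W`. -/
lemma preFockTwist_preCreate (W : X.str.Twist α) (x : X.carrier) (v : A × DSum X.pow) :
    (preFockTwist W).equiv (X.preCreate x v)
      = X.preCreate (W.equiv x) ((preFockTwist W).equiv v) := by
  induction v using X.preFock_induction with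
  | h0 a =>
    rw [preCreate_inl, preFockTwist_inl, preCreate_inl, preFockTwist_inr]
    exact congrArg (fun y => ((0 : A), DSum.lof X.pow 0 y)) (twist_rmul W x a)
  | h1 k y =>
    rw [preCreate_inr, preFockTwist_inr, preFockTwist_inr, preCreate_inr, powTwist_up]
  | h2 v w hv hw => simp only [map_add, hv, hw]

variable (X) in
/-- The inclusion of the algebraic Fock space in the Fock space. -/
noncomputable def toFock : A × DSum X.pow →ₗ[ℂ] X.fock.carrier := X.preFock.toCompl

variable (X) in
@[elab_as_elim]
lemma fock_dense_induction {p : X.fock.carrier → Prop} (z : X.fock.carrier)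
    (hc : IsClosed {z | p z}) (h : ∀ v, p (X.toFock v)) : p z := X.preFock.dense_induction z hc h

lemma ip_toFock (v w : A × DSum X.pow) :
    X.fock.str.ip (X.toFock v) (X.toFock w) = X.preFock.ip v w := X.preFock.ipC_toCompl v w

lemma norm_toFock (v : A × DSum X.pow) : ‖X.toFock v‖ = X.preFock.nrm v :=
  X.preFock.norm_toCompl v

/-- The second quantization of a twisted automorphism. -/
noncomputable def fockTwist (W : X.str.Twist α) : X.fock.str.Twist α := (preFockTwist W).compl

lemma fockTwist_toFock (W : X.str.Twist α) (v : A × DSum X.pow) :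
    (fockTwist W).equiv (X.toFock v) = X.toFock ((preFockTwist W).equiv v) :=
  (preFockTwist W).compl_toCompl v

lemma fockTwist_vac (W : X.str.Twist α) (a : A) :
    (fockTwist W).equiv (X.vac a) = X.vac (α a) :=
  (fockTwist_toFock W (a, 0)).trans (congrArg X.toFock (preFockTwist_inl W a))

lemma creation_toFock (x : X.carrier) (v : A × DSum X.pow) :
    (X.creation x).op (X.toFock v) = X.toFock (X.preCreate x v) :=
  X.preFock.mapCompl_toCompl X.preFock _ 
    (X.preFock.nrm_map_le X.preFock (X.preCreate_adj x) (X.str.ip x x) (X.preAnn_preCreate x)) v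

/-- The adjoint `star` is obtained by choice, so it has to be identified with the explicit
annihilation map by testing inner products against a dense set. -/
lemma star_creation_toFock (x : X.carrier) (v : A × DSum X.pow) :
    (star (X.creation x)).op (X.toFock v) = X.toFock (X.preAnn x v) := by
  refine ext_ip fun z => (Adj.star_right _ _ _).trans ?_
  refine X.fock_dense_induction z (isClosed_eq ?_ ?_) fun w => ?_
  · exact (X.preFock.ipC.continuous.comp (X.creation x).op.continuous).clm_apply continuous_const
  · exact X.preFock.ipC.continuous.clm_apply continuous_const
  · rw [creation_toFock, ip_toFock, ip_toFock, preCreate_adj]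

lemma left_op (a : A) (x : X.carrier) : (X.left a).op x = X.str.lmul a x := rfl

lemma fock_adj_ext {S T : X.fock.Adj}
    (h : ∀ v, S.op (X.toFock v) = T.op (X.toFock v)) : S = T :=
  Subtype.ext (PreCorr.clm_ext h)

/-- Conjugation of adjointable operators by a twisted automorphism. -/
noncomputable def conjAux (W : X.str.Twist α) (T : X.Adj) : X.Adj :=
  ⟨(twistIsometry W).toContinuousLinearEquiv.toContinuousLinearMap ∘L T.op ∘L
      (twistIsometry W).symm.toContinuousLinearEquiv.toContinuousLinearMap,
    (twistIsometry W).toContinuousLinearEquiv.toContinuousLinearMap ∘L (star T).op ∘L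
      (twistIsometry W).symm.toContinuousLinearEquiv.toContinuousLinearMap, fun x y => by
    obtain ⟨x, rfl⟩ := W.equiv.surjective x
    obtain ⟨y, rfl⟩ := W.equiv.surjective y
    change X.str.ip (W.equiv (T.op (W.equiv.symm (W.equiv x)))) (W.equiv y) =
      X.str.ip (W.equiv x) (W.equiv ((star T).op (W.equiv.symm (W.equiv y))))
    -- Both sides acquire the same `α`. Hence `W T W⁻¹` is adjointable, although `W` is only an
    -- `α`-twisted map.
    rw [W.ip_map, W.ip_map, W.equiv.symm_apply_apply, W.equiv.symm_apply_apply, Adj.star_right]⟩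

lemma conjAux_op (W : X.str.Twist α) (T : X.Adj) (x : X.carrier) :
    (conjAux W T).op (W.equiv x) = W.equiv (T.op x) :=
  congrArg (fun x => W.equiv (T.op x)) (W.equiv.symm_apply_apply x)

lemma adj_ext_twist (W : X.str.Twist α) {S T : X.Adj}
    (h : ∀ x, S.op (W.equiv x) = T.op (W.equiv x)) : S = T :=
  Subtype.ext (ContinuousLinearMap.ext fun x => by
    obtain ⟨x, rfl⟩ := W.equiv.surjective x
    exact h x)

/-- Conjugation of adjointable operators by a twisted automorphism. -/
noncomputable def conj (W : X.str.Twist α) : X.Adj ≃⋆ₐ[ℂ] X.Adj where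
  toFun := conjAux W
  invFun := conjAux W.symm
  left_inv T := adj_ext_twist W.symm fun x => by
    obtain ⟨x, rfl⟩ := W.equiv.surjective x
    rw [conjAux_op, conjAux_op]
    simp [PreCorr.Twist.symm]
  right_inv T := adj_ext_twist W fun x => by
    obtain ⟨x, rfl⟩ := W.symm.equiv.surjective x
    rw [conjAux_op, conjAux_op]
    simp [PreCorr.Twist.symm]
  map_mul' S T := adj_ext_twist W fun x => by simp only [conjAux_op, Adj.op_mul]
  map_add' S T := adj_ext_twist W fun x => by simp only [conjAux_op, Adj.op_add, map_add]
  map_smul' c T := adj_ext_twist W fun x => by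
    simp only [conjAux_op, Adj.op_smul, map_smul]
  map_star' T := Adj.ext_ip fun x y => by
    obtain ⟨x, rfl⟩ := W.equiv.surjective x
    obtain ⟨y, rfl⟩ := W.equiv.surjective y
    rw [Adj.star_right, conjAux_op, conjAux_op, W.ip_map, W.ip_map, Adj.star_right]

lemma conj_op (W : X.str.Twist α) (T : X.Adj) (x : X.carrier) :
    (conj W T).op (W.equiv x) = W.equiv (T.op x) := conjAux_op W T x

lemma conj_left (W : X.str.Twist α) (a : A) : conj W (X.left a) = X.left (α a) :=
  adj_ext_twist W fun x => by rw [conj_op, left_op, left_op, W.lmul_map]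

lemma conj_creation (W : X.str.Twist α) (x : X.carrier) :
    conj (fockTwist W) (X.creation x) = X.creation (W.equiv x) := by
  refine adj_ext_twist (fockTwist W) fun z => ?_
  rw [conj_op]
  refine X.fock_dense_induction z (isClosed_eq ?_ ?_) fun v => ?_
  · exact (twistIsometry (fockTwist W)).continuous.comp (X.creation x).op.continuous
  · exact (X.creation (W.equiv x)).op.continuous.comp (twistIsometry (fockTwist W)).continuous
  · rw [creation_toFock, fockTwist_toFock, fockTwist_toFock, creation_toFock,
      preFockTwist_preCreate]

lemma toeplitz_le {S : NonUnitalStarSubalgebra ℂ X.fock.Adj}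
    (hS : IsClosed (S : Set X.fock.Adj)) (hT : ∀ x, X.creation x ∈ S)
    (hl : ∀ a, X.fock.left a ∈ S) : X.toeplitz ≤ S := by
  refine NonUnitalStarSubalgebra.topologicalClosure_minimal _ (NonUnitalStarAlgebra.adjoin_le ?_) hS
  rintro _ (⟨x, rfl⟩ | ⟨a, rfl⟩)
  exacts [hT x, hl a]

end Twist

end Corr

/-! ### Toeplitz relations and normal ordering. -/

namespace Corr

section Relations

attribute [local instance] adjCStarAlgebra

variable {A : Type u} [NonUnitalCStarAlgebra A] [PartialOrder A] [StarOrderedRing A]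
  {X : Corr.{u, v} A}

lemma Adj.op_sub (S T : X.Adj) (x : X.carrier) : (S - T).op x = S.op x - T.op x := rfl

variable (X) in
/-- The left action of `A` by adjointable operators, as a homomorphism. -/
noncomputable def leftHom : A →⋆ₙₐ[ℂ] X.Adj where
  toFun := X.left
  map_smul' c a := Adj.ext_ip fun x y => by
    simp only [Adj.op_smul, left_op, map_smul, LinearMap.smul_apply, MonoidHom.id_apply]
  map_zero' := Adj.ext_ip fun x y => by
    rw [left_op, map_zero]
    rfl
  map_add' a b := Adj.ext_ip fun x y => by
    rw [Adj.op_add, left_op, left_op, left_op, map_add, LinearMap.add_apply]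
  map_mul' a b := Adj.ext_ip fun x y => by
    rw [Adj.op_mul, left_op, left_op, left_op, X.str.lmul_mul]
  map_star' a := (X.star_left a).symm

lemma leftHom_apply (a : A) : X.leftHom a = X.left a := rfl

lemma norm_left_le (a : A) : ‖X.left a‖ ≤ ‖a‖ :=
  NonUnitalStarAlgHom.norm_apply_le X.leftHom a

lemma left_toFock (a : A) (v : A × DSum X.pow) :
    (X.fock.left a).op (X.toFock v) = X.toFock (X.preFock.lmul a v) :=
  X.preFock.lmulC_toCompl a v

lemma annihilate_create_apply (Y : Corr.{u, v} A) (x x' : X.carrier) (y : Y.carrier) :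
    annihilate X Y x (create X Y x' y) = Y.str.lmul (X.str.ip x x') y :=
  annihilate_toCompl X Y x _

lemma preAnn_preCreate_apply (x y : X.carrier) (v : A × DSum X.pow) :
    X.preAnn x (X.preCreate y v) = X.preFock.lmul (X.str.ip x y) v := by
  induction v using X.preFock_induction with
  | h0 a =>
    rw [preCreate_inl, preAnn_inr, preAnnAux_zero, preFock_lmul, map_zero]
    exact congrArg (fun b => (b, (0 : DSum X.pow))) (X.str.ip_rmul x y a)
  | h1 k z =>
    rw [preCreate_inr, preAnn_inr, preAnnAux_succ, preFock_lmul, dsumLmul_lof, mul_zero]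
    exact congrArg (fun b => ((0 : A), DSum.lof X.pow k b))
      (annihilate_create_apply (X.pow k) x y z)
  | h2 v w hv hw => rw [map_add, map_add, hv, hw, map_add]

/-- The defining relation of the Toeplitz algebra. It allows any annihilation operator standing to
the left of a creation operator to be removed. -/
lemma star_creation_mul_creation (x y : X.carrier) :
    star (X.creation x) * X.creation y = X.fock.left (X.str.ip x y) :=
  fock_adj_ext fun v => by
    rw [Adj.op_mul, creation_toFock, star_creation_toFock, preAnn_preCreate_apply, left_toFock]

lemma norm_creation_le (x : X.carrier) : ‖X.creation x‖ ≤ ‖x‖ := by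
  refine (pow_le_pow_iff_left₀ (norm_nonneg _) (norm_nonneg _) two_ne_zero).1 ?_
  rw [X.norm_sq, pow_two, ← CStarRing.norm_star_mul_self, star_creation_mul_creation]
  exact norm_left_le _

variable (X) in
/-- The creation operator depends linearly and continuously on the vector. -/
noncomputable def creationL : X.carrier →L[ℂ] X.fock.Adj :=
  LinearMap.mkContinuous
    { toFun := X.creation
      map_add' := fun x y => fock_adj_ext fun v => by
        rw [Adj.op_add, creation_toFock, creation_toFock, creation_toFock, ← map_add]
        congr 1
        induction v using X.preFock_induction with
        | h0 a =>
          have : X.up₀ (x + y) = X.up₀ x + X.up₀ y := map_add X.str.rmul x y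
          simp [preCreate_inl, this]
        | h1 k z =>
          have : X.up (x + y) k z = X.up x k z + X.up y k z :=
            (congrArg (X.str.tensor (X.pow k).str).toCompl (TensorProduct.add_tmul x y z)).trans
              (map_add _ _ _)
          simp [preCreate_inr, this]
        | h2 v w hv hw =>
          simp only [map_add, hv, hw]
          abel
      map_smul' := fun c x => fock_adj_ext fun v => by
        rw [Adj.op_smul, creation_toFock, creation_toFock, ← map_smul]
        congr 1
        induction v using X.preFock_induction with
        | h0 a =>
          have : X.up₀ (c • x) = c • X.up₀ x := map_smul X.str.rmul c x
          simp [preCreate_inl, this]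
        | h1 k z =>
          have : X.up (c • x) k z = c • X.up x k z :=
            map_smul (X.str.tensor (X.pow k).str).toCompl c (x ⊗ₜ z)
          simp [preCreate_inr, this]
        | h2 v w hv hw => simp only [map_add, hv, hw, smul_add, RingHom.id_apply] } 1
    fun x => by rw [one_mul]; exact norm_creation_le x

lemma creationL_apply (x : X.carrier) : X.creationL x = X.creation x := rfl

lemma left_mul_creation (a : A) (x : X.carrier) :
    X.fock.left a * X.creation x = X.creation (X.str.lmul a x) :=
  fock_adj_ext fun v => by
    rw [Adj.op_mul, creation_toFock, left_toFock, creation_toFock]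
    congr 1
    induction v using X.preFock_induction with
    | h0 b =>
      rw [preCreate_inl, preCreate_inl, preFock_lmul, mul_zero, dsumLmul_lof]
      exact congrArg (fun b => ((0 : A), DSum.lof X.pow 0 b)) (X.str.lmul_rmul a x b)
    | h1 k z =>
      rw [preCreate_inr, preCreate_inr, preFock_lmul, mul_zero, dsumLmul_lof]
      exact congrArg (fun b => ((0 : A), DSum.lof X.pow (k + 1) b))
        ((X.str.tensor (X.pow k).str).lmulC_toCompl a (x ⊗ₜ z))
    | h2 v w hv hw => simp only [map_add, hv, hw]

/-- The identity says that the tensor products are balanced over `A`, which holds only after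
completion and not for algebraic tensors. It is therefore derived from the Toeplitz relation: `D =
T_x a - T_{x a}` satisfies `D⋆ D = 0`. -/
lemma creation_mul_left (x : X.carrier) (a : A) :
    X.creation x * X.fock.left a = X.creation (X.str.rmul x a) := by
  rw [← sub_eq_zero, ← CStarRing.star_mul_self_eq_zero_iff, star_sub, star_mul, sub_mul, mul_sub,
    mul_sub, star_creation_mul_creation, star_left, mul_assoc, mul_assoc,
    ← mul_assoc _ (X.creation x) (X.fock.left a), star_creation_mul_creation,
    star_creation_mul_creation, ← mul_assoc _ (X.creation x) (X.fock.left a),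
    star_creation_mul_creation]
  simp only [← leftHom_apply, ← map_mul, X.str.ip_rmul, X.str.ip_rmul_left, mul_assoc, sub_self]

lemma star_creation_mul_left (x : X.carrier) (a : A) :
    star (X.creation x) * X.fock.left a = star (X.creation (X.str.lmul (star a) x)) := by
  rw [← left_mul_creation, star_mul, star_left, star_star]

lemma left_mul_star_creation (x : X.carrier) (a : A) :
    X.fock.left a * star (X.creation x) = star (X.creation (X.str.rmul x (star a))) := by
  rw [← creation_mul_left, star_mul, star_left, star_star]

/-- Sums of normally ordered products of creation and annihilation operators. -/
inductive IsNormallyOrdered (X : Corr.{u, v} A) : X.fock.Adj → Prop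
  | left (a : A) : IsNormallyOrdered X (X.fock.left a)
  | creation (x : X.carrier) : IsNormallyOrdered X (X.creation x)
  | star_creation (x : X.carrier) : IsNormallyOrdered X (star (X.creation x))
  | creation_mul (x : X.carrier) {S : X.fock.Adj} :
      IsNormallyOrdered X S → IsNormallyOrdered X (X.creation x * S)
  | mul_star_creation (x : X.carrier) {S : X.fock.Adj} :
      IsNormallyOrdered X S → IsNormallyOrdered X (S * star (X.creation x))
  | add {S T : X.fock.Adj} :
      IsNormallyOrdered X S → IsNormallyOrdered X T → IsNormallyOrdered X (S + T)

namespace IsNormallyOrdered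

lemma smul (c : ℂ) {S : X.fock.Adj} (hS : IsNormallyOrdered X S) :
    IsNormallyOrdered X (c • S) := by
  induction hS with
  | left a =>
    rw [← leftHom_apply, ← map_smul]
    exact .left _
  | creation x =>
    rw [← creationL_apply, ← map_smul]
    exact .creation _
  | star_creation x =>
    have : c • star (X.creation x) = star (X.creation (star c • x)) := by
      rw [← creationL_apply, ← creationL_apply, map_smul, star_smul, star_star]
    rw [this]
    exact .star_creation _
  | creation_mul x _ h =>
    rw [← mul_smul_comm]
    exact .creation_mul x h
  | mul_star_creation x _ h =>
    rw [← smul_mul_assoc]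
    exact .mul_star_creation x h
  | add _ _ h h' =>
    rw [smul_add]
    exact .add h h'

lemma left_mul (a : A) {S : X.fock.Adj} (hS : IsNormallyOrdered X S) :
    IsNormallyOrdered X (X.fock.left a * S) := by
  induction hS with
  | left b =>
    rw [← leftHom_apply, ← leftHom_apply, ← map_mul]
    exact .left _
  | creation x =>
    rw [left_mul_creation]
    exact .creation _
  | star_creation x =>
    rw [left_mul_star_creation]
    exact .star_creation _
  | creation_mul x h _ =>
    rw [← mul_assoc, left_mul_creation]
    exact .creation_mul _ h
  | mul_star_creation x _ h =>
    rw [← mul_assoc]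
    exact .mul_star_creation x h
  | add _ _ h h' =>
    rw [mul_add]
    exact .add h h'

/-- The annihilation operator either meets a creation operator and contracts with it to an element
of `A`, or is absorbed into the annihilation operators on the right. -/
lemma star_creation_mul (z : X.carrier) {S : X.fock.Adj} (hS : IsNormallyOrdered X S) :
    IsNormallyOrdered X (star (X.creation z) * S) := by
  induction hS with
  | left b =>
    rw [star_creation_mul_left]
    exact .star_creation _
  | creation x =>
    rw [star_creation_mul_creation]
    exact .left _
  | star_creation x => exact .mul_star_creation _ (.star_creation _)
  | creation_mul x h _ =>
    rw [← mul_assoc, star_creation_mul_creation]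
    exact h.left_mul _
  | mul_star_creation x _ h =>
    rw [← mul_assoc]
    exact .mul_star_creation x h
  | add _ _ h h' =>
    rw [mul_add]
    exact .add h h'

/-- Normal ordering of words: generators and their adjoints are multiplied on from the left one at a
time, and each such multiplication preserves normal order by the relations above. -/
lemma of_mem_adjoin {T : X.fock.Adj}
    (hT : T ∈ NonUnitalStarAlgebra.adjoin ℂ (Set.range X.creation ∪ Set.range X.fock.left)) :
    IsNormallyOrdered X T := by
  rw [← NonUnitalStarSubalgebra.mem_toNonUnitalSubalgebra,
    NonUnitalStarAlgebra.adjoin_toNonUnitalSubalgebra] at hT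
  -- The induction is strengthened by the second conjunct because products of two normally ordered
  -- operators are not directly accessible, whereas the property of preserving normal order under
  -- left multiplication is clearly multiplicative.
  refine (show IsNormallyOrdered X T ∧ ∀ S, IsNormallyOrdered X S → IsNormallyOrdered X (T * S)
    from ?_).1
  induction hT using NonUnitalAlgebra.adjoin_induction with
  | mem T hT =>
    rcases hT with (⟨x, rfl⟩ | ⟨a, rfl⟩) | hT
    · exact ⟨.creation x, fun S hS => .creation_mul x hS⟩
    · exact ⟨.left a, fun S hS => hS.left_mul a⟩
    · rw [← star_star T]
      rcases hT with ⟨x, hx⟩ | ⟨a, ha⟩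
      · rw [← hx]
        exact ⟨.star_creation x, fun S hS => hS.star_creation_mul x⟩
      · rw [← ha, star_left]
        exact ⟨.left _, fun S hS => hS.left_mul _⟩
  | zero =>
    have h0 : IsNormallyOrdered X 0 := by
      rw [← map_zero X.fock.leftHom]
      exact .left 0
    exact ⟨h0, fun S _ => by rwa [zero_mul]⟩
  | add S T _ _ hS hT =>
    exact ⟨.add hS.1 hT.1, fun R hR => by rw [add_mul]; exact .add (hS.2 R hR) (hT.2 R hR)⟩
  | mul S T _ _ hS hT =>
    exact ⟨hS.2 T hT.1, fun R hR => by rw [mul_assoc]; exact hS.2 _ (hT.2 R hR)⟩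
  | smul c T _ hT =>
    exact ⟨hT.1.smul c, fun R hR => by rw [smul_mul_assoc]; exact (hT.2 R hR).smul c⟩

end IsNormallyOrdered

end Relations

end Corr

/-! ### Mixing families and weak limits. -/

/-- The set of vectors on which a bounded family of operators tends to zero is closed. -/
lemma isClosed_setOf_tendsto_zero {ι : Type*} {l : Filter ι} {V W : Type*}
    [SeminormedAddCommGroup V] [SeminormedAddCommGroup W] (F : ι → V → W) {C : ℝ}
    (hF : ∀ i x y, ‖F i x - F i y‖ ≤ C * ‖x - y‖) :
    IsClosed {x | Filter.Tendsto (fun i => F i x) l (nhds 0)} := by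
  refine isClosed_of_closure_subset fun x hx => ?_
  rw [Set.mem_ofPred_eq, NormedAddGroup.tendsto_nhds_zero]
  intro ε hε
  have hC : 0 < |C| + 1 := by positivity
  obtain ⟨y, hy, hxy⟩ := Metric.mem_closure_iff.1 hx (ε / 2 / (|C| + 1)) (by positivity)
  filter_upwards [NormedAddGroup.tendsto_nhds_zero.1 hy (ε / 2) (by positivity)] with i hi
  rw [dist_eq_norm, lt_div_iff₀ hC] at hxy
  have h1 : C * ‖x - y‖ ≤ |C| * ‖x - y‖ :=
    mul_le_mul_of_nonneg_right (le_abs_self C) (norm_nonneg _)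
  calc ‖F i x‖ = ‖F i x - F i y + F i y‖ := by rw [sub_add_cancel]
    _ ≤ ‖F i x - F i y‖ + ‖F i y‖ := norm_add_le _ _
    _ < ε := by nlinarith [hF i x y, norm_nonneg (x - y)]

namespace Corr

section Mixing

attribute [local instance] adjCStarAlgebra

variable {A : Type u} [NonUnitalCStarAlgebra A] [PartialOrder A] [StarOrderedRing A]
  {X : Corr.{u, v} A} {ι : Type*} {l : Filter ι} {α : ι → A ≃⋆ₐ[ℂ] A}
  (W : ∀ i, X.str.Twist (α i))

lemma norm_conj {α : A ≃⋆ₐ[ℂ] A} (W : X.str.Twist α) (T : X.Adj) : ‖conj W T‖ = ‖T‖ :=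
  NonUnitalStarAlgHom.norm_map (conj W) (conj W).injective T

lemma norm_ip_op_le (T : X.Adj) (x y : X.carrier) :
    ‖X.str.ip x (T.op y)‖ ≤ ‖T‖ * ‖x‖ * ‖y‖ :=
  calc ‖X.str.ip x (T.op y)‖ ≤ ‖x‖ * ‖T.op y‖ := X.norm_ip_le _ _
    _ ≤ ‖x‖ * (‖T‖ * ‖y‖) := by gcongr; exact T.op.le_opNorm y
    _ = _ := by ring

/-- Taking `x = T y` gives `‖T y‖² ≤ C ‖T y‖ ‖y‖`. The lemma turns estimates of matrix coefficients,
which survive weak limits, into norm estimates. -/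
lemma Adj.norm_le_of_ip {T : X.Adj} {C : ℝ} (hC : 0 ≤ C)
    (h : ∀ x y, ‖X.str.ip x (T.op y)‖ ≤ C * ‖x‖ * ‖y‖) : ‖T‖ ≤ C :=
  ContinuousLinearMap.opNorm_le_bound _ hC fun y => by
    have h1 := h (T.op y) y
    rw [← X.norm_sq] at h1
    by_contra hlt
    rw [not_le] at hlt
    have h2 : 0 < ‖T.op y‖ := (mul_nonneg hC (norm_nonneg y)).trans_lt hlt
    change C * ‖y‖ < ‖T.op y‖ at hlt
    nlinarith

lemma norm_toFock_inl (a : A) : ‖X.toFock (a, 0)‖ = ‖a‖ := by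
  rw [norm_toFock, PreCorr.nrm, preFock_ip_mk, map_zero, add_zero, CStarRing.norm_star_mul_self,
    Real.sqrt_mul_self (norm_nonneg a)]

lemma norm_toFock_lof (k : ℕ) (y : (X.pow k).carrier) :
    ‖X.toFock (0, DSum.lof X.pow k y)‖ = ‖y‖ := by
  rw [norm_toFock, PreCorr.nrm, preFock_ip_mk, mul_zero, zero_add, dsumIp_lof, DSum.lof_same]
  exact (X.pow k).nrm_eq y

/-- If `⟪W_i x, y⟫ → 0` for all vectors, then the annihilation operators of `W_i x` tend strongly
to zero. -/
lemma tendsto_star_creation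
    (hW : ∀ x y, Filter.Tendsto (fun i => X.str.ip ((W i).equiv x) y) l (nhds 0))
    (x : X.carrier) (z : X.fock.carrier) :
    Filter.Tendsto (fun i => (star (X.creation ((W i).equiv x))).op z) l (nhds 0) := by
  have hbound : ∀ i z, ‖(star (X.creation ((W i).equiv x))).op z‖ ≤ ‖x‖ * ‖z‖ := fun i z => by
    refine ((star (X.creation ((W i).equiv x))).op.le_opNorm _).trans ?_
    gcongr
    change ‖star (X.creation ((W i).equiv x))‖ ≤ _
    rw [norm_star]
    exact (norm_creation_le _).trans (norm_twist (W i) x).le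
  refine X.fock_dense_induction z ?_ fun v => ?_
  · refine isClosed_setOf_tendsto_zero
      (fun i (z : X.fock.carrier) => (star (X.creation ((W i).equiv x))).op z) (C := ‖x‖)
      fun i z z' => ?_
    rw [← map_sub]
    exact hbound i _
  · induction v using X.preFock_induction with
    | h0 a =>
      simp only [star_creation_toFock, preAnn_inl, map_zero]
      exact tendsto_const_nhds
    | h2 v w hv hw =>
      have := hv.add hw
      rw [add_zero] at this
      exact this.congr fun i => by rw [map_add, map_add]
    | h1 k y =>
      cases k with
      | zero =>
        refine squeeze_zero_norm (fun i => ?_) (tendsto_zero_iff_norm_tendsto_zero.1 (hW x y))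
        rw [star_creation_toFock, preAnn_inr, preAnnAux_zero]
        exact (norm_toFock_inl _).le
      | succ k =>
        -- The operators are bounded by `‖x‖` uniformly in `i`, so convergence need only be checked
        -- on algebraic tensors.
        refine (X.str.tensor (X.pow k).str).dense_induction y ?_ fun t => ?_
        · refine isClosed_setOf_tendsto_zero (fun i (y : (X.pow (k + 1)).carrier) =>
            (star (X.creation ((W i).equiv x))).op (X.toFock (0, DSum.lof X.pow (k + 1) y)))
            (C := ‖x‖) fun i z z' => ?_
          rw [← map_sub, ← map_sub, Prod.mk_sub_mk, sub_zero, ← map_sub]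
          exact (hbound i _).trans_eq (by rw [norm_toFock_lof])
        · let L : X.carrier ⊗[ℂ] (X.pow k).carrier →ₗ[ℂ] X.fock.carrier :=
            X.toFock ∘ₗ LinearMap.inr ℂ A (DSum X.pow) ∘ₗ DSum.lof X.pow (k + 1) ∘ₗ
              (X.str.tensor (X.pow k).str).toCompl
          change Filter.Tendsto (fun i => (star (X.creation ((W i).equiv x))).op (L t)) l (nhds 0)
          induction t with
          | zero =>
            simp only [map_zero]
            exact tendsto_const_nhds
          | add t t' ht ht' =>
            have := ht.add ht'
            rw [add_zero] at this
            refine this.congr fun i => ?_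
            rw [map_add, map_add]
          | tmul x' η =>
            have h := X.preCreate_inr x' k η
            refine squeeze_zero_norm (a := fun i => ‖X.str.ip ((W i).equiv x) x'‖ *
              ‖X.toFock (0, DSum.lof X.pow k η)‖) (fun i => ?_) ?_
            · change ‖(star (X.creation ((W i).equiv x))).op
                (X.toFock (0, DSum.lof X.pow (k + 1) (X.up x' k η)))‖ ≤ _
              -- Read `x' ⊗ η` as `T_{x'} η`; the annihilation operator of `W_i x` then contracts it
              -- to `⟪W_i x, x'⟫ η`.
              rw [← h, ← creation_toFock, ← Adj.op_mul, star_creation_mul_creation]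
              refine ((X.fock.left _).op.le_opNorm _).trans ?_
              gcongr
              exact norm_left_le _
            · simpa using (hW x x').norm.mul_const ‖X.toFock (0, DSum.lof X.pow k η)‖

/-- A normally ordered operator is, up to an element of `A`, weakly null along `W`. -/
lemma IsNormallyOrdered.exists_tendsto
    (hW : ∀ x y, Filter.Tendsto (fun i => X.str.ip ((W i).equiv x) y) l (nhds 0))
    {T : X.fock.Adj} (hT : IsNormallyOrdered X T) :
    ∃ a : A, ∀ x y, Filter.Tendsto (fun i => X.fock.str.ip x
      ((conj (fockTwist (W i)) (T - X.fock.left a)).op y)) l (nhds 0) := by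
  -- The leading creation operator is moved to the other side of the inner product, where it becomes
  -- a strongly null annihilation operator; the remaining factor is bounded by `‖S‖ ‖z‖`.
  have h1 : ∀ (x : X.carrier) (S : X.fock.Adj) (y z : X.fock.carrier),
      Filter.Tendsto (fun i => X.fock.str.ip y
        ((conj (fockTwist (W i)) (X.creation x * S)).op z)) l (nhds 0) := fun x S y z => by
    refine squeeze_zero_norm (fun i => ?_) (a := fun i =>
      ‖(star (X.creation ((W i).equiv x))).op y‖ * (‖S‖ * ‖z‖)) ?_
    · rw [map_mul, conj_creation, Adj.op_mul, ← Adj.star_left]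
      refine (X.fock.norm_ip_le _ _).trans ?_
      gcongr
      refine ((conj (fockTwist (W i)) S).op.le_opNorm z).trans ?_
      gcongr
      exact (norm_conj _ S).le
    · simpa using (tendsto_star_creation W hW x y).norm.mul_const (‖S‖ * ‖z‖)
  -- The mirror case follows by taking adjoints, since weak nullity is stable under adjoints.
  have h2 : ∀ (x : X.carrier) (S : X.fock.Adj) (y z : X.fock.carrier),
      Filter.Tendsto (fun i => X.fock.str.ip y
        ((conj (fockTwist (W i)) (S * star (X.creation x))).op z)) l (nhds 0) := fun x S y z => by
    have := (h1 x (star S) z y).star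
    rw [star_zero] at this
    refine this.congr fun i => ?_
    rw [X.fock.str.star_ip, ← Adj.star_right, ← map_star, star_mul, star_star]
  have h0 : X.fock.left 0 = 0 := map_zero X.fock.leftHom
  induction hT with
  | left a => 
    refine ⟨a, fun y z => tendsto_const_nhds.congr fun i => ?_⟩
    rw [sub_self, map_zero]
    exact (map_zero (X.fock.str.ip y)).symm
  | creation x =>
    refine ⟨0, fun y z => ?_⟩
    have := h1 x 1 y z
    rwa [mul_one, ← sub_zero (X.creation x), ← h0] at this
  | star_creation x =>
    refine ⟨0, fun y z => ?_⟩
    have := h2 x 1 y z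
    rwa [one_mul, ← sub_zero (star (X.creation x)), ← h0] at this
  | creation_mul x _ _ =>
    refine ⟨0, fun y z => ?_⟩
    rw [h0, sub_zero]
    exact h1 x _ y z
  | mul_star_creation x _ _ =>
    refine ⟨0, fun y z => ?_⟩
    rw [h0, sub_zero]
    exact h2 x _ y z
  | @add S T _ _ h h' =>
    obtain ⟨a, ha⟩ := h
    obtain ⟨b, hb⟩ := h'
    refine ⟨a + b, fun y z => ?_⟩
    have := (ha y z).add (hb y z)
    rw [add_zero] at this
    refine this.congr fun i => ?_
    rw [← map_add, ← Adj.op_add, ← map_add, ← leftHom_apply, ← leftHom_apply, ← leftHom_apply,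
      map_add X.fock.leftHom]
    rw [add_sub_add_comm]

end Mixing

end Corr

/-! ### Quasi-free automorphisms and their fixed points. -/

namespace Corr

section Dynamics

attribute [local instance] adjCStarAlgebra

variable {A : Type u} [NonUnitalCStarAlgebra A] [PartialOrder A] [StarOrderedRing A]
  {X : Corr.{u, v} A}

/-- An automorphism maps the Toeplitz algebra into itself if it does so with the generators. -/
lemma map_mem_toeplitz (φ : X.fock.Adj ≃⋆ₐ[ℂ] X.fock.Adj)
    (hT : ∀ x, φ (X.creation x) ∈ X.toeplitz) (hl : ∀ a, φ (X.fock.left a) ∈ X.toeplitz)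
    {T : X.fock.Adj} (hmem : T ∈ X.toeplitz) : φ T ∈ X.toeplitz := by
  have hφ : Continuous φ := (NonUnitalStarAlgHom.isometry φ φ.injective).continuous
  let S : NonUnitalStarSubalgebra ℂ X.fock.Adj :=
    { carrier := {T | φ T ∈ X.toeplitz}
      add_mem' := fun {a b} ha hb => by
        rw [Set.mem_ofPred_eq] at ha hb ⊢
        rw [map_add]
        exact add_mem ha hb
      mul_mem' := fun {a b} ha hb => by
        rw [Set.mem_ofPred_eq] at ha hb ⊢
        rw [map_mul]
        exact mul_mem ha hb
      zero_mem' := by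
        rw [Set.mem_ofPred_eq, map_zero]
        exact zero_mem _
      smul_mem' := fun c a ha => by
        rw [Set.mem_ofPred_eq] at ha ⊢
        rw [map_smul]
        exact SMulMemClass.smul_mem c ha
      star_mem' := fun {a} ha => by
        rw [Set.mem_ofPred_eq] at ha ⊢
        rw [map_star]
        exact star_mem ha }
  exact toeplitz_le (S := S) ((isClosed_toeplitz X).preimage hφ) hT hl hmem

section Single

variable {α : A ≃⋆ₐ[ℂ] A} (W : X.str.Twist α)

lemma conj_mem_toeplitz {T : X.fock.Adj} (hT : T ∈ X.toeplitz) :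
    conj (fockTwist W) T ∈ X.toeplitz := by
  refine map_mem_toeplitz _ (fun x => ?_) (fun a => ?_) hT
  · rw [conj_creation]
    exact (X.toeplitzT _).2
  · rw [conj_left]
    exact (X.toeplitzOf _).2

/-- As `W` and `α` are onto, every generator is itself the image of a generator. This is what makes
the restriction to the Toeplitz algebra invertible. -/
lemma conj_symm_mem_toeplitz {T : X.fock.Adj} (hT : T ∈ X.toeplitz) :
    (conj (fockTwist W)).symm T ∈ X.toeplitz := by
  refine map_mem_toeplitz _ (fun x => ?_) (fun a => ?_) hT
  · obtain ⟨x, rfl⟩ := W.equiv.surjective x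
    rw [← conj_creation, StarAlgEquiv.symm_apply_apply]
    exact (X.toeplitzT _).2
  · obtain ⟨a, rfl⟩ : ∃ b, α b = a := α.surjective a
    rw [← conj_left (fockTwist W), StarAlgEquiv.symm_apply_apply]
    exact (X.toeplitzOf _).2

/-- The quasi-free automorphism of the Toeplitz algebra given by a twisted automorphism. -/
noncomputable def quasiFree : X.toeplitz ≃⋆ₐ[ℂ] X.toeplitz where
  toFun T := ⟨conj (fockTwist W) T, conj_mem_toeplitz W T.2⟩
  invFun T := ⟨(conj (fockTwist W)).symm T, conj_symm_mem_toeplitz W T.2⟩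
  left_inv _ := Subtype.ext ((conj (fockTwist W)).symm_apply_apply _)
  right_inv _ := Subtype.ext ((conj (fockTwist W)).apply_symm_apply _)
  map_mul' _ _ := Subtype.ext (map_mul (conj (fockTwist W)) _ _)
  map_add' _ _ := Subtype.ext (map_add (conj (fockTwist W)) _ _)
  map_smul' c _ := Subtype.ext (map_smul (conj (fockTwist W)) c _)
  map_star' _ := Subtype.ext (map_star (conj (fockTwist W)) _)

lemma coe_quasiFree (T : X.toeplitz) :
    (quasiFree W T : X.fock.Adj) = conj (fockTwist W) T := rfl

lemma quasiFree_toeplitzT (x : X.carrier) :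
    quasiFree W (X.toeplitzT x) = X.toeplitzT (W.equiv x) := Subtype.ext (conj_creation W x)

lemma quasiFree_toeplitzOf (a : A) :
    quasiFree W (X.toeplitzOf a) = X.toeplitzOf (α a) := Subtype.ext (conj_left (fockTwist W) a)

/-- A quasi-free automorphism intertwines the vacuum compressions. -/
lemma ip_vac_conj (T : X.fock.Adj) (a b : A) :
    X.fock.str.ip (X.vac (α a)) ((conj (fockTwist W) T).op (X.vac (α b)))
      = α (X.fock.str.ip (X.vac a) (T.op (X.vac b))) := by
  rw [← fockTwist_vac, ← fockTwist_vac, conj_op, (fockTwist W).ip_map]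

end Single

/-- Automorphisms of the Toeplitz algebra are determined on `A` and on the creation operators of
vectors spanning a dense subspace. -/
lemma toeplitz_equiv_ext {s : Set X.carrier}
    (hs : (Submodule.span ℂ s).topologicalClosure = ⊤)
    {φ ψ : X.toeplitz ≃⋆ₐ[ℂ] X.toeplitz}
    (hT : ∀ x ∈ s, φ (X.toeplitzT x) = ψ (X.toeplitzT x))
    (hl : ∀ a, φ (X.toeplitzOf a) = ψ (X.toeplitzOf a)) : φ = ψ := by
  have hφ : Continuous φ := (NonUnitalStarAlgHom.isometry φ φ.injective).continuous
  have hψ : Continuous ψ := (NonUnitalStarAlgHom.isometry ψ ψ.injective).continuous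
  -- With `T_x` continuous and linear in `x`, the vectors on which the automorphisms agree form a
  -- closed subspace, so agreement on a total set suffices.
  let TL : X.carrier →L[ℂ] X.toeplitz :=
    X.creationL.codRestrict X.toeplitz.toSubmodule fun x => (X.toeplitzT x).2
  have hT' : ∀ x, φ (X.toeplitzT x) = ψ (X.toeplitzT x) := fun x => by
    let K : Submodule ℂ X.carrier :=
      { carrier := {x | φ (TL x) = ψ (TL x)}
        add_mem' := fun {x y} hx hy => by
          rw [Set.mem_ofPred_eq] at hx hy ⊢
          rw [map_add, map_add, map_add, hx, hy]
        zero_mem' := by simp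
        smul_mem' := fun c x hx => by
          rw [Set.mem_ofPred_eq] at hx ⊢
          rw [map_smul, map_smul, map_smul, hx] }
    have hK : IsClosed (K : Set X.carrier) :=
      isClosed_eq (hφ.comp TL.continuous) (hψ.comp TL.continuous)
    have h1 := Submodule.topologicalClosure_minimal _ (Submodule.span_le (p := K).2 hT) hK
    rw [hs] at h1
    exact h1 (Submodule.mem_top (x := x))
  -- The automorphisms live only on the Toeplitz algebra, while `toeplitz_le` concerns subalgebras
  -- of all adjointable operators; membership is therefore built into the carrier.
  let S : NonUnitalStarSubalgebra ℂ X.fock.Adj :=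
    { carrier := {T | ∃ h : T ∈ X.toeplitz, φ ⟨T, h⟩ = ψ ⟨T, h⟩}
      add_mem' := by
        rintro a b ⟨ha, ha'⟩ ⟨hb, hb'⟩
        refine ⟨add_mem ha hb, ?_⟩
        have := congrArg₂ (· + ·) ha' hb'
        simp only [← map_add] at this
        exact this
      mul_mem' := by
        rintro a b ⟨ha, ha'⟩ ⟨hb, hb'⟩
        refine ⟨mul_mem ha hb, ?_⟩
        have := congrArg₂ (· * ·) ha' hb'
        simp only [← map_mul] at this
        exact this
      zero_mem' := ⟨zero_mem _, (map_zero φ).trans (map_zero ψ).symm⟩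
      smul_mem' := by
        rintro c a ⟨ha, ha'⟩
        refine ⟨SMulMemClass.smul_mem c ha, ?_⟩
        have := congrArg (c • ·) ha'
        simp only [← map_smul] at this
        exact this
      star_mem' := by
        rintro a ⟨ha, ha'⟩
        refine ⟨star_mem ha, ?_⟩
        have := congrArg star ha'
        simp only [← map_star] at this
        exact this }
  have hS : IsClosed (S : Set X.fock.Adj) := by
    have h1 : IsClosed {T : X.toeplitz | φ T = ψ T} := isClosed_eq hφ hψ
    have h2 := (isClosed_toeplitz X).isClosedMap_subtype_val
      _ h1
    convert h2 using 1
    ext T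
    constructor
    · rintro ⟨h, h'⟩
      exact ⟨⟨T, h⟩, h', rfl⟩
    · rintro ⟨⟨T, h⟩, h', rfl⟩
      exact ⟨h, h'⟩
  have h := toeplitz_le (S := S) hS (fun x => ⟨(X.toeplitzT x).2, hT' x⟩)
    fun a => ⟨(X.toeplitzOf a).2, hl a⟩
  exact StarAlgEquiv.ext fun T => (h T.2).2

section Vacuum

lemma ip_vac_left (a b c : A) :
    X.fock.str.ip (X.vac a) ((X.fock.left b).op (X.vac c)) = star a * b * c := by
  have h : (X.fock.left b).op (X.vac c) = X.vac (b * c) := by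
    refine (left_toFock b (c, 0)).trans ?_
    rw [preFock_lmul, map_zero]
    rfl
  rw [h]
  refine (ip_toFock (a, 0) (b * c, 0)).trans ?_
  rw [preFock_ip_mk, map_zero, add_zero, mul_assoc]

lemma norm_vac (a : A) : ‖X.vac a‖ = ‖a‖ := norm_toFock_inl a

lemma vac_mul (a b : A) : X.vac (a * b) = X.fock.str.rmul (X.vac a) b := by
  refine Eq.symm ((X.preFock.rmulC_toCompl (a, 0) b).trans ?_)
  refine congrArg X.preFock.toCompl (Prod.ext rfl ?_)
  exact LinearMap.congr_fun (map_zero (dsumRmul X.pow)) b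

lemma left_vac (a b : A) : (X.fock.left a).op (X.vac b) = X.vac (a * b) := by
  refine (left_toFock a (b, 0)).trans ?_
  rw [preFock_lmul, map_zero]
  rfl

/-- Right linearity is forced by the existence of an adjoint, because the inner product is right
linear and separates points. -/
lemma Adj.op_rmul {Y : Corr.{u, v} A} (T : Y.Adj) (y : Y.carrier) (a : A) :
    T.op (Y.str.rmul y a) = Y.str.rmul (T.op y) a :=
  Corr.ext_ip fun z => by
    rw [← Adj.star_left, Y.str.ip_rmul, Y.str.ip_rmul, Adj.star_left]

end Vacuum

lemma _root_.IsStarProjection.norm_le_one {R : Type*} [NonUnitalNormedRing R] [StarRing R]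
    [CStarRing R] {p : R} (hp : IsStarProjection p) : ‖p‖ ≤ 1 := by
  have h := CStarRing.norm_star_mul_self (x := p)
  rw [hp.isSelfAdjoint.star_eq, hp.isIdempotentElem.eq] at h
  nlinarith [norm_nonneg p]

variable {ι : Type*} {l : Filter ι} [l.NeBot] {α : ι → A ≃⋆ₐ[ℂ] A}
  (W : ∀ i, X.str.Twist (α i))

/-- For a mixing family of twisted automorphisms fixing the corner `p A p`, fixed elements of
`p T_X p` are approximated by elements of `p A p`. -/
lemma exists_norm_sub_left_le
    (hW : ∀ x y, Filter.Tendsto (fun i => X.str.ip ((W i).equiv x) y) l (nhds 0))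
    {p : A} (hp : IsStarProjection p) (hα : ∀ i a, α i (p * a * p) = p * a * p)
    {T : X.fock.Adj} (hT : T ∈ X.toeplitz) (hpT : X.fock.left p * T * X.fock.left p = T)
    (hfix : ∀ i, conj (fockTwist (W i)) T = T) {ε : ℝ} (hε : 0 < ε) :
    ∃ a, ‖T - X.fock.left (p * a * p)‖ ≤ ε := by
  obtain ⟨S, hS, hTS⟩ := Metric.mem_closure_iff.1 hT ε hε
  rw [dist_eq_norm] at hTS
  obtain ⟨a, ha⟩ := (IsNormallyOrdered.of_mem_adjoin hS).exists_tendsto W hW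
  refine ⟨a, Adj.norm_le_of_ip hε.le fun x y => ?_⟩
  have hαp : ∀ i, α i p = p := fun i => by
    simpa only [hp.isIdempotentElem.eq] using hα i p
  have hlp : ‖X.fock.left p‖ ≤ 1 := (norm_left_le p).trans hp.norm_le_one
  have hl : ∀ z, ‖(X.fock.left p).op z‖ ≤ ‖z‖ := fun z =>
    ((X.fock.left p).op.le_opNorm z).trans (mul_le_of_le_one_left (norm_nonneg z) hlp)
  have hlps : star (X.fock.left p) = X.fock.left p := by
    rw [star_left, hp.isSelfAdjoint.star_eq]
  -- The operator `T - p a p = p (T - a) p` is fixed, so it may be conjugated by any `W_i` at no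
  -- cost. Since `α_i p = p`, the projections move onto `x` and `y`, and inserting `S` splits the
  -- middle factor into a small and a weakly null part.
  have key : ∀ i, X.fock.str.ip x ((T - X.fock.left (p * a * p)).op y) =
      X.fock.str.ip ((X.fock.left p).op x) ((conj (fockTwist (W i)) (T - S)).op
        ((X.fock.left p).op y)) +
      X.fock.str.ip ((X.fock.left p).op x) ((conj (fockTwist (W i)) (S - X.fock.left a)).op
        ((X.fock.left p).op y)) := fun i => by
    have h1 : T - X.fock.left (p * a * p)
        = X.fock.left p * (T - X.fock.left a) * X.fock.left p := by
      rw [mul_sub, sub_mul, hpT]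
      simp only [← leftHom_apply, map_mul]
    have h2 : conj (fockTwist (W i)) (T - X.fock.left (p * a * p))
        = T - X.fock.left (p * a * p) := by
      rw [map_sub, hfix, conj_left, hα]
    rw [← h2, h1, map_mul, map_mul, conj_left, hαp, Adj.op_mul, Adj.op_mul,
      ← sub_add_sub_cancel T S (X.fock.left a), map_add, Adj.op_add, ← map_add,
      ← Adj.star_left, hlps]
  have hlim : Filter.Tendsto (fun i => ε * ‖x‖ * ‖y‖ +
      ‖X.fock.str.ip ((X.fock.left p).op x) ((conj (fockTwist (W i)) (S - X.fock.left a)).op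
        ((X.fock.left p).op y))‖) l (nhds (ε * ‖x‖ * ‖y‖)) := by
    simpa using (ha ((X.fock.left p).op x) ((X.fock.left p).op y)).norm.const_add
      (ε * ‖x‖ * ‖y‖)
  -- The left-hand side does not depend on `i`, so only the limit `ε ‖x‖ ‖y‖` of the bounds remains.
  refine ge_of_tendsto' hlim fun i => ?_
  rw [key i]
  refine (norm_add_le _ _).trans (add_le_add_left ?_ _)
  refine (norm_ip_op_le _ _ _).trans ?_
  rw [norm_conj]
  gcongr
  exacts [hl x, hl y]

/-- For a mixing family of twisted automorphisms fixing the corner `p A p`, fixed elements of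
`p T_X p` are equal to their vacuum compressions. -/
lemma eq_left_of_fixed
    (hW : ∀ x y, Filter.Tendsto (fun i => X.str.ip ((W i).equiv x) y) l (nhds 0))
    {p : A} (hp : IsStarProjection p) (hα : ∀ i a, α i (p * a * p) = p * a * p)
    {T : X.fock.Adj} (hT : T ∈ X.toeplitz) (hpT : X.fock.left p * T * X.fock.left p = T)
    (hfix : ∀ i, conj (fockTwist (W i)) T = T) :
    T = X.fock.left (X.fock.str.ip (X.vac p) (T.op (X.vac p))) := by
  rw [← sub_eq_zero, ← norm_le_zero_iff]
  refine le_of_forall_pos_le_add fun ε hε => ?_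
  -- Half of `ε` is used for `T - p a p` and half for `e - p a p`, which is the vacuum compression
  -- of the same operator. The approximating `a` thus drops out without any appeal to closedness of
  -- the corner.
  obtain ⟨a, ha⟩ := exists_norm_sub_left_le W hW hp hα hT hpT hfix (half_pos hε)
  set e := X.fock.str.ip (X.vac p) (T.op (X.vac p))
  have h1 : X.fock.str.ip (X.vac p) ((T - X.fock.left (p * a * p)).op (X.vac p))
      = e - p * a * p := by
    rw [Adj.op_sub, map_sub, ip_vac_left, hp.isSelfAdjoint.star_eq]
    congr 1
    simp only [mul_assoc, hp.isIdempotentElem.eq]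
    simp only [← mul_assoc, hp.isIdempotentElem.eq]
  have h2 : ‖e - p * a * p‖ ≤ ε / 2 := by
    rw [← h1]
    refine (norm_ip_op_le _ _ _).trans ?_
    rw [norm_vac]
    have := hp.norm_le_one
    calc _ ≤ ε / 2 * 1 * 1 := by gcongr
      _ = _ := by ring
  calc ‖T - X.fock.left e‖ = ‖T - X.fock.left (p * a * p) - X.fock.left (e - p * a * p)‖ := by
        simp only [← leftHom_apply, map_sub, sub_sub_sub_cancel_right]
    _ ≤ ε / 2 + ε / 2 := (norm_sub_le _ _).trans (add_le_add ha ((norm_left_le _).trans h2))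
    _ = 0 + ε := by ring

end Dynamics

end Corr

/-! ### Translations on `ℓ²(G)` are mixing. -/

section Translation

variable {S : Type*}

/-- The action of a permutation on `ℓ²`. -/
noncomputable def ellTwoPerm (σ : Equiv.Perm S) : ellTwo S ≃ₗᵢ[ℂ] ellTwo S where
  toFun f := ⟨fun s => f (σ.symm s), by
    refine (memℓp_gen_iff (by norm_num)).2 ?_
    exact σ.symm.summable_iff.2 ((memℓp_gen_iff (by norm_num)).1 (lp.memℓp f))⟩
  invFun f := ⟨fun s => f (σ s), by
    refine (memℓp_gen_iff (by norm_num)).2 ?_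
    exact σ.summable_iff.2 ((memℓp_gen_iff (by norm_num)).1 (lp.memℓp f))⟩
  map_add' f f' := rfl
  map_smul' c f := rfl
  left_inv f := lp.ext (funext fun s => congrArg f (σ.symm_apply_apply s))
  right_inv f := lp.ext (funext fun s => congrArg f (σ.apply_symm_apply s))
  norm_map' f := by
    rw [lp.norm_eq_tsum_rpow (by norm_num), lp.norm_eq_tsum_rpow (by norm_num)]
    congr 1
    exact σ.symm.tsum_eq fun s => ‖f s‖ ^ (2 : ENNReal).toReal

lemma ellTwoPerm_single [DecidableEq S] (σ : Equiv.Perm S) (s : S) (c : ℂ) :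
    ellTwoPerm σ (lp.single 2 s c) = lp.single 2 (σ s) c := by
  refine lp.ext (funext fun t => ?_)
  change (lp.single 2 s c : ellTwo S) (σ.symm t) = _
  obtain ⟨t, rfl⟩ := σ.surjective t
  rw [σ.symm_apply_apply]
  by_cases h : t = s
  · subst h
    rw [lp.single_apply_self, lp.single_apply_self]
  · rw [lp.single_apply_ne _ _ _ h, lp.single_apply_ne _ _ _ (by simpa)]

/-- The left translations of an infinite group are mixing on `ℓ²(G)`. -/
lemma tendsto_inner_translation {G : Type*} [Group G] (f f' : ellTwo G) :
    Filter.Tendsto (fun g : G => ⟪ellTwoPerm (Equiv.mulLeft g) f, f'⟫_ℂ) Filter.cofinite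
      (nhds 0) := by
  classical
  have hclosed : IsClosed {f : ellTwo G | Filter.Tendsto
      (fun g : G => ⟪ellTwoPerm (Equiv.mulLeft g) f, f'⟫_ℂ) Filter.cofinite (nhds 0)} := by
    refine isClosed_setOf_tendsto_zero (fun (g : G) (f : ellTwo G) =>
      ⟪ellTwoPerm (Equiv.mulLeft g) f, f'⟫_ℂ) (C := ‖f'‖) fun g f₁ f₂ => ?_
    rw [← inner_sub_left, ← map_sub, mul_comm]
    refine (norm_inner_le_norm _ _).trans_eq ?_
    rw [LinearIsometryEquiv.norm_map]
  -- It suffices to treat finite combinations of the `δ_h`, which are dense.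
  refine hclosed.mem_of_tendsto (lp.hasSum_single ENNReal.ofNat_ne_top f)
    (Filter.Eventually.of_forall fun s => ?_)
  simp only [Set.mem_ofPred_eq, map_sum, sum_inner]
  rw [← Finset.sum_const_zero (s := s)]
  refine tendsto_finsetSum _ fun h _ => ?_
  simp only [ellTwoPerm_single]
  -- For `f = δ_h` the inner product is `f'(gh)`. Square summable coefficients vanish at infinity,
  -- and the injection `g ↦ gh` preserves the cofinite filter.
  have h1 : Filter.Tendsto (fun g => f' g) Filter.cofinite (nhds 0) := by
    have h2 := ((memℓp_gen_iff (p := 2) (by norm_num)).1 (lp.memℓp f')).tendsto_cofinite_zero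
    rw [tendsto_zero_iff_norm_tendsto_zero]
    have h3 := h2.sqrt
    simpa [Real.sqrt_sq] using h3
  have h2 := h1.comp (mul_left_injective h).tendsto_cofinite
  have h3 := (h2.const_mul (starRingEnd ℂ (f h)))
  rw [mul_zero] at h3
  refine h3.congr fun g => ?_
  rw [lp.inner_single_left, RCLike.inner_apply, mul_comm]
  rfl

end Translation

/-! ### The quasi-free action on the Toeplitz algebra of `H ⊗ ℓ²(G) ⊗ E`. -/

section Pimsner

variable {E : Type u} [NonUnitalCStarAlgebra E] [PartialOrder E] [StarOrderedRing E]
  {H : Type v} [NormedAddCommGroup H] [InnerProductSpace ℂ H] [CompleteSpace H]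

/-- A unitary normalizing the image of a faithful representation implements an automorphism. -/
lemma exists_conj_aut {π : E →⋆ₙₐ[ℂ] (H →L[ℂ] H)} (hπ : Function.Injective π)
    (u : unitary (H →L[ℂ] H))
    (hu : (fun T : H →L[ℂ] H => (u : H →L[ℂ] H) * T * star (u : H →L[ℂ] H)) ''
      Set.range π = Set.range π) :
    ∃ α : E ≃⋆ₐ[ℂ] E, ∀ x, π (α x) = (u : H →L[ℂ] H) * π x * star (u : H →L[ℂ] H) := by
  have h1 : ∀ x, ∃ y, π y = (u : H →L[ℂ] H) * π x * star (u : H →L[ℂ] H) := fun x => by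
    have : (u : H →L[ℂ] H) * π x * star (u : H →L[ℂ] H) ∈ Set.range π := by
      rw [← hu]
      exact ⟨_, ⟨x, rfl⟩, rfl⟩
    exact this
  choose f hf using h1
  have huu : star (u : H →L[ℂ] H) * (u : H →L[ℂ] H) = 1 := Unitary.coe_star_mul_self u
  let φ : E →⋆ₙₐ[ℂ] E :=
    { toFun := f
      map_smul' := fun c x => hπ (by
        simp only [hf, map_smul, MonoidHom.id_apply, mul_smul_comm, smul_mul_assoc])
      map_zero' := hπ (by simp [hf])
      map_add' := fun x y => hπ (by simp only [hf, map_add, mul_add, add_mul])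
      map_mul' := fun x y => hπ (by
        simp only [hf, map_mul]
        simp only [mul_assoc]
        rw [← mul_assoc (star (u : H →L[ℂ] H)) (u : H →L[ℂ] H), huu, one_mul])
      map_star' := fun x => hπ (by
        simp only [hf, map_star, star_mul, star_star, mul_assoc]) }
  have hφ : Function.Bijective φ := by
    refine ⟨fun x y hxy => hπ ?_, fun y => ?_⟩
    · have h := congrArg (fun z => star (u : H →L[ℂ] H) * π z * (u : H →L[ℂ] H)) hxy
      change star (u : H →L[ℂ] H) * π (f x) * (u : H →L[ℂ] H)
        = star (u : H →L[ℂ] H) * π (f y) * (u : H →L[ℂ] H) at h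
      simp only [hf, mul_assoc, huu, mul_one] at h
      simpa only [← mul_assoc, huu, one_mul] using h
    -- Surjectivity uses that the conjugated image equals the whole image, not merely that it is
    -- contained in it.
    · have : π y ∈ Set.range π := ⟨y, rfl⟩
      rw [← hu] at this
      obtain ⟨_, ⟨x, rfl⟩, hx⟩ := this
      exact ⟨x, hπ ((hf x).trans hx)⟩
  exact ⟨StarAlgEquiv.ofBijective φ hφ, hf⟩

/-- A pair of an isometry and an automorphism that is compatible with the representation gives a
twisted automorphism of the exterior tensor product. -/
noncomputable def PreCorr.exteriorTwist {K : Type*} [NormedAddCommGroup K] [InnerProductSpace ℂ K]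
    {ρ : E →ₗ[ℂ] K →ₗ[ℂ] K} (hmul : ∀ a b k, ρ (a * b) k = ρ a (ρ b k))
    (hstar : ∀ a k l, ⟪ρ a k, l⟫_ℂ = ⟪k, ρ (star a) l⟫_ℂ) (S : K ≃ₗᵢ[ℂ] K) (α : E ≃⋆ₐ[ℂ] E)
    (hS : ∀ a k, S (ρ a k) = ρ (α a) (S k)) : (PreCorr.exterior ρ hmul hstar).Twist α where
  equiv := TensorProduct.congr S.toLinearEquiv (PreCorr.Twist.self E α).equiv
  ip_map v w := by
    change PreCorr.exteriorIp E K _ _ = α (PreCorr.exteriorIp E K _ _)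
    induction v with
    | zero => simp
    | add v v' h h' => simp only [map_add, LinearMap.add_apply, h, h']
    | tmul k x =>
      induction w with
      | zero => simp
      | add w w' h h' => simp only [map_add, h, h']
      | tmul l y =>
        rw [TensorProduct.congr_tmul, TensorProduct.congr_tmul, PreCorr.exteriorIp_tmul,
          PreCorr.exteriorIp_tmul, map_smul, map_mul, map_star]
        exact congrArg (· • (star (α x) * α y)) (S.inner_map_map k l)
  lmul_map a v := by
    change TensorProduct.congr S.toLinearEquiv (PreCorr.Twist.self E α).equiv
      (LinearMap.rTensorHom E (ρ a) v) = LinearMap.rTensorHom E (ρ (α a)) _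
    induction v with
    | zero => simp
    | add v v' h h' => simp only [map_add, h, h']
    | tmul k x => simp [hS]

variable {G : Type w} [Group G] {π : E →⋆ₙₐ[ℂ] (H →L[ℂ] H)}

/-- The twisted automorphism `ζ ⊗ δ_h ⊗ x ↦ u ζ ⊗ δ_{gh} ⊗ α(x)`, before completion. -/
noncomputable def prePimsnerTwist (g : G) {u : unitary (H →L[ℂ] H)} {α : E ≃⋆ₐ[ℂ] E}
    (hα : ∀ x, π (α x) = (u : H →L[ℂ] H) * π x * star (u : H →L[ℂ] H)) :
    (PreCorr.exterior (ampliation G π) (ampliation_mul G π) (ampliation_star G π)).Twist α :=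
  PreCorr.exteriorTwist (ampliation_mul G π) (ampliation_star G π)
    (TensorProduct.congrIsometry (Unitary.linearIsometryEquiv u) (ellTwoPerm (Equiv.mulLeft g))) α
    fun a k => by
      induction k with
      | zero => simp
      | add k k' h h' => simp only [map_add, h, h']
      | tmul ζ f =>
        simp only [ampliation_tmul, TensorProduct.congrIsometry_apply, TensorProduct.congr_tmul, hα]
        congr 1
        -- Covariance `u π(a) = π(α a) u` amounts to `u⋆ u = 1`.
        change (u : H →L[ℂ] H) (π a ζ) = (u : H →L[ℂ] H) (π a ((star (u : H →L[ℂ] H) *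
          (u : H →L[ℂ] H)) ζ))
        rw [Unitary.coe_star_mul_self]
        rfl

lemma prePimsnerTwist_tmul (g : G) {u : unitary (H →L[ℂ] H)} {α : E ≃⋆ₐ[ℂ] E}
    (hα : ∀ x, π (α x) = (u : H →L[ℂ] H) * π x * star (u : H →L[ℂ] H)) (ζ : H) (f : ellTwo G)
    (x : E) : (prePimsnerTwist g hα).equiv ((ζ ⊗ₜ f) ⊗ₜ x)
      = ((u : H →L[ℂ] H) ζ ⊗ₜ ellTwoPerm (Equiv.mulLeft g) f) ⊗ₜ α x := rfl

/-- The twisted automorphism `ζ ⊗ δ_h ⊗ x ↦ u ζ ⊗ δ_{gh} ⊗ α(x)`. -/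
noncomputable def pimsnerTwist (g : G) {u : unitary (H →L[ℂ] H)} {α : E ≃⋆ₐ[ℂ] E}
    (hα : ∀ x, π (α x) = (u : H →L[ℂ] H) * π x * star (u : H →L[ℂ] H)) :
    (pimsnerModule G π).str.Twist α := (prePimsnerTwist g hα).compl

lemma pimsnerTwist_toCompl (g : G) {u : unitary (H →L[ℂ] H)} {α : E ≃⋆ₐ[ℂ] E}
    (hα : ∀ x, π (α x) = (u : H →L[ℂ] H) * π x * star (u : H →L[ℂ] H))
    (v : (H ⊗[ℂ] ellTwo G) ⊗[ℂ] E) :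
    (pimsnerTwist g hα).equiv
      ((PreCorr.exterior (ampliation G π) (ampliation_mul G π) (ampliation_star G π)).toCompl v)
    = (PreCorr.exterior (ampliation G π) (ampliation_mul G π) (ampliation_star G π)).toCompl
      ((prePimsnerTwist g hα).equiv v) := (prePimsnerTwist g hα).compl_toCompl v

lemma pimsnerTwist_pimsnerTmul (g : G) {u : unitary (H →L[ℂ] H)} {α : E ≃⋆ₐ[ℂ] E}
    (hα : ∀ x, π (α x) = (u : H →L[ℂ] H) * π x * star (u : H →L[ℂ] H)) (ζ : H) (h : G) (x : E) :
    (pimsnerTwist g hα).equiv (pimsnerTmul π ζ h x)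
      = pimsnerTmul π ((u : H →L[ℂ] H) ζ) (g * h) (α x) := by
  classical
  refine (pimsnerTwist_toCompl g hα _).trans ?_
  rw [prePimsnerTwist_tmul, ellTwoPerm_single]
  rfl

/-- The twisted automorphisms `ζ ⊗ δ_h ⊗ x ↦ U_g ζ ⊗ δ_{gh} ⊗ α_g(x)` are mixing. -/
lemma tendsto_ip_pimsnerTwist {u : G → unitary (H →L[ℂ] H)} {α : G → E ≃⋆ₐ[ℂ] E}
    (hα : ∀ g x, π (α g x) = (u g : H →L[ℂ] H) * π x * star (u g : H →L[ℂ] H))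
    (x y : (pimsnerModule G π).carrier) :
    Filter.Tendsto (fun g => (pimsnerModule G π).str.ip ((pimsnerTwist g (hα g)).equiv x) y)
      Filter.cofinite (nhds 0) := by
  set P := PreCorr.exterior (ampliation G π) (ampliation_mul G π) (ampliation_star G π) with hP
  have h1 : ∀ v w, Filter.Tendsto (fun g => P.ip ((prePimsnerTwist g (hα g)).equiv v) w)
      Filter.cofinite (nhds 0) := fun v w => by
    induction v with
    | zero =>
      refine tendsto_const_nhds.congr fun g => ?_
      rw [map_zero, ← P.star_ip, map_zero, star_zero]
    | add v v' h h' =>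
      have := h.add h'
      rw [add_zero] at this
      exact this.congr fun g => by rw [map_add, P.ip_add_left]
    | tmul k a =>
      induction w with
      | zero => simp only [map_zero]; exact tendsto_const_nhds
      | add w w' h h' =>
        have := h.add h'
        rw [add_zero] at this
        exact this.congr fun g => by rw [map_add]
      | tmul l b =>
        induction k with
        | zero =>
          refine tendsto_const_nhds.congr fun g => ?_
          rw [TensorProduct.zero_tmul, map_zero, ← P.star_ip, map_zero, star_zero]
        | add k k' h h' =>
          have := h.add h'
          rw [add_zero] at this
          exact this.congr fun g => by rw [TensorProduct.add_tmul, map_add, P.ip_add_left]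
        | tmul ζ f =>
          induction l with
          | zero => simp only [TensorProduct.zero_tmul, map_zero]; exact tendsto_const_nhds
          | add l l' h h' =>
            have := h.add h'
            rw [add_zero] at this
            exact this.congr fun g => by rw [TensorProduct.add_tmul, map_add]
          | tmul ξ f' =>
            -- The inner product is `⟪U_g ζ, ξ⟫ ⟪λ_g f, f'⟫ α_g(a)⋆ b`. The outer factors are
            -- bounded uniformly in `g` because `U_g` and `α_g` are isometric, so the mixing of `λ`
            -- decides.
            refine squeeze_zero_norm (a := fun g : G =>
              ‖⟪ellTwoPerm (Equiv.mulLeft g) f, f'⟫_ℂ‖ * (‖ζ‖ * ‖ξ‖ * (‖a‖ * ‖b‖)))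
              (fun g => ?_) ?_
            · have h2 : P.ip ((prePimsnerTwist g (hα g)).equiv ((ζ ⊗ₜ f) ⊗ₜ a)) ((ξ ⊗ₜ f') ⊗ₜ b)
                  = ⟪((u g : H →L[ℂ] H) ζ ⊗ₜ[ℂ] ellTwoPerm (Equiv.mulLeft g) f), ξ ⊗ₜ[ℂ] f'⟫_ℂ •
                    (star (α g a) * b) := rfl
              have h3 : ‖(u g : H →L[ℂ] H) ζ‖ = ‖ζ‖ := (Unitary.linearIsometryEquiv (u g)).norm_map ζ
              have h4 : ‖star (α g a)‖ = ‖a‖ := by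
                rw [norm_star, NonUnitalStarAlgHom.norm_map (α g) (α g).injective]
              rw [h2, TensorProduct.inner_tmul, norm_smul, norm_mul]
              calc _ ≤ (‖ζ‖ * ‖ξ‖) * ‖⟪ellTwoPerm (Equiv.mulLeft g) f, f'⟫_ℂ‖ * (‖a‖ * ‖b‖) := by
                    gcongr
                    · exact (norm_inner_le_norm _ _).trans_eq (by rw [h3])
                    · exact (norm_mul_le _ _).trans_eq (by rw [h4])
                _ = _ := by ring
            · simpa using (tendsto_inner_translation f f').norm.mul_const
                (‖ζ‖ * ‖ξ‖ * (‖a‖ * ‖b‖))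
  -- This bound, uniform in `g`, carries the limit over to the completion in one variable after the
  -- other.
  have hsub : ∀ g x y, ‖(pimsnerModule G π).str.ip ((pimsnerTwist g (hα g)).equiv x) y‖
      ≤ ‖x‖ * ‖y‖ := fun g x y =>
    ((pimsnerModule G π).norm_ip_le _ _).trans_eq (by rw [Corr.norm_twist])
  refine P.dense_induction x ?_ fun v => P.dense_induction y ?_ fun w => ?_
  · refine isClosed_setOf_tendsto_zero (fun g (x : (pimsnerModule G π).carrier) =>
      (pimsnerModule G π).str.ip ((pimsnerTwist g (hα g)).equiv x) y) (C := ‖y‖) fun g x x' => ?_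
    rw [← (pimsnerModule G π).str.ip_sub_left, ← map_sub, mul_comm]
    exact hsub g _ y
  · refine isClosed_setOf_tendsto_zero (fun g (y : (pimsnerModule G π).carrier) =>
      (pimsnerModule G π).str.ip ((pimsnerTwist g (hα g)).equiv (P.toCompl v)) y)
      (C := ‖P.toCompl v‖) fun g y y' => ?_
    rw [← map_sub]
    exact hsub g _ _
  · refine (h1 v w).congr fun g => ?_
    rw [pimsnerTwist_toCompl]
    exact (P.ipC_toCompl _ _).symm

/-- The vectors `ζ ⊗ δ_h ⊗ x` span a dense subspace. -/
lemma span_pimsnerTmul (G : Type w) (π : E →⋆ₙₐ[ℂ] (H →L[ℂ] H)) :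
    (Submodule.span ℂ {z | ∃ ζ, ∃ h : G, ∃ x, pimsnerTmul π ζ h x = z}).topologicalClosure = ⊤ := by
  classical
  set P := PreCorr.exterior (ampliation G π) (ampliation_mul G π) (ampliation_star G π) with hP
  set K := (Submodule.span ℂ {z | ∃ ζ, ∃ h : G, ∃ x, pimsnerTmul π ζ h x = z}).topologicalClosure
  have hK : IsClosed (K : Set (pimsnerModule G π).carrier) :=
    Submodule.isClosed_topologicalClosure _
  have h1 : ∀ v, P.toCompl v ∈ K := fun v => by
    induction v with
    | zero => rw [map_zero]; exact zero_mem K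
    | add v v' h h' => rw [map_add]; exact add_mem h h'
    | tmul k x =>
      induction k with
      | zero => rw [TensorProduct.zero_tmul, map_zero]; exact zero_mem K
      | add v v' h h' => rw [TensorProduct.add_tmul, map_add]; exact add_mem h h'
      | tmul ζ f =>
        -- The map `f ↦ ζ ⊗ f ⊗ x` is bounded, so the expansion of `f` in the basis `δ_h` converges
        -- in `X` as well.
        let L : ellTwo G →ₗ[ℂ] P.Compl :=
          P.toCompl ∘ₗ (TensorProduct.mk ℂ _ E).flip x ∘ₗ TensorProduct.mk ℂ H (ellTwo G) ζ
        have hL : ∀ f, ‖L f‖ ≤ ‖ζ‖ * ‖x‖ * ‖f‖ := fun f => by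
          refine (P.norm_toCompl _).trans_le (Real.sqrt_le_iff.2 ⟨by positivity, ?_⟩)
          change ‖⟪ζ ⊗ₜ[ℂ] f, ζ ⊗ₜ[ℂ] f⟫_ℂ • (star x * x)‖ ≤ _
          rw [norm_smul, CStarRing.norm_star_mul_self, TensorProduct.inner_tmul, norm_mul]
          calc _ ≤ (‖ζ‖ * ‖ζ‖) * (‖f‖ * ‖f‖) * (‖x‖ * ‖x‖) := by
                gcongr <;> exact norm_inner_le_norm _ _
            _ = _ := by ring
        have hLc : Continuous L := AddMonoidHomClass.continuous_of_bound L _ hL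
        have hsum := (hLc.tendsto f).comp (lp.hasSum_single ENNReal.ofNat_ne_top f)
        refine hK.mem_of_tendsto hsum (Filter.Eventually.of_forall fun s => ?_)
        rw [Function.comp_apply, map_sum]
        refine sum_mem fun h _ => ?_
        have h2 : (lp.single 2 h (f h) : ellTwo G) = f h • lp.single 2 h (1 : ℂ) := by
          rw [← lp.single_smul, smul_eq_mul, mul_one]
        rw [h2, map_smul]
        refine K.smul_mem _ (Submodule.le_topologicalClosure _ (Submodule.subset_span
          ⟨ζ, h, x, ?_⟩))
        rw [pimsnerTmul]
        congr!
  rw [Submodule.eq_top_iff']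
  intro z
  exact P.dense_induction z hK h1

/-- The quasi-free action is unique. -/
lemma IsQuasiFree.unique {U : G →* unitary (H →L[ℂ] H)} {α : G → E ≃⋆ₐ[ℂ] E}
    (hα : ∀ g x, π (α g x) = (U g : H →L[ℂ] H) * π x * star (U g : H →L[ℂ] H))
    {Γ : G →* ((pimsnerModule G π).toeplitz ≃⋆ₐ[ℂ] (pimsnerModule G π).toeplitz)}
    (hΓ : IsQuasiFree π U Γ) (g : G) : Γ g = Corr.quasiFree (pimsnerTwist g (hα g)) := by
  refine Corr.toeplitz_equiv_ext (span_pimsnerTmul G π) ?_ fun a => ?_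
  · rintro _ ⟨ζ, h, x, rfl⟩
    rw [hΓ.map_creation g x _ (hα g x), Corr.quasiFree_toeplitzT, pimsnerTwist_pimsnerTmul]
  · rw [hΓ.map_of g a _ (hα g a), Corr.quasiFree_toeplitzOf]

/-- The quasi-free action exists. -/
lemma exists_isQuasiFree {U : G →* unitary (H →L[ℂ] H)} (hπ : Function.Injective π)
    {α : G → E ≃⋆ₐ[ℂ] E}
    (hα : ∀ g x, π (α g x) = (U g : H →L[ℂ] H) * π x * star (U g : H →L[ℂ] H)) :
    ∃ Γ : G →* ((pimsnerModule G π).toeplitz ≃⋆ₐ[ℂ] (pimsnerModule G π).toeplitz),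
      IsQuasiFree π U Γ := by
  -- The automorphisms `α_g` are given separately for each `g`; they form an action because `U` is a
  -- homomorphism and `π` is faithful.
  have h1 : ∀ x, α 1 x = x := fun x => hπ (by rw [hα]; simp)
  have hm : ∀ g g' x, α (g * g') x = α g (α g' x) := fun g g' x => hπ (by
    rw [hα, hα, hα, map_mul, Submonoid.coe_mul, star_mul]
    simp only [mul_assoc])
  refine ⟨{ toFun := fun g => Corr.quasiFree (pimsnerTwist g (hα g)), map_one' := ?_,
            map_mul' := fun g g' => ?_ }, ⟨fun g x y hxy ζ h => ?_, fun g x y hxy => ?_⟩⟩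
  · refine Corr.toeplitz_equiv_ext (span_pimsnerTmul G π) ?_ fun a => ?_
    · rintro _ ⟨ζ, h, x, rfl⟩
      rw [Corr.quasiFree_toeplitzT, pimsnerTwist_pimsnerTmul, h1, map_one, one_mul]
      rfl
    · rw [Corr.quasiFree_toeplitzOf, h1]
      rfl
  · refine Corr.toeplitz_equiv_ext (span_pimsnerTmul G π) ?_ fun a => ?_
    · rintro _ ⟨ζ, h, x, rfl⟩
      rw [StarAlgEquiv.mul_apply]
      simp only [Corr.quasiFree_toeplitzT, pimsnerTwist_pimsnerTmul]
      rw [hm, map_mul, mul_assoc]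
      rfl
    · rw [StarAlgEquiv.mul_apply]
      simp only [Corr.quasiFree_toeplitzOf]
      rw [hm]
  · change Corr.quasiFree (pimsnerTwist g (hα g)) _ = _
    rw [Corr.quasiFree_toeplitzT, pimsnerTwist_pimsnerTmul]
    congr 2
    exact hπ ((hα g x).trans hxy.symm)
  · change Corr.quasiFree (pimsnerTwist g (hα g)) _ = _
    rw [Corr.quasiFree_toeplitzOf]
    congr 1
    exact hπ ((hα g x).trans hxy.symm)

end Pimsner

/-! ### Square roots in corners and the vacuum compression. -/

/-- A positive element of the corner `p E p` has a square root in `p E p`. -/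
lemma IsStarProjection.exists_star_mul_self_eq {E : Type*} [NonUnitalCStarAlgebra E]
    [PartialOrder E] [StarOrderedRing E] {p e : E} (hp : IsStarProjection p) (he : 0 ≤ e)
    (hpe : p * e * p = e) : ∃ c, p * c * p = c ∧ star c * c = e := by
  have hc : star (CFC.sqrt e) = CFC.sqrt e := (IsSelfAdjoint.of_nonneg (CFC.sqrt_nonneg e)).star_eq
  have hcc : CFC.sqrt e * CFC.sqrt e = e := CFC.sqrt_mul_sqrt_self e he
  have hpp := hp.isIdempotentElem.eq
  have hps := hp.isSelfAdjoint.star_eq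
  set c := CFC.sqrt e
  have hpe' : p * e = e := by
    rw [← hpe]
    simp only [← mul_assoc, hpp]
  have hep' : e * p = e := by
    rw [← hpe]
    simp only [mul_assoc, hpp]
  -- By the C⋆-identity it is enough that `(cp - c)⋆ (cp - c) = p c² p - p c² - c² p + c²` vanishes,
  -- and it does because `c² = e` lies in the corner.
  have h1 : c * p = c := by
    rw [← sub_eq_zero, ← CStarRing.star_mul_self_eq_zero_iff, star_sub, star_mul, hc, hps]
    have : (p * c - c) * (c * p - c) = p * (c * c) * p - p * (c * c) - (c * c) * p + c * c := by
      noncomm_ring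
    rw [this, hcc, hpe', hep', sub_self, zero_sub, neg_add_cancel]
  have h2 : p * c = c := by
    have := congrArg star h1
    rwa [star_mul, hc, hps] at this
  exact ⟨c, by rw [h2, h1], by rw [hc, hcc]⟩

namespace Corr

section VacuumCompression

variable {A : Type u} [NonUnitalCStarAlgebra A] [PartialOrder A] [StarOrderedRing A]
  {X : Corr.{u, v} A} {p : A}

variable (X p) in
/-- The map `T ↦ ⟪p Ω, T (p Ω)⟫`. -/
noncomputable def vacCompression : X.toeplitz →ₗ[ℂ] A where
  toFun T := X.fock.str.ip (X.vac p) ((T : X.fock.Adj).op (X.vac p))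
  map_add' _ _ := map_add (X.fock.str.ip (X.vac p)) _ _
  map_smul' c _ := map_smul (X.fock.str.ip (X.vac p)) c _

lemma vacCompression_apply (T : X.toeplitz) : X.vacCompression p T
    = X.fock.str.ip (X.vac p) ((T : X.fock.Adj).op (X.vac p)) := rfl

lemma coe_toeplitzOf (a : A) : (X.toeplitzOf a : X.fock.Adj) = X.fock.left a := rfl

/-- Here `p Ω` plays the part of the vacuum vector: `(p a) Ω = (p Ω) a`, and right multiplication
passes through adjointable operators and out of the inner product. -/
lemma ip_vac_op_vac (T : X.fock.Adj) (a b : A) :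
    X.fock.str.ip (X.vac (p * a)) (T.op (X.vac (p * b)))
      = star a * X.fock.str.ip (X.vac p) (T.op (X.vac p)) * b := by
  rw [vac_mul, vac_mul, X.fock.str.ip_rmul_left, Adj.op_rmul, X.fock.str.ip_rmul, mul_assoc]

variable (hp : IsStarProjection p)

include hp

/-- Because `(p p) Ω = p Ω`, the values lie in `p A p` even when `T` is outside the corner. -/
lemma mul_vacCompression_mul (T : X.toeplitz) :
    p * X.vacCompression p T * p = X.vacCompression p T := by
  rw [vacCompression_apply]
  nth_rw 1 [← hp.isSelfAdjoint.star_eq]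
  rw [← ip_vac_op_vac, hp.isIdempotentElem.eq]

lemma vacCompression_toeplitzOf {a : A} (ha : p * a * p = a) :
    X.vacCompression p (X.toeplitzOf a) = a := by
  rw [vacCompression_apply, coe_toeplitzOf, ip_vac_left, hp.isSelfAdjoint.star_eq, ha]

/-- For an element of the corner, left multiplication on `p Ω` agrees with right multiplication: `a
(p Ω) = (p a) Ω = (p Ω) a`. Applied to `a⋆` on the left of the inner product, this lets `a` come
out. -/
lemma vacCompression_toeplitzOf_mul {a : A} (ha : p * a * p = a) (T : X.toeplitz) :
    X.vacCompression p (X.toeplitzOf a * T) = a * X.vacCompression p T := by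
  have hpa : star a * p = p * star a := by
    rw [← ha]
    simp only [star_mul, hp.isSelfAdjoint.star_eq, ← mul_assoc, hp.isIdempotentElem.eq]
    simp only [mul_assoc, hp.isIdempotentElem.eq]
  change X.fock.str.ip (X.vac p) ((X.fock.left a * (T : X.fock.Adj)).op (X.vac p)) = _
  rw [Adj.op_mul, ← Adj.star_left, star_left, left_vac, hpa, vac_mul, X.fock.str.ip_rmul_left,
    star_star]
  rfl

lemma vacCompression_mul_toeplitzOf {a : A} (ha : p * a * p = a) (T : X.toeplitz) :
    X.vacCompression p (T * X.toeplitzOf a) = X.vacCompression p T * a := by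
  have hpa : a * p = p * a := by
    rw [← ha]
    simp only [← mul_assoc, hp.isIdempotentElem.eq]
    simp only [mul_assoc, hp.isIdempotentElem.eq]
  change X.fock.str.ip (X.vac p) (((T : X.fock.Adj) * X.fock.left a).op (X.vac p)) = _
  rw [Adj.op_mul, left_vac, hpa, vac_mul, Adj.op_rmul, X.fock.str.ip_rmul]
  rfl

lemma norm_vacCompression_le (T : X.toeplitz) : ‖X.vacCompression p T‖ ≤ ‖T‖ := by
  refine (norm_ip_op_le (T : X.fock.Adj) _ _).trans ?_
  rw [norm_vac]
  calc _ ≤ ‖(T : X.fock.Adj)‖ * 1 * 1 := by gcongr <;> exact hp.norm_le_one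
    _ = ‖T‖ := by rw [mul_one, mul_one]; rfl

omit hp in
lemma vacCompression_star_mul_self_nonneg (T : X.toeplitz) :
    0 ≤ X.vacCompression p (star T * T) := by
  change 0 ≤ X.fock.str.ip (X.vac p) ((star (T : X.fock.Adj) * (T : X.fock.Adj)).op (X.vac p))
  rw [Adj.op_mul, Adj.star_right]
  exact X.fock.str.ip_nonneg _

/-- For `T = p T p` the projections can be moved onto the test vectors, `⟪a Ω, T (b Ω)⟫ = ⟪p a Ω, T
(p b Ω)⟫`. So compression by `p Ω` recovers the compression by the formal `Ω`. -/
lemma isVacuumCompression_vacCompression {T : X.toeplitz}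
    (hT : X.toeplitzOf p * T * X.toeplitzOf p = T) :
    X.IsVacuumCompression T (X.vacCompression p T) := fun a b => by
  have h : X.fock.left p * (T : X.fock.Adj) * X.fock.left p = T := congrArg Subtype.val hT
  rw [← h, Adj.op_mul, Adj.op_mul, ← Adj.star_left, star_left, hp.isSelfAdjoint.star_eq, left_vac,
    left_vac, ip_vac_op_vac]
  rfl

end VacuumCompression

end Corr

/-! ### Fixed points of the corner and the conditional expectation. -/

namespace Corr

section FixedPoints

variable {A : Type u} [NonUnitalCStarAlgebra A] [PartialOrder A] [StarOrderedRing A]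
  {X : Corr.{u, v} A} {p : A}

lemma toeplitzOf_add (a b : A) : X.toeplitzOf (a + b) = X.toeplitzOf a + X.toeplitzOf b :=
  Subtype.ext (map_add X.fock.leftHom a b)

lemma toeplitzOf_mul (a b : A) : X.toeplitzOf (a * b) = X.toeplitzOf a * X.toeplitzOf b :=
  Subtype.ext (map_mul X.fock.leftHom a b)

lemma toeplitzOf_star (a : A) : X.toeplitzOf (star a) = star (X.toeplitzOf a) :=
  Subtype.ext (map_star X.fock.leftHom a)

lemma toeplitzOf_smul (c : ℂ) (a : A) : X.toeplitzOf (c • a) = c • X.toeplitzOf a :=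
  Subtype.ext (map_smul X.fock.leftHom c a)

lemma mul_mul_mul_of_mul_self {R : Type*} [NonUnitalRing R] {q : R} (hq : q * q = q) (a : R) :
    q * (q * a * q) * q = q * a * q := by
  rw [← mul_assoc, ← mul_assoc, hq, mul_assoc, hq]

lemma toeplitzOf_mul_mul_of_mem_corner (hp : IsStarProjection p)
    (hp' : IsSelfAdjoint (X.toeplitzOf p)) {T : X.toeplitz}
    (hT : T ∈ corner (X.toeplitzOf p) hp') : X.toeplitzOf p * T * X.toeplitzOf p = T := by
  obtain ⟨T, rfl⟩ := hT
  exact mul_mul_mul_of_mul_self (by rw [← toeplitzOf_mul, hp.isIdempotentElem.eq]) T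

variable {G : Type*} [Group G] {α : G → A ≃⋆ₐ[ℂ] A} (W : ∀ g, X.str.Twist (α g))
  {Γ : G →* (X.toeplitz ≃⋆ₐ[ℂ] X.toeplitz)} (hΓ : ∀ g, Γ g = quasiFree (W g))

include hΓ

/-- A quasi-free action whose automorphisms fix `p` restricts to the corner `p T_X p`. -/
lemma map_mem_corner (hα : ∀ g, α g p = p) (hp' : IsSelfAdjoint (X.toeplitzOf p)) (g : G)
    {T : X.toeplitz} (hT : T ∈ corner (X.toeplitzOf p) hp') :
    Γ g T ∈ corner (X.toeplitzOf p) hp' := by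
  obtain ⟨T, rfl⟩ := hT
  refine ⟨Γ g T, ?_⟩
  rw [map_mul, map_mul, hΓ, quasiFree_toeplitzOf, hα]

/-- The fixed points in the corner `p T_X p` of a mixing quasi-free action that fixes `p A p`. -/
lemma mem_fixedPoints_iff [Infinite G]
    (hW : ∀ x y, Filter.Tendsto (fun g => X.str.ip ((W g).equiv x) y) Filter.cofinite (nhds 0))
    (hp : IsStarProjection p) (hα : ∀ g a, α g (p * a * p) = p * a * p)
    (hp' : IsSelfAdjoint (X.toeplitzOf p)) (T : X.toeplitz) :
    T ∈ fixedPoints Γ (corner (X.toeplitzOf p) hp') ↔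
      ∃ a, p * a * p = a ∧ X.toeplitzOf a = T := by
  constructor
  · rintro ⟨hT, hfix⟩
    refine ⟨X.vacCompression p T, mul_vacCompression_mul hp T, Subtype.ext (Eq.symm ?_)⟩
    refine eq_left_of_fixed W hW hp hα T.2
      (congrArg Subtype.val (toeplitzOf_mul_mul_of_mem_corner hp hp' hT)) fun g => ?_
    rw [← coe_quasiFree, ← hΓ, hfix]
  · rintro ⟨a, ha, rfl⟩
    refine ⟨⟨X.toeplitzOf a, ?_⟩, fun g => ?_⟩
    · rw [← toeplitzOf_mul, ← toeplitzOf_mul, ha]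
    · rw [hΓ, quasiFree_toeplitzOf, ← ha, hα]

omit hΓ in
variable (X p) in
/-- The vacuum compression, as a map of the Toeplitz algebra into itself. -/
noncomputable def vacExpectation : X.toeplitz →ₗ[ℂ] X.toeplitz where
  toFun T := X.toeplitzOf (X.vacCompression p T)
  map_add' _ _ := by rw [map_add, toeplitzOf_add]
  map_smul' _ _ := by rw [map_smul, toeplitzOf_smul, RingHom.id_apply]

omit hΓ in
lemma vacExpectation_apply (T : X.toeplitz) :
    X.vacExpectation p T = X.toeplitzOf (X.vacCompression p T) := rfl

/-- Quasi-free automorphisms that fix `p` commute with the vacuum compression. -/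
lemma vacExpectation_map (hα : ∀ g, α g p = p) (g : G) (T : X.toeplitz) :
    X.vacExpectation p (Γ g T) = Γ g (X.vacExpectation p T) := by
  rw [vacExpectation_apply, vacExpectation_apply, hΓ, quasiFree_toeplitzOf]
  refine congrArg X.toeplitzOf ?_
  have := ip_vac_conj (W g) (T : X.fock.Adj) p p
  rwa [hα] at this

/-- The vacuum compression is a conditional expectation of the corner `p T_X p` onto the fixed
points of a mixing quasi-free action that fixes `p A p`. -/
lemma isConditionalExpectation_vacExpectation [Infinite G]
    (hW : ∀ x y, Filter.Tendsto (fun g => X.str.ip ((W g).equiv x) y) Filter.cofinite (nhds 0))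
    (hp : IsStarProjection p) (hα : ∀ g a, α g (p * a * p) = p * a * p)
    (hp' : IsSelfAdjoint (X.toeplitzOf p)) :
    IsConditionalExpectation (corner (X.toeplitzOf p) hp')
      (fixedPoints Γ (corner (X.toeplitzOf p) hp'))
      (X.vacExpectation p ∘ₗ (corner (X.toeplitzOf p) hp').toSubmodule.subtype) := by
  have hmem := mem_fixedPoints_iff W hΓ hW hp hα hp'
  refine ⟨fun T hT => hT.1, fun T => ?_, fun T hT => ?_, fun d T hd => ?_, fun T d hd => ?_,
    fun T => ?_, fun T => ?_⟩
  · exact (hmem _).2 ⟨_, mul_vacCompression_mul hp _, rfl⟩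
  · obtain ⟨a, ha, hT⟩ := (hmem _).1 hT
    change X.toeplitzOf (X.vacCompression p T) = T
    rw [← hT, vacCompression_toeplitzOf hp ha]
  · obtain ⟨a, ha, hd⟩ := (hmem _).1 hd
    change X.toeplitzOf (X.vacCompression p (d * T)) = d * X.toeplitzOf (X.vacCompression p T)
    rw [← hd, vacCompression_toeplitzOf_mul hp ha, toeplitzOf_mul]
  · obtain ⟨a, ha, hd⟩ := (hmem _).1 hd
    change X.toeplitzOf (X.vacCompression p (T * d)) = X.toeplitzOf (X.vacCompression p T) * d
    rw [← hd, vacCompression_mul_toeplitzOf hp ha, toeplitzOf_mul]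
  · exact (norm_left_le _).trans (norm_vacCompression_le hp _)
  -- Positivity is required inside the fixed point algebra, so the square root must be found in `p A
  -- p`.
  · obtain ⟨c, hpc, hc⟩ := hp.exists_star_mul_self_eq
      (vacCompression_star_mul_self_nonneg (T : X.toeplitz)) (mul_vacCompression_mul hp _)
    refine ⟨X.toeplitzOf c, (hmem _).2 ⟨c, hpc, rfl⟩, ?_⟩
    change X.toeplitzOf (X.vacCompression p (star (T : X.toeplitz) * T)) = _
    rw [← hc, toeplitzOf_mul, toeplitzOf_star]

end FixedPoints

end Corr

/-! ### The corner of `E` at `1 ⊗ e₀`. -/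

section Corner

variable {B : Type u} [CStarAlgebra B] {E : Type v} [NonUnitalCStarAlgebra E]
  {K : Type w} [NonUnitalRing K] [StarRing K] [Module ℂ K] [IsScalarTower ℂ K K]
  [SMulCommClass ℂ K K] [StarModule ℂ K] {j : B ⊗[ℂ] K →⋆ₙₐ[ℂ] E} {e₀ : K}

lemma map_tmul_mul_map_tmul (b b' : B) (k k' : K) :
    j (b ⊗ₜ k) * j (b' ⊗ₜ k') = j ((b * b') ⊗ₜ (k * k')) := by
  rw [← map_mul, Algebra.TensorProduct.tmul_mul_tmul]

lemma IsMinimalProjection.isStarProjection_map (he₀ : IsMinimalProjection e₀) :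
    IsStarProjection (j (1 ⊗ₜ e₀)) where
  isIdempotentElem := by
    rw [IsIdempotentElem, map_tmul_mul_map_tmul, one_mul,
      he₀.isStarProjection.isIdempotentElem.eq]
  isSelfAdjoint := by
    rw [IsSelfAdjoint, ← map_star, TensorProduct.star_tmul, star_one,
      he₀.isStarProjection.isSelfAdjoint.star_eq]

lemma corner_map_tmul (he₀ : IsMinimalProjection e₀) (b : B) :
    j (1 ⊗ₜ e₀) * j (b ⊗ₜ e₀) * j (1 ⊗ₜ e₀) = j (b ⊗ₜ e₀) := by
  rw [map_tmul_mul_map_tmul, map_tmul_mul_map_tmul, one_mul, mul_one,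
    he₀.isStarProjection.isIdempotentElem.eq, he₀.isStarProjection.isIdempotentElem.eq]

/-- The corner of `E` at `1 ⊗ e₀` is `B ⊗ e₀`. -/
lemma exists_corner_eq (hj : Function.Injective j) {J : Set E} (hJ : J = closure (Set.range j))
    (ideal : ∀ a : E, ∀ y ∈ J, a * y ∈ J ∧ y * a ∈ J) (he₀ : IsMinimalProjection e₀) (a : E) :
    ∃ b : B, j (1 ⊗ₜ e₀) * a * j (1 ⊗ₜ e₀) = j (b ⊗ₜ e₀) := by
  have hee := he₀.isStarProjection.isIdempotentElem.eq
  let φ : B →⋆ₙₐ[ℂ] E :=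
    { toFun := fun b => j (b ⊗ₜ e₀)
      map_smul' := fun c b => by
        rw [MonoidHom.id_apply, ← map_smul, TensorProduct.smul_tmul']
      map_zero' := by rw [TensorProduct.zero_tmul, map_zero]
      map_add' := fun b b' => by rw [TensorProduct.add_tmul, map_add]
      map_mul' := fun b b' => by
        rw [map_tmul_mul_map_tmul, hee]
      map_star' := fun b => by
        rw [← map_star, TensorProduct.star_tmul, he₀.isStarProjection.isSelfAdjoint.star_eq] }
  -- Slice by a linear functional that does not vanish on `e₀`.
  have hφ : Function.Injective φ := by
    refine (injective_iff_map_eq_zero φ).2 fun b hb => ?_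
    have hb' : b ⊗ₜ[ℂ] e₀ = 0 := hj (hb.trans (map_zero j).symm)
    obtain ⟨f, hf⟩ := Module.Projective.exists_dual_ne_zero ℂ he₀.ne_zero
    have := congrArg ((TensorProduct.rid ℂ B).toLinearMap ∘ₗ f.lTensor B) hb'
    simpa [hf] using this
  -- An injective ⋆-homomorphism from the complete algebra `B` is isometric, so its range is closed.
  -- Compressions of elements of `J` can then be computed on the algebraic tensor product.
  have hclosed : IsClosed (Set.range φ) :=
    (NonUnitalStarAlgHom.isometry φ hφ).isClosedEmbedding.isClosed_range
  set p := j (1 ⊗ₜ e₀)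
  have hpp : p * p = p := he₀.isStarProjection_map.isIdempotentElem.eq
  have hpJ : p ∈ J := hJ ▸ subset_closure ⟨_, rfl⟩
  have h1 : ∀ y ∈ J, p * y * p ∈ Set.range φ := fun y hy => by
    rw [hJ] at hy
    refine closure_minimal (s := Set.range j) (t := {y | p * y * p ∈ Set.range φ}) ?_ ?_ hy
    · rintro _ ⟨t, rfl⟩
      induction t with
      | zero => exact ⟨0, by simp⟩
      | add t t' h h' =>
        obtain ⟨b, hb⟩ := h
        obtain ⟨b', hb'⟩ := h'
        exact ⟨b + b', by rw [map_add, map_add, mul_add, add_mul, hb, hb']⟩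
      | tmul b k =>
        -- Minimality gives `p (b ⊗ k) p = b ⊗ e₀ k e₀ = (c b) ⊗ e₀`.
        obtain ⟨c, hc⟩ := he₀.minimal k
        refine ⟨c • b, ?_⟩
        change j ((c • b) ⊗ₜ e₀) = j (1 ⊗ₜ e₀) * j (b ⊗ₜ k) * j (1 ⊗ₜ e₀)
        rw [map_tmul_mul_map_tmul, map_tmul_mul_map_tmul, one_mul, mul_one, hc]
        exact congrArg j (TensorProduct.smul_tmul c b e₀)
    · exact hclosed.preimage (f := fun y => p * y * p) (by fun_prop)
  -- For any `a` in `E` the element `p a p` is in the ideal because `p` is, and a second compression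
  -- by `p` changes nothing.
  obtain ⟨b, hb⟩ := h1 (p * a * p) (ideal _ p hpJ).1
  refine ⟨b, ?_⟩
  rw [← show φ b = j (b ⊗ₜ e₀) from rfl, hb]
  simp only [mul_assoc, hpp]
  simp only [← mul_assoc, hpp]

end Corner

/-! ### The theorem. -/

set_option maxHeartbeats 1000000 in
theorem theorem4p5 {B : Type u} [CStarAlgebra B]
    {E : Type v} [NonUnitalCStarAlgebra E] [PartialOrder E] [StarOrderedRing E]
    {H : Type w} [NormedAddCommGroup H] [InnerProductSpace ℂ H] [CompleteSpace H]
    {G : Type*} [Group G] [Countable G] [Infinite G]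
    -- the essential ideal `J = B ⊗ K` of `E`
    (j : B ⊗[ℂ] KK →⋆ₙₐ[ℂ] E) (hj : Function.Injective j)
    (J : Set E) (hJ : J = closure (Set.range j))
    (ideal : ∀ a : E, ∀ y ∈ J, a * y ∈ J ∧ y * a ∈ J)
    (essential : ∀ a : E, (∀ y ∈ J, a * y = 0) → a = 0)
    -- the representation `E ⊆ B(H)` and the unitary representation of `G`
    (π : E →⋆ₙₐ[ℂ] (H →L[ℂ] H)) (hπ : Function.Injective π) (nondeg : IsNondegenerate π)
    (U : G →* unitary (H →L[ℂ] H))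
    (hUE : ∀ g, (fun T : H →L[ℂ] H => (U g : H →L[ℂ] H) * T * star (U g : H →L[ℂ] H)) ''
      Set.range π = Set.range π)
    (hUJ : ∀ g, (fun T : H →L[ℂ] H => (U g : H →L[ℂ] H) * T * star (U g : H →L[ℂ] H)) ''
      (π '' J) = π '' J)
    -- the minimal projection
    (e₀ : KK) (he₀ : IsMinimalProjection e₀)
    (hUe : ∀ g, (U g : H →L[ℂ] H) * π (j (1 ⊗ₜ e₀)) = π (j (1 ⊗ₜ e₀)) ∧
      π (j (1 ⊗ₜ e₀)) * (U g : H →L[ℂ] H) = π (j (1 ⊗ₜ e₀))) :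
    -- the quasi-free action exists and is unique
    (∃! Γ : G →* ((pimsnerModule G π).toeplitz ≃⋆ₐ[ℂ] (pimsnerModule G π).toeplitz),
      IsQuasiFree π U Γ) ∧
    ∀ Γ : G →* ((pimsnerModule G π).toeplitz ≃⋆ₐ[ℂ] (pimsnerModule G π).toeplitz),
      IsQuasiFree π U Γ →
      -- it restricts to the corner
      (∀ g, ∀ a ∈ pimsnerCorner G π j e₀ he₀, Γ g a ∈ pimsnerCorner G π j e₀ he₀) ∧
      -- the fixed point algebra of the corner is `ι(B)`
      (fixedPoints Γ (pimsnerCorner G π j e₀ he₀) : Set (pimsnerModule G π).toeplitz) =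
        Set.range (pimsnerIota G π j e₀) ∧
      -- the vacuum compression is an equivariant conditional expectation onto it
      ∃ Φ : pimsnerCorner G π j e₀ he₀ →ₗ[ℂ] (pimsnerModule G π).toeplitz,
        IsConditionalExpectation (pimsnerCorner G π j e₀ he₀)
          (fixedPoints Γ (pimsnerCorner G π j e₀ he₀)) Φ ∧
        (∀ g, ∀ a a' : pimsnerCorner G π j e₀ he₀,
          (a' : (pimsnerModule G π).toeplitz) = Γ g a → Φ a' = Γ g (Φ a)) ∧
        ∀ a : pimsnerCorner G π j e₀ he₀, ∃ b : B, Φ a = pimsnerIota G π j e₀ b ∧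
          (pimsnerModule G π).IsVacuumCompression a (j (b ⊗ₜ e₀)) := by
  have hp : IsStarProjection (j (1 ⊗ₜ e₀)) := he₀.isStarProjection_map
  choose α hα using fun g => exists_conj_aut hπ (U g) (hUE g)
  -- From `U_g p = p` and its adjoint `p U_g⋆ = p`, conjugation by `U_g` is trivial on the whole
  -- corner `p E p`.
  have hαp : ∀ g a, α g (j (1 ⊗ₜ e₀) * a * j (1 ⊗ₜ e₀)) = j (1 ⊗ₜ e₀) * a * j (1 ⊗ₜ e₀) :=
    fun g a => hπ (by
      have h := congrArg star (hUe g).1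
      rw [star_mul, ← map_star, hp.isSelfAdjoint.star_eq] at h
      rw [hα, map_mul, map_mul, ← mul_assoc, ← mul_assoc, (hUe g).1, mul_assoc, h])
  have hpp : ∀ g, α g (j (1 ⊗ₜ e₀)) = j (1 ⊗ₜ e₀) := fun g => by
    simpa only [hp.isIdempotentElem.eq] using hαp g (j (1 ⊗ₜ e₀))
  have hcorner := exists_corner_eq hj hJ ideal he₀
  obtain ⟨Γ₀, hΓ₀⟩ := exists_isQuasiFree (U := U) hπ hα
  refine ⟨⟨Γ₀, hΓ₀, fun Γ hΓ => MonoidHom.ext fun g => by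
    rw [hΓ.unique hα, hΓ₀.unique hα]⟩, fun Γ hΓ => ?_⟩
  have hW := tendsto_ip_pimsnerTwist (π := π) hα
  have hΓW := hΓ.unique hα
  have hp' := (pimsnerModule G π).isSelfAdjoint_toeplitzOf (isSelfAdjoint_map_one_tmul j he₀)
  refine ⟨fun g _ => Corr.map_mem_corner _ hΓW hpp hp' g, Set.ext fun T => ?_, _,
    Corr.isConditionalExpectation_vacExpectation _ hΓW hW hp hαp hp', fun g T T' hT => ?_,
    fun T => ?_⟩
  · refine (Corr.mem_fixedPoints_iff _ hΓW hW hp hαp hp' T).trans ⟨?_, ?_⟩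
    · rintro ⟨a, ha, rfl⟩
      obtain ⟨b, hb⟩ := hcorner a
      exact ⟨b, congrArg (pimsnerModule G π).toeplitzOf (hb.symm.trans ha)⟩
    · rintro ⟨b, rfl⟩
      exact ⟨_, corner_map_tmul he₀ b, rfl⟩
  · exact (congrArg ((pimsnerModule G π).vacExpectation _) hT).trans
      (Corr.vacExpectation_map _ hΓW hpp g T)
  -- The compression is already cut down by `p` on both sides, so it is itself of the form `b ⊗ e₀`.
  · obtain ⟨b, hb⟩ := hcorner ((pimsnerModule G π).vacCompression (j (1 ⊗ₜ e₀)) T)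
    have hb' := (Corr.mul_vacCompression_mul hp _).symm.trans hb
    exact ⟨b, congrArg (pimsnerModule G π).toeplitzOf hb',
      hb' ▸ Corr.isVacuumCompression_vacCompression hp
        (Corr.toeplitzOf_mul_mul_of_mem_corner hp hp' T.2)⟩
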